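/- Let $p,q>1$ be integers, $n=p+q$, $\gamma=(\gamma_1,\dots,\gamma_n)$ with all $\gamma_i>0$, $|\gamma|=\gamma_1+\dots+\gamma_n$, $|\gamma'|=\gamma_1+\dots+\gamma_p$, $|\gamma''|=\gamma_{p+1}+\dots+\gamma_n$, $x^\gamma=\prod_{i=1}^n x_i^{\gamma_i}$, $\mathbb{R}_n^+=\{x\in\mathbb{R}^n: x_1>0,\dots,x_n>0\}$ and $P(x)=x_1^2+\dots+x_p^2-x_{p+1}^2-\dots-x_{p+q}^2$. A test function is a complex-valued, compactly supported function $\varphi$ on the closed orthant $\overline{\mathbb{R}}{}_n^+$ that is infinitely differentiable up to the boundary and even in each variable: $\partial^{2m+1}\varphi/\partial x_i^{2m+1}=0$ on $x_i=0$ for all $m\ge 0$ and all $i$. Let $P^\lambda_{\gamma,+}$ be the functional $$(P^\lambda_{\gamma,+},\varphi)_\gamma=\int_{\{x\in\mathbb{R}_n^+:\,P(x)>0\}}P(x)^\lambda\varphi(x)\,x^\gamma\,dx ,$$ where the integral converges for $\operatorname{Re}\lambda>-1$ and is continued meromorphically to $\lambda\in\mathbb{C}$. With $S_d^+$ the part of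 the unit sphere of $\mathbb{R}^d$ with all coordinates positive, $dS_d$ its surface measure, and, for $\omega=(\omega',\omega'')$, $$\psi(r,s)=\frac12\int_{S_p^+}\int_{S_q^+}\varphi(r\omega',s\omega'')\,\omega^\gamma\,dS_p\,dS_q,$$ let, for $j=0,1,2,\dots$, $$(\delta^{(j)}_{\gamma,1}(P),\varphi)_\gamma=\int_0^\infty\left[\left(\frac1{2s}\frac{\partial}{\partial s}\right)^{j}\psi(r,s)\,s^{q+|\gamma''|-2}\right]_{s=r}r^{p+|\gamma'|-1}\,dr .$$ This integral converges for $j<\frac{n+|\gamma|-2}{2}$; for $j\ge\frac{n+|\gamma|-2}{2}$ it is understood as its regularization by analytic continuation, that is, as the value at $z=0$ of the meromorphic continuation of the integral of the same integrand multiplied by $r^{z}$ (convergent for large $\operatorname{Re}z$), when that continuation is regular at $z=0$. **Theorem 1.** Let $k\ge 1$ be an integer, and suppose that either $n+|\gamma|$ is not an integer, or $n+|\gamma|$ is an odd integer, or $n+|\gamma|$ is an even integer and $k<\frac{n+|\gamma|}{2}$. Then $P^\lambda_{\gamma,+}$ (which has a meromorphic continuation to $\mathbb{C}$) has a simple pole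 at $\lambda=-k$, with residue $$\operatorname*{res}_{\lambda=-k}P^\lambda_{\gamma,+}=\frac{(-1)^{k-1}}{(k-1)!}\,\delta^{(k-1)}_{\gamma,1}(P),$$ that is, the (possibly regularized) integral defining $\delta^{(k-1)}_{\gamma,1}(P)$ exists, $\lim_{\lambda\to-k}(\lambda+k)(P^\lambda_{\gamma,+},\varphi)_\gamma=\frac{(-1)^{k-1}}{(k-1)!}(\delta^{(k-1)}_{\gamma,1}(P),\varphi)_\gamma$ for every test function $\varphi$, and this residue is not the zero functional. -/

import Mathlib

open MeasureTheory Filter Topology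
open scoped ContDiff

noncomputable section

namespace ConePower

/-- The open orthant: all coordinates are positive. -/
def openOrthant (ι : Type) : Set (ι → ℝ) := {x | ∀ i, 0 < x i}

/-- The closed orthant: all coordinates are nonnegative. -/
def closedOrthant (ι : Type) : Set (ι → ℝ) := {x | ∀ i, 0 ≤ x i}

/-- Test functions on the closed orthant: complex valued, infinitely differentiable up to the
boundary, even with respect to each variable (all partial derivatives of odd order in `x i` vanish
on the face `x i = 0`), with compact support in the closed orthant.
Values outside the closed orthant play no role. -/
structure TestFunction (ι : Type) [Fintype ι] [DecidableEq ι] where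
  /-- The underlying function. -/
  toFun : (ι → ℝ) → ℂ
  smooth : ContDiffOn ℝ ∞ toFun (closedOrthant ι)
  even : ∀ i : ι, ∀ x ∈ closedOrthant ι, x i = 0 → ∀ m : ℕ,
    iteratedDerivWithin (2 * m + 1) (fun t : ℝ => toFun (Function.update x i t)) (Set.Ici 0) 0 = 0
  compactSupport : ∃ R : ℝ, ∀ x ∈ closedOrthant ι, R < ‖x‖ → toFun x = 0

instance (ι : Type) [Fintype ι] [DecidableEq ι] :
    CoeFun (TestFunction ι) (fun _ => (ι → ℝ) → ℂ) := ⟨TestFunction.toFun⟩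

/-- The weight `x ^ γ = ∏ x i ^ γ i`. -/
def weight {ι : Type} [Fintype ι] (γ : ι → ℝ) (x : ι → ℝ) : ℝ := ∏ i, x i ^ γ i

variable {p q : ℕ}

/-- The quadratic form `x_1² + … + x_p² - x_{p+1}² - … - x_{p+q}²`; a point of `ℝ^(p+q)` is
indexed by `Fin p ⊕ Fin q`. -/
def quadForm (x : Fin p ⊕ Fin q → ℝ) : ℝ :=
  ∑ i : Fin p, x (Sum.inl i) ^ 2 - ∑ j : Fin q, x (Sum.inr j) ^ 2

/-- The number `n + |γ|`, where `n = p + q`. -/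
def homDim (γ : Fin p ⊕ Fin q → ℝ) : ℝ := (p : ℝ) + (q : ℝ) + ∑ i, γ i

/-- The set of points of the open orthant where the quadratic form is positive. -/
def posRegion (p q : ℕ) : Set (Fin p ⊕ Fin q → ℝ) :=
  {x | x ∈ openOrthant (Fin p ⊕ Fin q) ∧ 0 < quadForm x}

/-- The function `P(x) ^ l * φ(x) * x ^ γ`. -/
def powerIntegrand (γ : Fin p ⊕ Fin q → ℝ) (l : ℂ) (φ : TestFunction (Fin p ⊕ Fin q))
    (x : Fin p ⊕ Fin q → ℝ) : ℂ :=
  (quadForm x : ℂ) ^ l * φ x * (weight γ x : ℂ)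

/-- `T l` is the weighted functional `P^l_{γ,+}` for every complex `l`: against each test function
it is the integral over the part `P > 0` of the open orthant where that converges, i.e. for
`Re l > -1`, and it is continued meromorphically in `l` to the whole plane. -/
def IsPowerFunctional (γ : Fin p ⊕ Fin q → ℝ) (T : ℂ → TestFunction (Fin p ⊕ Fin q) → ℂ) : Prop :=
  ∀ φ : TestFunction (Fin p ⊕ Fin q),
    MeromorphicOn (fun l => T l φ) Set.univ ∧
    ∀ l : ℂ, -1 < l.re →
      IntegrableOn (powerIntegrand γ l φ) (posRegion p q) ∧
      T l φ = ∫ x in posRegion p q, powerIntegrand γ l φ x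

/-- The part of the unit sphere of `ℝ^d` in the open orthant. -/
def posSphere (d : ℕ) : Set (Metric.sphere (0 : EuclideanSpace ℝ (Fin d)) 1) :=
  {θ | ∀ i, 0 < θ.1 i}

/-- The surface measure on the unit sphere of `ℝ^d`. -/
def surfaceMeasure (d : ℕ) : Measure (Metric.sphere (0 : EuclideanSpace ℝ (Fin d)) 1) :=
  (volume : Measure (EuclideanSpace ℝ (Fin d))).toSphere

/-- The spherical integral
`ψ(r,s) = 1/2 ∫_{S_p^+} ∫_{S_q^+} φ(r ω', s ω'') ω^γ dS_p dS_q`. -/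
def psi (γ : Fin p ⊕ Fin q → ℝ) (φ : TestFunction (Fin p ⊕ Fin q)) (r s : ℝ) : ℂ :=
  (1 / 2) * ∫ ω' in posSphere p, (∫ ω'' in posSphere q,
    φ (Sum.elim (fun i => r * ω'.1 i) (fun j => s * ω''.1 j)) *
      (weight γ (Sum.elim (fun i => ω'.1 i) (fun j => ω''.1 j)) : ℂ)
      ∂(surfaceMeasure q)) ∂(surfaceMeasure p)

/-- The operator `f ↦ (1 / (2 s)) ∂f/∂s`. -/
def halfRadialDeriv (f : ℝ → ℂ) : ℝ → ℂ := fun s => (1 / (2 * (s : ℂ))) * deriv f s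

/-- The function
`r ↦ [ ((1/(2s)) ∂/∂s)^j ( ψ(r,s) s^(q+|γ''|-2) ) ]_{s=r} r^(p+|γ'|-1)`. -/
def deltaIntegrand (γ : Fin p ⊕ Fin q → ℝ) (j : ℕ) (φ : TestFunction (Fin p ⊕ Fin q)) (r : ℝ) :
    ℂ :=
  (halfRadialDeriv^[j]
      (fun s => psi γ φ r s * ((s ^ ((q : ℝ) + ∑ i, γ (Sum.inr i) - 2) : ℝ) : ℂ))) r *
    ((r ^ ((p : ℝ) + ∑ i, γ (Sum.inl i) - 1) : ℝ) : ℂ)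

/-- `L` is the regularization, by analytic continuation, of the possibly divergent integral of `f`
over `(0, ∞)`: the integral of `r ^ z * f r`, convergent for `Re z` large, extends to a
meromorphic function of `z` that is analytic at `z = 0` with value `L` there. -/
def IsRegularizedIntegral (f : ℝ → ℂ) (L : ℂ) : Prop :=
  ∃ F : ℂ → ℂ, MeromorphicOn F Set.univ ∧ AnalyticAt ℂ F 0 ∧ F 0 = L ∧
    ∃ c : ℝ, ∀ z : ℂ, c < z.re →
      IntegrableOn (fun r : ℝ => (r : ℂ) ^ z * f r) (Set.Ioi 0) ∧
      F z = ∫ r in Set.Ioi (0 : ℝ), (r : ℂ) ^ z * f r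

/-- `D` is the functional `δ^{(j)}_{γ,1}(P)`: the integral of `deltaIntegrand γ j φ` over `(0, ∞)`,
which converges for `j < (n + |γ| - 2) / 2`, and its regularization for the other `j`. -/
def IsConeDelta (γ : Fin p ⊕ Fin q → ℝ) (j : ℕ) (D : TestFunction (Fin p ⊕ Fin q) → ℂ) : Prop :=
  ∀ φ : TestFunction (Fin p ⊕ Fin q),
    ((j : ℝ) < (homDim γ - 2) / 2 →
      IntegrableOn (deltaIntegrand γ j φ) (Set.Ioi 0) ∧
      D φ = ∫ r in Set.Ioi (0 : ℝ), deltaIntegrand γ j φ r) ∧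
    ((homDim γ - 2) / 2 ≤ (j : ℝ) → IsRegularizedIntegral (deltaIntegrand γ j φ) (D φ))

/-- The family of functionals `T l` has a simple pole at `l = z` with residue the functional `R`:
against every test function it is meromorphic at `z` and `(l - z) T l → R` as `l → z`, and `R` is
not the zero functional, so that the pole is a genuine one. -/
def HasSimplePoleWithResidue {X : Type} (T : ℂ → X → ℂ) (z : ℂ) (R : X → ℂ) : Prop :=
  (∀ φ : X, MeromorphicAt (fun l => T l φ) z ∧
    Tendsto (fun l => (l - z) * T l φ) (𝓝[≠] z) (𝓝 (R φ))) ∧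
  ∃ φ : X, R φ ≠ 0

end ConePower

end

/-! Put N = n + |γ| and b = q + |γ''| - 1. In polar coordinates x = (r ω', s ω'') the form is P = r²
- s², and s = r t turns the functional into 2 ∫∫ r^(α-1) (1 - t²)^λ t^b U(r,t) dt dr over r > 0, 0 <
t < 1, with α = 2 λ + N and U(r,t) = ψ(r, r t) (`integral_powerIntegrand`, in terms of
`coneIntegral`). The even extension of a test function is smooth on the whole space, so U extends to
a smooth function on the plane, even in r and zero for large |r|. The cone (t = 1) and its vertex (r
= 0) now give separate singularities.

At t = 1, integration by parts in t expresses the integral at λ through integrals at λ + 1, at the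
price of a division by λ + 1 (`coneIntegral_slope`). Iterating, the residue at λ = -(j+1) is (-1)^j
/ j! times the integral with λ = 0 of an explicit operator applied to U (`tendsto_slopeExt`); the
outermost factor of that operator makes the integrand a t-derivative, so only the value at t = 1
remains (`coneIntegral_slope_boundary`).

At r = 0, the product of the operators r ∂/∂r - 2 i for i < m removes the Taylor terms of U below
order 2 m, the odd ones being zero by evenness, and under the integral it is multiplication by the
product of the -(α + 2 i) (`coneIntegral_taylorKiller`). This continues the integral to Re α > -2 m,
with possible poles only at α = -2 i. At λ = -k one has α = N - 2 k, and this is never -2 i exactly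
because N is not an even integer ≤ 2 k (`homDim_sub_ne_of_cases`).

The operator from the t-integrations is the one produced by j applications of (1/(2s)) ∂/∂s to
s^(b-1) U(r, s/r) (`halfRadialDeriv_iterate_rpow_mul`). Hence the residue is the integral defining
δ^(j), and its regularization by r^z is the same continuation in α (`isConeDelta_coneDelta`). For
nonvanishing, a test function is chosen for which s^(b-1) ψ(r,s) is locally a multiple of exp(s²), a
fixed point of (1/(2s)) ∂/∂s; the integrand is then nonnegative, nonzero and supported away from the
vertex (`IsConeDelta.exists_ne_zero`). -/

noncomputable section
namespace ConePower

/-! ### Meromorphic continuation and holomorphic parameter integrals -/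

/-- The identity theorem for meromorphic functions, on a preconnected set. -/
theorem eventuallyEq_of_meromorphicOn {f g : ℂ → ℂ} {U : Set ℂ} (hU : IsPreconnected U)
    (hf : MeromorphicOn f U) (hg : MeromorphicOn g U) {z₀ : ℂ} (hz₀ : z₀ ∈ U)
    (h : f =ᶠ[𝓝[≠] z₀] g) {z : ℂ} (hz : z ∈ U) : f =ᶠ[𝓝[≠] z] g := by
  have hfg : MeromorphicOn (f - g) U := hf.sub hg
  by_contra hne
  have h1 : meromorphicOrderAt (f - g) z ≠ ⊤ := by
    intro htop
    rw [meromorphicOrderAt_eq_top_iff] at htop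
    exact hne (htop.mono fun w hw => sub_eq_zero.1 hw)
  have h2 := hfg.meromorphicOrderAt_ne_top_of_isPreconnected hU hz hz₀ h1
  refine h2 (meromorphicOrderAt_eq_top_iff.2 (h.mono fun w hw => ?_))
  simp [hw]

theorem isPreconnected_halfPlane (B : ℝ) : IsPreconnected {z : ℂ | B < z.re} :=
  (convex_halfSpace_re_gt B).isPreconnected

theorem isOpen_halfPlane (B : ℝ) : IsOpen {z : ℂ | B < z.re} :=
  isOpen_lt continuous_const Complex.continuous_re

/-- Two meromorphic functions on a half plane which agree far to the right agree up to isolated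
points. -/
theorem eventuallyEq_of_eq_of_re_gt {f g : ℂ → ℂ} {B c : ℝ}
    (hf : MeromorphicOn f {z | B < z.re}) (hg : MeromorphicOn g {z | B < z.re})
    (h : ∀ z : ℂ, c < z.re → f z = g z) {z : ℂ} (hz : B < z.re) : f =ᶠ[𝓝[≠] z] g := by
  refine eventuallyEq_of_meromorphicOn (isPreconnected_halfPlane B) hf hg
    (z₀ := ((max B c + 1 : ℝ) : ℂ)) ?_ ?_ hz
  · simp only [Set.mem_ofPred_eq, Complex.ofReal_re]
    linarith [le_max_left B c]
  · apply eventually_nhdsWithin_of_eventually_nhds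
    filter_upwards [(isOpen_halfPlane c).mem_nhds
      (show c < ((max B c + 1 : ℝ) : ℂ).re by
        rw [Complex.ofReal_re]; linarith [le_max_right B c])] with w hw
    exact h w hw

/-- A function with meromorphic extensions to all half planes has a meromorphic extension to the
plane. -/
theorem exists_meromorphic_extension {I : ℂ → ℂ} {c : ℝ}
    (hext : ∀ B : ℝ, ∃ F : ℂ → ℂ, MeromorphicOn F {z | B < z.re} ∧
      ∀ z : ℂ, c < z.re → F z = I z) :
    ∃ F : ℂ → ℂ, MeromorphicOn F Set.univ ∧ ∀ z : ℂ, c < z.re → F z = I z := by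
  choose F hF hFI using hext
  -- Extensions to different half planes are glued along vertical strips. Near a point with ⌊Re⌋ = n
  -- only the extensions of index n - 1 and n - 2 occur, and they agree up to isolated points.
  refine ⟨fun z => F (⌊z.re⌋ - 1 : ℤ) z, fun z₀ _ => ?_, fun z hz => hFI _ z hz⟩
  set n := ⌊z₀.re⌋ with hn
  have hn1 : (n : ℝ) ≤ z₀.re := Int.floor_le _
  have hn2 : z₀.re < n + 1 := Int.lt_floor_add_one _
  have hmer : MeromorphicAt (F (n - 2 : ℤ)) z₀ := hF _ z₀ (by
    simp only [Set.mem_ofPred_eq]; push_cast; linarith)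
  refine hmer.congr ?_
  have e : F (n - 2 : ℤ) =ᶠ[𝓝[≠] z₀] F (n - 1 : ℤ) := by
    refine eventuallyEq_of_eq_of_re_gt (B := (n - 1 : ℤ)) (c := c) ?_ (hF _) ?_ ?_
    · refine (hF _).mono_set fun z hz => ?_
      simp only [Set.mem_ofPred_eq] at hz ⊢
      push_cast at hz ⊢
      linarith
    · intro z hz
      rw [hFI _ z hz, hFI _ z hz]
    · push_cast; linarith
  have hnear : ∀ᶠ z in 𝓝[≠] z₀, (n : ℝ) - 1 < z.re ∧ z.re < (n : ℝ) + 1 := by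
    apply eventually_nhdsWithin_of_eventually_nhds
    refine (Complex.continuous_re.continuousAt.eventually_const_lt (by linarith)).and
      (Complex.continuous_re.continuousAt.eventually_lt_const hn2)
  filter_upwards [e, hnear] with z hz hz2
  by_cases h : (n : ℝ) ≤ z.re
  · have : ⌊z.re⌋ = n := Int.floor_eq_iff.2 ⟨h, hz2.2⟩
    simp only [this]
    exact hz
  · have : ⌊z.re⌋ = n - 1 := Int.floor_eq_iff.2 ⟨by push_cast; linarith, by push_cast; linarith⟩
    simp only [this]
    congr 2
    ring

/-- A dominated integral of a function depending holomorphically on a parameter is holomorphic. -/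
theorem differentiableAt_integral_of_dominated {X : Type*} [MeasurableSpace X] {μ : Measure X}
    {F : ℂ → X → ℂ} {z₀ : ℂ} {ε : ℝ} (hε : 0 < ε) {bound : X → ℝ}
    (hmeas : ∀ z ∈ Metric.ball z₀ ε, AEStronglyMeasurable (F z) μ)
    (hdiff : ∀ᵐ x ∂μ, DifferentiableOn ℂ (fun z => F z x) (Metric.ball z₀ ε))
    (hbound : ∀ᵐ x ∂μ, ∀ z ∈ Metric.ball z₀ ε, ‖F z x‖ ≤ bound x)
    (hint : Integrable bound μ) :
    DifferentiableAt ℂ (fun z => ∫ x, F z x ∂μ) z₀ := by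
  have hsub : ∀ z ∈ Metric.ball z₀ (ε / 2), Metric.closedBall z (ε / 4) ⊆ Metric.ball z₀ ε := by
    intro z hz w hw
    rw [Metric.mem_ball] at hz ⊢
    rw [Metric.mem_closedBall] at hw
    linarith [dist_triangle w z z₀]
  have hz₀ : z₀ ∈ Metric.ball z₀ ε := Metric.mem_ball_self hε
  have hda : ∀ᵐ x ∂μ, ∀ z ∈ Metric.ball z₀ ε, HasDerivAt (fun w => F w x)
      (deriv (fun w => F w x) z) z := by
    filter_upwards [hdiff] with x hx z hz
    exact (hx.differentiableAt (Metric.isOpen_ball.mem_nhds hz)).hasDerivAt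
  refine (hasDerivAt_integral_of_dominated_loc_of_deriv_le
    (F' := fun z x => deriv (fun w => F w x) z) (bound := fun x => bound x / (ε / 4))
    (Metric.ball_mem_nhds z₀ (half_pos hε)) ?_ ?_ ?_ ?_ (hint.div_const _) ?_).2.differentiableAt
  · filter_upwards [Metric.ball_mem_nhds z₀ hε] with z hz using hmeas z hz
  · exact hint.mono' (hmeas z₀ hz₀) (hbound.mono fun x hx => hx z₀ hz₀)
  -- Measurability of the derivative in the parameter: it is a pointwise limit of difference
  -- quotients along the steps `u n`.
  · set u : ℕ → ℂ := fun n => ((ε / 2 / (n + 1) : ℝ) : ℂ) with hu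
    have hu0 : Tendsto u atTop (𝓝 0) := by
      have h1 : Tendsto (fun n : ℕ => (ε / 2 / (n + 1) : ℝ)) atTop (𝓝 0) :=
        tendsto_const_nhds.div_atTop (tendsto_atTop_add_const_right _ _ tendsto_natCast_atTop_atTop)
      simpa [hu, Function.comp_def] using (Complex.continuous_ofReal.tendsto 0).comp h1
    have hupos : ∀ n : ℕ, 0 < ε / 2 / ((n : ℝ) + 1) := fun n => by positivity
    have hune : ∀ n, u n ≠ 0 := fun n => by
      simp only [hu]
      exact_mod_cast (hupos n).ne'
    refine aestronglyMeasurable_of_tendsto_ae atTop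
      (f := fun n x => (u n)⁻¹ • (F (z₀ + u n) x - F z₀ x)) (fun n => ?_) ?_
    · suffices hmem : z₀ + u n ∈ Metric.ball z₀ ε from
        ((hmeas _ hmem).sub (hmeas _ hz₀)).const_smul (u n)⁻¹
      rw [Metric.mem_ball, dist_eq_norm, add_sub_cancel_left, hu, Complex.norm_real,
        Real.norm_of_nonneg (hupos n).le]
      have h2 : ε / 2 / ((n : ℝ) + 1) ≤ ε / 2 := div_le_self (by linarith) (by
        have : (0 : ℝ) ≤ n := n.cast_nonneg
        linarith)
      linarith
    · filter_upwards [hda] with x hx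
      have := (hasDerivAt_iff_tendsto_slope_zero.1 (hx z₀ hz₀)).comp
        (tendsto_nhdsWithin_iff.2 ⟨hu0, Eventually.of_forall hune⟩)
      exact this
  · filter_upwards [hbound, hdiff] with x hx hd z hz
    -- Cauchy's estimate on circles of radius ε/4 turns the bound on the function into one on its
    -- derivative.
    refine Complex.norm_deriv_le_of_forall_mem_sphere_norm_le (by positivity) ?_ ?_
    · refine (hd.mono ?_).diffContOnCl
      rw [closure_ball _ (by positivity)]
      exact hsub z hz
    · intro w hw
      exact hx w (hsub z hz (Metric.sphere_subset_closedBall hw))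
  · filter_upwards [hda] with x hx z hz
    exact hx z (Metric.ball_subset_ball (by linarith) hz)

end ConePower
end

noncomputable section
namespace ConePower

/-! ### Smoothness of the even extension of a test function -/

section EvenExtension

set_option linter.unusedSectionVars false

variable {ι : Type} [Fintype ι] [DecidableEq ι]

theorem closedOrthant_eq_pi : closedOrthant ι = Set.univ.pi fun _ => Set.Ici (0 : ℝ) := by
  ext x; simp only [closedOrthant, Set.mem_ofPred_eq, Set.mem_univ_pi, Set.mem_Ici]

theorem uniqueDiffOn_closedOrthant : UniqueDiffOn ℝ (closedOrthant ι) := by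
  rw [closedOrthant_eq_pi]
  exact UniqueDiffOn.univ_pi fun _ => uniqueDiffOn_Ici 0

theorem isClosed_closedOrthant : IsClosed (closedOrthant ι) := by
  rw [closedOrthant_eq_pi]
  exact isClosed_set_pi fun _ _ => isClosed_Ici

/-- Symmetry of second derivatives within a set holds at points of the closure of its interior; this
gives it up to the boundary in `orthantPartial_comm`. -/
theorem closedOrthant_subset_closure_interior :
    closedOrthant ι ⊆ closure (interior (closedOrthant ι)) := by
  rw [closedOrthant_eq_pi, interior_pi_set Set.finite_univ, closure_pi_set]
  simp

/-- The partial derivative within the closed orthant. -/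
def orthantPartial (i : ι) (f : (ι → ℝ) → ℂ) : (ι → ℝ) → ℂ :=
  fun x => fderivWithin ℝ f (closedOrthant ι) x (Pi.single i 1)

theorem contDiffOn_orthantPartial {f : (ι → ℝ) → ℂ} (hf : ContDiffOn ℝ ∞ f (closedOrthant ι))
    (i : ι) : ContDiffOn ℝ ∞ (orthantPartial i f) (closedOrthant ι) :=
  (hf.fderivWithin uniqueDiffOn_closedOrthant (by simp)).clm_apply contDiffOn_const

theorem contDiffOn_orthantPartial_iterate {f : (ι → ℝ) → ℂ}
    (hf : ContDiffOn ℝ ∞ f (closedOrthant ι)) (i : ι) (m : ℕ) :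
    ContDiffOn ℝ ∞ ((orthantPartial i)^[m] f) (closedOrthant ι) := by
  induction m with
  | zero => exact hf
  | succ m ih =>
    rw [Function.iterate_succ_apply']
    exact contDiffOn_orthantPartial ih i

theorem eqOn_orthantPartial {f g : (ι → ℝ) → ℂ} (h : Set.EqOn f g (closedOrthant ι)) (i : ι) :
    Set.EqOn (orthantPartial i f) (orthantPartial i g) (closedOrthant ι) := fun x hx => by
  simp only [orthantPartial]
  rw [fderivWithin_congr h (h hx)]

theorem orthantPartial_comm {f : (ι → ℝ) → ℂ} (hf : ContDiffOn ℝ ∞ f (closedOrthant ι)) (i j : ι) :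
    Set.EqOn (orthantPartial i (orthantPartial j f)) (orthantPartial j (orthantPartial i f))
      (closedOrthant ι) := by
  intro x hx
  have hd : DifferentiableWithinAt ℝ (fderivWithin ℝ f (closedOrthant ι)) (closedOrthant ι) x :=
    ((hf.fderivWithin uniqueDiffOn_closedOrthant (m := ∞) (by simp)).differentiableOn (by simp)) x hx
  have key : ∀ i j : ι, orthantPartial i (orthantPartial j f) x =
      fderivWithin ℝ (fderivWithin ℝ f (closedOrthant ι)) (closedOrthant ι) x (Pi.single i 1)
        (Pi.single j 1) := by
    intro i j
    change fderivWithin ℝ (fun y => fderivWithin ℝ f (closedOrthant ι) y (Pi.single j 1))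
      (closedOrthant ι) x (Pi.single i 1) = _
    rw [fderivWithin_clm_apply (uniqueDiffOn_closedOrthant x hx) hd
      (differentiableWithinAt_const _)]
    simp
  rw [key, key]
  exact ((hf x hx).isSymmSndFDerivWithinAt
    (by rw [minSmoothness_of_isRCLikeNormedField]; exact WithTop.coe_le_coe.2 (le_top : (2 : ℕ∞) ≤ ⊤)) uniqueDiffOn_closedOrthant
    (closedOrthant_subset_closure_interior hx) hx).eq _ _

theorem orthantPartial_iterate_comm {f : (ι → ℝ) → ℂ} (hf : ContDiffOn ℝ ∞ f (closedOrthant ι))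
    (i j : ι) (m : ℕ) :
    Set.EqOn ((orthantPartial i)^[m] (orthantPartial j f))
      (orthantPartial j ((orthantPartial i)^[m] f)) (closedOrthant ι) := by
  induction m with
  | zero => exact fun x _ => rfl
  | succ m ih =>
    rw [Function.iterate_succ_apply', Function.iterate_succ_apply']
    exact (eqOn_orthantPartial ih i).trans
      (orthantPartial_comm (contDiffOn_orthantPartial_iterate hf i m) i j)

theorem add_smul_single_mem_closedOrthant {x : ι → ℝ} (hx : x ∈ closedOrthant ι) (j : ι) {s : ℝ}
    (hs : 0 ≤ s) : x + s • Pi.single j 1 ∈ closedOrthant ι := fun i => by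
  by_cases h : i = j
  · subst h; simpa using add_nonneg (hx i) hs
  · simpa [h] using hx i

/-- The derivative along the coordinate direction `j`, as a one sided derivative. -/
theorem hasDerivWithinAt_orthantPartial {f : (ι → ℝ) → ℂ}
    (hf : ContDiffOn ℝ ∞ f (closedOrthant ι)) (j : ι) {x : ι → ℝ} {t : ℝ} (ht : 0 ≤ t)
    (hx : x ∈ closedOrthant ι) :
    HasDerivWithinAt (fun s : ℝ => f (x + s • Pi.single j 1))
      (orthantPartial j f (x + t • Pi.single j 1)) (Set.Ici 0) t := by
  have h1 : HasFDerivWithinAt f (fderivWithin ℝ f (closedOrthant ι) (x + t • Pi.single j 1))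
      (closedOrthant ι) (x + t • Pi.single j 1) :=
    (hf.differentiableOn (by simp) _ (add_smul_single_mem_closedOrthant hx j ht)).hasFDerivWithinAt
  have h2 : HasDerivWithinAt (fun s : ℝ => x + s • (Pi.single j 1 : ι → ℝ)) (Pi.single j 1)
      (Set.Ici 0) t := by
    simpa using (((hasDerivAt_id t).smul_const (Pi.single j 1 : ι → ℝ)).const_add x).hasDerivWithinAt
  exact h1.comp_hasDerivWithinAt t h2 fun s hs => add_smul_single_mem_closedOrthant hx j hs

/-- For j ≠ i, moving in the direction j stays in the face x i = 0, so the derivative is that of a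
constant. -/
theorem orthantPartial_eq_zero_of_face {g : (ι → ℝ) → ℂ} (hg : ContDiffOn ℝ ∞ g (closedOrthant ι))
    {i j : ι} (hij : i ≠ j) (h : ∀ x ∈ closedOrthant ι, x i = 0 → g x = 0) {x : ι → ℝ}
    (hx : x ∈ closedOrthant ι) (hxi : x i = 0) : orthantPartial j g x = 0 := by
  have h1 := hasDerivWithinAt_orthantPartial hg j (le_refl (0 : ℝ)) hx
  rw [zero_smul, add_zero] at h1
  have h2 : HasDerivWithinAt (fun s : ℝ => g (x + s • Pi.single j 1)) 0 (Set.Ici 0) 0 :=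
    (hasDerivWithinAt_const (0 : ℝ) (Set.Ici 0) (0 : ℂ)).congr_of_mem (fun s hs => by
      refine h _ (add_smul_single_mem_closedOrthant hx j hs) ?_
      simp [hxi, hij]) Set.self_mem_Ici
  exact (uniqueDiffOn_Ici (0 : ℝ) 0 Set.self_mem_Ici).eq_deriv _ h1 h2

/-- Translates the evenness condition of `TestFunction`, written with one-variable derivatives, into
iterates of `orthantPartial`, which can be commuted and differentiated further. -/
theorem iteratedDerivWithin_update_eq {f : (ι → ℝ) → ℂ} (hf : ContDiffOn ℝ ∞ f (closedOrthant ι))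
    (i : ι) {x : ι → ℝ} (hx : x ∈ closedOrthant ι) (hxi : x i = 0) (m : ℕ) :
    Set.EqOn (iteratedDerivWithin m (fun t : ℝ => f (Function.update x i t)) (Set.Ici 0))
      (fun t => (orthantPartial i)^[m] f (Function.update x i t)) (Set.Ici 0) := by
  have hupd : ∀ t : ℝ, Function.update x i t = x + t • Pi.single i 1 := by
    intro t
    ext j
    by_cases h : j = i
    · subst h; simp [hxi]
    · simp [h]
  simp only [hupd]
  induction m with
  | zero => intro t _; simp
  | succ m ih =>
    intro t ht
    rw [iteratedDerivWithin_succ, derivWithin_congr ih (ih ht), Function.iterate_succ_apply']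
    exact (hasDerivWithinAt_orthantPartial (contDiffOn_orthantPartial_iterate hf i m) i ht
      hx).derivWithin (uniqueDiffOn_Ici (0 : ℝ) t ht)

/-- A smooth function on the closed orthant has parity `ε` if on the face `x i = 0` its normal
derivatives of order `m` vanish whenever `m + ε i` is odd. -/
structure HasParity (f : (ι → ℝ) → ℂ) (ε : ι → ℕ) : Prop where
  smooth : ContDiffOn ℝ ∞ f (closedOrthant ι)
  vanish : ∀ i, ∀ x ∈ closedOrthant ι, x i = 0 → ∀ m, Odd (m + ε i) →
    (orthantPartial i)^[m] f x = 0

/-- A normal derivative shifts the order by one and so flips the parity in that variable; tangential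
derivatives commute with the normal ones and keep the vanishing on the face. Closure under
differentiation is the reason for general parities `ε`. -/
theorem HasParity.orthantPartial {f : (ι → ℝ) → ℂ} {ε : ι → ℕ} (hf : HasParity f ε) (j : ι) :
    HasParity (orthantPartial j f) (ε + Pi.single j 1) := by
  refine ⟨contDiffOn_orthantPartial hf.smooth j, fun i x hx hxi m hm => ?_⟩
  by_cases hij : i = j
  · subst hij
    rw [← Function.iterate_succ_apply]
    refine hf.vanish i x hx hxi _ ?_
    simp only [Pi.add_apply, Pi.single_eq_same] at hm
    rwa [Nat.succ_eq_add_one, show m + 1 + ε i = m + (ε i + 1) by ring]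
  · rw [orthantPartial_iterate_comm hf.smooth i j m hx]
    refine orthantPartial_eq_zero_of_face (contDiffOn_orthantPartial_iterate hf.smooth i m) hij
      (fun y hy hyi => hf.vanish i y hy hyi m ?_) hx hxi
    simpa [hij] using hm

theorem TestFunction.hasParity (φ : TestFunction ι) : HasParity φ.toFun 0 := by
  refine ⟨φ.smooth, fun i x hx hxi m hm => ?_⟩
  obtain ⟨l, hl⟩ := hm
  have h := iteratedDerivWithin_update_eq φ.smooth i hx hxi m (Set.self_mem_Ici (a := (0 : ℝ)))
  have hx' : Function.update x i 0 = x := by rw [← hxi, Function.update_eq_self]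
  simp only [hx'] at h
  rw [← h]
  simp only [Pi.zero_apply, add_zero] at hl
  rw [hl]
  exact φ.even i x hx hxi l

/-- The sign `1` of nonnegative numbers, `-1` of negative numbers. -/
def rsign (t : ℝ) : ℝ := if t < 0 then -1 else 1

/-- The extension of a function on the closed orthant to the whole space, with parity `ε`. -/
def parityExtension (ε : ι → ℕ) (f : (ι → ℝ) → ℂ) (x : ι → ℝ) : ℂ :=
  ((∏ i, rsign (x i) ^ ε i : ℝ) : ℂ) * f fun i => |x i|

/-- The sign vector attached to a Boolean vector. -/
def signVec (b : ι → Bool) (i : ι) : ℝ := if b i then 1 else -1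

/-- Multiplication by a sign vector. -/
def reflection (b : ι → Bool) : (ι → ℝ) →L[ℝ] (ι → ℝ) :=
  ContinuousLinearMap.pi fun i => signVec b i • ContinuousLinearMap.proj i

theorem reflection_apply (b : ι → Bool) (x : ι → ℝ) (i : ι) :
    reflection b x i = signVec b i * x i := by
  simp [reflection]

/-- On each closed orthant the extension is a signed reflection of `f`. The sign is ambiguous only
where x i = 0: for `ε i` odd `f` vanishes there, for `ε i` even the sign is squared away. -/
theorem HasParity.parityExtension_eq {f : (ι → ℝ) → ℂ} {ε : ι → ℕ} (hf : HasParity f ε)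
    (b : ι → Bool) {x : ι → ℝ} (hx : reflection b x ∈ closedOrthant ι) :
    parityExtension ε f x = ((∏ i, signVec b i ^ ε i : ℝ) : ℂ) * f (reflection b x) := by
  have habs : (fun i => |x i|) = reflection b x := by
    ext i
    have h := hx i
    rw [reflection_apply] at h ⊢
    unfold signVec at h ⊢
    split_ifs at h ⊢
    · rw [one_mul] at h ⊢; exact abs_of_nonneg h
    · rw [abs_of_nonpos (by linarith)]; ring
  unfold parityExtension
  rw [habs]
  by_cases hz : ∃ i, x i = 0 ∧ Odd (ε i)
  · obtain ⟨i, hi, ho⟩ := hz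
    have h0 : f (reflection b x) = 0 :=
      hf.vanish i _ hx (by rw [reflection_apply, hi, mul_zero]) 0 (by simpa using ho)
    rw [h0, mul_zero, mul_zero]
  · push Not at hz
    congr 2
    refine Finset.prod_congr rfl fun i _ => ?_
    have h := hx i
    rw [reflection_apply] at h
    unfold rsign
    unfold signVec at h ⊢
    by_cases h0 : x i = 0
    · obtain ⟨m, hm⟩ := Nat.not_odd_iff_even.1 (hz i h0)
      rw [hm, ← two_mul, pow_mul, pow_mul]
      split_ifs <;> norm_num
    · have h0' := lt_or_gt_of_ne h0
      split_ifs at h ⊢ <;> first | rfl | (exfalso; rcases h0' with h1 | h1 <;> linarith)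

/-- The derivative is written with the parity extensions of the partial derivatives, so its formula
does not depend on the orthant `b`. -/
theorem HasParity.hasFDerivWithinAt_parityExtension {f : (ι → ℝ) → ℂ} {ε : ι → ℕ}
    (hf : HasParity f ε) (b : ι → Bool) (x : ι → ℝ) :
    HasFDerivWithinAt (parityExtension ε f)
      (∑ j, (ContinuousLinearMap.proj j : (ι → ℝ) →L[ℝ] ℝ).smulRight
        (parityExtension (ε + Pi.single j 1) (ConePower.orthantPartial j f) x))
      (reflection b ⁻¹' closedOrthant ι) x := by
  by_cases hx : reflection b x ∈ closedOrthant ι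
  swap
  · refine HasFDerivWithinAt.of_notMem_closure ?_
    rwa [(isClosed_closedOrthant.preimage (reflection b).continuous).closure_eq]
  have h1 : HasFDerivWithinAt f (fderivWithin ℝ f (closedOrthant ι) (reflection b x))
      (closedOrthant ι) (reflection b x) :=
    (hf.smooth.differentiableOn (by simp) _ hx).hasFDerivWithinAt
  have h2 := (h1.comp x (reflection b).hasFDerivAt.hasFDerivWithinAt
    (Set.mapsTo_preimage (reflection b) (closedOrthant ι))).const_mul
      ((∏ i, signVec b i ^ ε i : ℝ) : ℂ)
  refine (h2.congr (fun y hy => hf.parityExtension_eq b hy)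
    (hf.parityExtension_eq b hx)).congr_fderiv ?_
  ext v
  have hv : reflection b v = ∑ j, (signVec b j * v j) • (Pi.single j 1 : ι → ℝ) := by
    ext i
    simp [reflection_apply, Finset.sum_apply, Pi.single_apply]
  simp only [_root_.smul_apply, ContinuousLinearMap.comp_apply,
    _root_.sum_apply, ContinuousLinearMap.smulRight_apply,
    ContinuousLinearMap.proj_apply]
  rw [hv, map_sum, Finset.smul_sum]
  refine Finset.sum_congr rfl fun j _ => ?_
  rw [(hf.orthantPartial j).parityExtension_eq b hx, map_smul]
  have hp : ∏ i, signVec b i ^ ((ε + Pi.single j 1 : ι → ℕ) i) = (∏ i, signVec b i ^ ε i) * signVec b j := by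
    simp only [Pi.add_apply, pow_add, Finset.prod_mul_distrib]
    congr 1
    rw [Finset.prod_eq_single j]
    · simp
    · intro i _ hi; simp [hi]
    · simp
  rw [hp]
  simp only [ConePower.orthantPartial, Complex.real_smul, smul_eq_mul]
  push_cast
  ring

theorem hasFDerivWithinAt_biUnion_finset {κ : Type*} {E F : Type*} [NormedAddCommGroup E]
    [NormedSpace ℝ E] [NormedAddCommGroup F] [NormedSpace ℝ F] {f : E → F} {f' : E →L[ℝ] F} {x : E}
    (T : Finset κ) {s : κ → Set E} (h : ∀ k ∈ T, HasFDerivWithinAt f f' (s k) x) :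
    HasFDerivWithinAt f f' (⋃ k ∈ T, s k) x := by
  classical
  induction T using Finset.induction_on with
  | empty => simp
  | insert a T _ ih =>
    rw [Finset.set_biUnion_insert]
    exact (h a (Finset.mem_insert_self a T)).union
      (ih fun k hk => h k (Finset.mem_insert_of_mem hk))

/-- Finitely many closed orthants cover the space, and the derivatives within them coincide. -/
theorem HasParity.hasFDerivAt_parityExtension {f : (ι → ℝ) → ℂ} {ε : ι → ℕ}
    (hf : HasParity f ε) (x : ι → ℝ) :
    HasFDerivAt (parityExtension ε f)
      (∑ j, (ContinuousLinearMap.proj j : (ι → ℝ) →L[ℝ] ℝ).smulRight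
        (parityExtension (ε + Pi.single j 1) (ConePower.orthantPartial j f) x)) x := by
  rw [← hasFDerivWithinAt_univ]
  have hU : (⋃ b ∈ (Finset.univ : Finset (ι → Bool)), reflection b ⁻¹' closedOrthant ι) =
      Set.univ := by
    refine Set.eq_univ_of_forall fun y => ?_
    simp only [Finset.mem_univ, Set.iUnion_true, Set.mem_iUnion, Set.mem_preimage]
    refine ⟨fun i => decide (0 ≤ y i), fun i => ?_⟩
    rw [reflection_apply]
    unfold signVec
    by_cases h : 0 ≤ y i
    · simp [h]
    · simp only [h, decide_false, Bool.false_eq_true, if_false]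
      linarith
  rw [← hU]
  exact hasFDerivWithinAt_biUnion_finset _ fun b _ => hf.hasFDerivWithinAt_parityExtension b x

/-- The partial derivatives of the extension are extensions of the same kind, so the
differentiability order can be raised inductively. -/
theorem HasParity.contDiff_parityExtension {f : (ι → ℝ) → ℂ} {ε : ι → ℕ} (hf : HasParity f ε) :
    ContDiff ℝ ∞ (parityExtension ε f) := by
  refine contDiff_infty.2 fun n => ?_
  induction n generalizing f ε with
  | zero =>
    refine contDiff_zero.2 (continuous_iff_continuousAt.2 fun x => ?_)
    exact (hf.hasFDerivAt_parityExtension x).continuousAt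
  | succ n ih =>
    push_cast
    rw [contDiff_succ_iff_hasFDerivAt]
    refine ⟨_, ContDiff.sum fun j _ => ?_, fun x => hf.hasFDerivAt_parityExtension x⟩
    exact contDiff_const.smulRight (ih (hf.orthantPartial j))

/-- The even extension of a test function. -/
def TestFunction.evenExt (φ : TestFunction ι) (x : ι → ℝ) : ℂ := φ fun i => |x i|

theorem TestFunction.contDiff_evenExt (φ : TestFunction ι) : ContDiff ℝ ∞ φ.evenExt := by
  have h := φ.hasParity.contDiff_parityExtension
  have e : parityExtension 0 φ.toFun = φ.evenExt := by
    ext x; simp [parityExtension, TestFunction.evenExt]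
  rwa [e] at h

theorem TestFunction.evenExt_neg (φ : TestFunction ι) (x : ι → ℝ) :
    φ.evenExt (-x) = φ.evenExt x := by
  simp [TestFunction.evenExt]

theorem TestFunction.evenExt_of_mem (φ : TestFunction ι) {x : ι → ℝ} (hx : x ∈ closedOrthant ι) :
    φ.evenExt x = φ x := by
  simp only [TestFunction.evenExt]
  congr 1
  ext i
  exact abs_of_nonneg (hx i)

theorem TestFunction.exists_evenExt_eq_zero (φ : TestFunction ι) :
    ∃ R : ℝ, 0 < R ∧ ∀ x, R < ‖x‖ → φ.evenExt x = 0 := by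
  obtain ⟨R, hR⟩ := φ.compactSupport
  refine ⟨max R 1, by positivity, fun x hx => hR _ (fun i => abs_nonneg _) ?_⟩
  have : ‖(fun i => |x i|)‖ = ‖x‖ := by
    simp [Pi.norm_def]
  rw [this]
  exact (le_max_left _ _).trans_lt hx

end EvenExtension

end ConePower
end

noncomputable section
namespace ConePower

/-! ### Functions of r and t: Euler operators and vanishing at the vertex r = 0 -/

section Profiles

/-- The partial derivative with respect to the first variable. -/
def fstDeriv (U : ℝ × ℝ → ℂ) (x : ℝ × ℝ) : ℂ := fderiv ℝ U x (1, 0)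

/-- The partial derivative with respect to the second variable. -/
def sndDeriv (U : ℝ × ℝ → ℂ) (x : ℝ × ℝ) : ℂ := fderiv ℝ U x (0, 1)

/-- The operator `r ∂/∂r`. -/
def fstEuler (U : ℝ × ℝ → ℂ) (x : ℝ × ℝ) : ℂ := (x.1 : ℂ) * fstDeriv U x

/-- The operator `(t / 2) ∂/∂t`. -/
def sndEuler (U : ℝ × ℝ → ℂ) (x : ℝ × ℝ) : ℂ := ((x.2 / 2 : ℝ) : ℂ) * sndDeriv U x

theorem contDiff_fstDeriv {U : ℝ × ℝ → ℂ} (hU : ContDiff ℝ ∞ U) : ContDiff ℝ ∞ (fstDeriv U) :=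
  (hU.fderiv_right (by simp)).clm_apply contDiff_const

theorem contDiff_sndDeriv {U : ℝ × ℝ → ℂ} (hU : ContDiff ℝ ∞ U) : ContDiff ℝ ∞ (sndDeriv U) :=
  (hU.fderiv_right (by simp)).clm_apply contDiff_const

theorem contDiff_fstEuler {U : ℝ × ℝ → ℂ} (hU : ContDiff ℝ ∞ U) : ContDiff ℝ ∞ (fstEuler U) :=
  (Complex.ofRealCLM.contDiff.comp contDiff_fst).mul (contDiff_fstDeriv hU)

theorem contDiff_sndEuler {U : ℝ × ℝ → ℂ} (hU : ContDiff ℝ ∞ U) : ContDiff ℝ ∞ (sndEuler U) :=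
  (Complex.ofRealCLM.contDiff.comp (contDiff_snd.div_const 2)).mul (contDiff_sndDeriv hU)

theorem contDiff_fstDeriv_iterate {U : ℝ × ℝ → ℂ} (hU : ContDiff ℝ ∞ U) (j : ℕ) :
    ContDiff ℝ ∞ (fstDeriv^[j] U) := by
  induction j with
  | zero => exact hU
  | succ j ih => rw [Function.iterate_succ_apply']; exact contDiff_fstDeriv ih

theorem hasDerivAt_fst {U : ℝ × ℝ → ℂ} (hU : ContDiff ℝ ∞ U) (r t : ℝ) :
    HasDerivAt (fun r => U (r, t)) (fstDeriv U (r, t)) r := by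
  have h := (hU.differentiable (by simp) (r, t)).hasFDerivAt
  exact h.comp_hasDerivAt r ((hasDerivAt_id r).prodMk (hasDerivAt_const r t))

theorem hasDerivAt_snd {U : ℝ × ℝ → ℂ} (hU : ContDiff ℝ ∞ U) (r t : ℝ) :
    HasDerivAt (fun t => U (r, t)) (sndDeriv U (r, t)) t := by
  have h := (hU.differentiable (by simp) (r, t)).hasFDerivAt
  exact h.comp_hasDerivAt t ((hasDerivAt_const t r).prodMk (hasDerivAt_id t))

theorem fstDeriv_add {U V : ℝ × ℝ → ℂ} (hU : ContDiff ℝ ∞ U) (hV : ContDiff ℝ ∞ V) :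
    fstDeriv (U + V) = fstDeriv U + fstDeriv V := by
  ext x
  simp only [fstDeriv, Pi.add_apply]
  rw [fderiv_add (hU.differentiable (by simp) x) (hV.differentiable (by simp) x)]
  rfl

theorem sndDeriv_add {U V : ℝ × ℝ → ℂ} (hU : ContDiff ℝ ∞ U) (hV : ContDiff ℝ ∞ V) :
    sndDeriv (U + V) = sndDeriv U + sndDeriv V := by
  ext x
  simp only [sndDeriv, Pi.add_apply]
  rw [fderiv_add (hU.differentiable (by simp) x) (hV.differentiable (by simp) x)]
  rfl

theorem fstDeriv_smul {U : ℝ × ℝ → ℂ} (hU : ContDiff ℝ ∞ U) (a : ℂ) :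
    fstDeriv (a • U) = a • fstDeriv U := by
  ext x
  simp only [fstDeriv, Pi.smul_apply]
  rw [fderiv_const_smul (hU.differentiable (by simp) x)]
  rfl

theorem sndDeriv_smul {U : ℝ × ℝ → ℂ} (hU : ContDiff ℝ ∞ U) (a : ℂ) :
    sndDeriv (a • U) = a • sndDeriv U := by
  ext x
  simp only [sndDeriv, Pi.smul_apply]
  rw [fderiv_const_smul (hU.differentiable (by simp) x)]
  rfl

theorem fstDeriv_iterate_add {U V : ℝ × ℝ → ℂ} (hU : ContDiff ℝ ∞ U) (hV : ContDiff ℝ ∞ V)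
    (j : ℕ) : fstDeriv^[j] (U + V) = fstDeriv^[j] U + fstDeriv^[j] V := by
  induction j with
  | zero => rfl
  | succ j ih =>
    rw [Function.iterate_succ_apply', ih, fstDeriv_add (contDiff_fstDeriv_iterate hU j)
      (contDiff_fstDeriv_iterate hV j), Function.iterate_succ_apply', Function.iterate_succ_apply']

theorem fstDeriv_iterate_smul {U : ℝ × ℝ → ℂ} (hU : ContDiff ℝ ∞ U) (a : ℂ) (j : ℕ) :
    fstDeriv^[j] (a • U) = a • fstDeriv^[j] U := by
  induction j with
  | zero => rfl
  | succ j ih =>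
    rw [Function.iterate_succ_apply', ih, fstDeriv_smul (contDiff_fstDeriv_iterate hU j),
      Function.iterate_succ_apply']

theorem fstDeriv_sndDeriv {U : ℝ × ℝ → ℂ} (hU : ContDiff ℝ ∞ U) :
    fstDeriv (sndDeriv U) = sndDeriv (fstDeriv U) := by
  have hd : Differentiable ℝ (fderiv ℝ U) := (hU.fderiv_right (m := ∞) (by simp)).differentiable
    (by simp)
  have key : ∀ x v w, fderiv ℝ (fun y => fderiv ℝ U y v) x w = fderiv ℝ (fderiv ℝ U) x w v := by
    intro x v w
    rw [fderiv_clm_apply (hd x) (differentiableAt_const _)]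
    simp
  ext x
  change fderiv ℝ (fun y => fderiv ℝ U y (0, 1)) x (1, 0) =
    fderiv ℝ (fun y => fderiv ℝ U y (1, 0)) x (0, 1)
  rw [key, key]
  refine (hU.contDiffAt.isSymmSndFDerivAt ?_).eq _ _
  rw [minSmoothness_of_isRCLikeNormedField]
  exact WithTop.coe_le_coe.2 (le_top : (2 : ℕ∞) ≤ ⊤)

theorem fstDeriv_mul_fst {U : ℝ × ℝ → ℂ} (hU : ContDiff ℝ ∞ U) :
    fstDeriv (fstEuler U) = fstDeriv U + fstEuler (fstDeriv U) := by
  ext ⟨r, t⟩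
  have h1 := hasDerivAt_fst (contDiff_fstEuler hU) r t
  have h2 := ((hasDerivAt_id r).ofReal_comp).mul (hasDerivAt_fst (contDiff_fstDeriv hU) r t)
  rw [h1.unique h2]
  simp [fstEuler]

theorem sndDeriv_fstEuler {U : ℝ × ℝ → ℂ} (hU : ContDiff ℝ ∞ U) :
    sndDeriv (fstEuler U) = fstEuler (sndDeriv U) := by
  ext ⟨r, t⟩
  have h1 := hasDerivAt_snd (contDiff_fstEuler hU) r t
  have h2 := (hasDerivAt_snd (contDiff_fstDeriv hU) r t).const_mul (r : ℂ)
  rw [h1.unique h2, ← fstDeriv_sndDeriv hU]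
  rfl

theorem fstDeriv_sndEuler {U : ℝ × ℝ → ℂ} (hU : ContDiff ℝ ∞ U) :
    fstDeriv (sndEuler U) = sndEuler (fstDeriv U) := by
  ext ⟨r, t⟩
  have h1 := hasDerivAt_fst (contDiff_sndEuler hU) r t
  have h2 := (hasDerivAt_fst (contDiff_sndDeriv hU) r t).const_mul ((t / 2 : ℝ) : ℂ)
  rw [h1.unique h2, fstDeriv_sndDeriv hU]
  rfl

theorem fstEuler_sndEuler {U : ℝ × ℝ → ℂ} (hU : ContDiff ℝ ∞ U) :
    fstEuler (sndEuler U) = sndEuler (fstEuler U) := by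
  ext x
  simp only [fstEuler]
  rw [fstDeriv_sndEuler hU]
  simp only [sndEuler]
  rw [sndDeriv_fstEuler hU]
  simp only [fstEuler, fstDeriv_sndDeriv hU]
  ring

/-- Smooth functions of `(r, t)` which are even in `r` and vanish for large `|r|`. -/
def profile : Submodule ℂ (ℝ × ℝ → ℂ) where
  carrier := {U | ContDiff ℝ ∞ U ∧ (∀ r t, U (-r, t) = U (r, t)) ∧
    ∃ R : ℝ, ∀ r t, R < |r| → U (r, t) = 0}
  add_mem' := by
    rintro U V ⟨hU, hU', R, hR⟩ ⟨hV, hV', S, hS⟩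
    refine ⟨hU.add hV, fun r t => by simp [hU', hV'], max R S, fun r t h => ?_⟩
    simp [hR r t ((le_max_left _ _).trans_lt h), hS r t ((le_max_right _ _).trans_lt h)]
  zero_mem' := ⟨contDiff_const, by simp, 0, by simp⟩
  smul_mem' := by
    rintro a U ⟨hU, hU', R, hR⟩
    exact ⟨contDiff_const.smul hU, fun r t => by simp [hU'], R, fun r t h => by simp [hR r t h]⟩

theorem contDiff_profile (U : profile) : ContDiff ℝ ∞ U.1 := U.2.1

theorem even_profile (U : profile) (r t : ℝ) : U.1 (-r, t) = U.1 (r, t) := U.2.2.1 r t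

theorem exists_profile_eq_zero (U : profile) :
    ∃ R : ℝ, 0 < R ∧ ∀ r t, R < |r| → U.1 (r, t) = 0 := by
  obtain ⟨R, hR⟩ := U.2.2.2
  exact ⟨max R 1, by positivity, fun r t h => hR r t ((le_max_left _ _).trans_lt h)⟩

theorem fstDeriv_neg_of_even {U : ℝ × ℝ → ℂ} (hU : ContDiff ℝ ∞ U) {a : ℂ}
    (he : ∀ r t, U (-r, t) = a * U (r, t)) (r t : ℝ) :
    fstDeriv U (-r, t) = -a * fstDeriv U (r, t) := by
  have h1 : HasDerivAt (fun r => U (-r, t)) (-fstDeriv U (-r, t)) r := by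
    have := (hasDerivAt_fst hU (-r) t).scomp r (hasDerivAt_neg r)
    simpa [Function.comp_def] using this
  have h2 : HasDerivAt (fun r => U (-r, t)) (a * fstDeriv U (r, t)) r := by
    simpa [he] using (hasDerivAt_fst hU r t).const_mul a
  have := h1.unique h2
  linear_combination -this

theorem fstEuler_mem {U : ℝ × ℝ → ℂ} (hU : U ∈ profile) : fstEuler U ∈ profile := by
  obtain ⟨h1, h2, R, hR⟩ := hU
  refine ⟨contDiff_fstEuler h1, fun r t => ?_, R, fun r t hr => ?_⟩
  · simp only [fstEuler, fstDeriv_neg_of_even h1 (a := 1) (by simpa using h2)]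
    push_cast
    ring
  · have h0 : HasDerivAt (fun r => U (r, t)) 0 r := by
      refine (hasDerivAt_const r (0 : ℂ)).congr_of_eventuallyEq ?_
      filter_upwards [(continuous_abs.tendsto r).eventually_const_lt hr] with s hs
      exact hR s t hs
    simp only [fstEuler]
    rw [(hasDerivAt_fst h1 r t).unique h0, mul_zero]

theorem sndEuler_mem {U : ℝ × ℝ → ℂ} (hU : U ∈ profile) : sndEuler U ∈ profile := by
  obtain ⟨h1, h2, R, hR⟩ := hU
  refine ⟨contDiff_sndEuler h1, fun r t => ?_, R, fun r t hr => ?_⟩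
  · simp only [sndEuler]
    have h3 : HasDerivAt (fun t => U (-r, t)) (sndDeriv U (r, t)) t := by
      simpa only [h2] using hasDerivAt_snd h1 r t
    rw [(hasDerivAt_snd h1 (-r) t).unique h3]
  · have h0 : HasDerivAt (fun t => U (r, t)) 0 t := by
      simpa only [hR r _ hr] using hasDerivAt_const t (0 : ℂ)
    simp only [sndEuler]
    rw [(hasDerivAt_snd h1 r t).unique h0, mul_zero]

/-- The operator `r ∂/∂r` on profiles. -/
def radialEuler : Module.End ℂ profile where
  toFun U := ⟨fstEuler U.1, fstEuler_mem U.2⟩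
  map_add' U V := by
    ext x
    simp [fstEuler, fstDeriv_add (contDiff_profile U) (contDiff_profile V), mul_add]
  map_smul' a U := by
    ext x
    simp only [fstEuler, Submodule.coe_smul, fstDeriv_smul (contDiff_profile U), Pi.smul_apply, smul_eq_mul,
      RingHom.id_apply]
    ring

/-- The operator `(t / 2) ∂/∂t` on profiles. -/
def slopeEuler : Module.End ℂ profile where
  toFun U := ⟨sndEuler U.1, sndEuler_mem U.2⟩
  map_add' U V := by
    ext x
    simp [sndEuler, sndDeriv_add (contDiff_profile U) (contDiff_profile V), mul_add]
  map_smul' a U := by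
    ext x
    simp only [sndEuler, Submodule.coe_smul, sndDeriv_smul (contDiff_profile U), Pi.smul_apply, smul_eq_mul,
      RingHom.id_apply]
    ring

theorem commute_radialEuler_slopeEuler : Commute radialEuler slopeEuler := by
  refine LinearMap.ext fun U => Subtype.ext ?_
  exact fstEuler_sndEuler (contDiff_profile U)

/-- The profile vanishes to order `n` at `r = 0`. -/
def VanishesToOrder (n : ℕ) (U : profile) : Prop :=
  ∀ j < n, ∀ t, fstDeriv^[j] U.1 (0, t) = 0

theorem vanishesToOrder_zero (U : profile) : VanishesToOrder 0 U := fun _ h => absurd h (by simp)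

theorem VanishesToOrder.add {n : ℕ} {U V : profile} (hU : VanishesToOrder n U)
    (hV : VanishesToOrder n V) : VanishesToOrder n (U + V) := fun j hj t => by
  simp [fstDeriv_iterate_add (contDiff_profile U) (contDiff_profile V), hU j hj t, hV j hj t]

theorem VanishesToOrder.smul {n : ℕ} {U : profile} (hU : VanishesToOrder n U) (a : ℂ) :
    VanishesToOrder n (a • U) := fun j hj t => by
  simp [fstDeriv_iterate_smul (contDiff_profile U), hU j hj t]

theorem fstDeriv_iterate_sndEuler {U : ℝ × ℝ → ℂ} (hU : ContDiff ℝ ∞ U) (j : ℕ) :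
    fstDeriv^[j] (sndEuler U) = sndEuler (fstDeriv^[j] U) := by
  induction j with
  | zero => rfl
  | succ j ih =>
    rw [Function.iterate_succ_apply', ih, fstDeriv_sndEuler (contDiff_fstDeriv_iterate hU j),
      Function.iterate_succ_apply']

theorem VanishesToOrder.slopeEuler {n : ℕ} {U : profile} (hU : VanishesToOrder n U) :
    VanishesToOrder n (slopeEuler U) := fun j hj t => by
  change fstDeriv^[j] (sndEuler U.1) (0, t) = 0
  rw [fstDeriv_iterate_sndEuler (contDiff_profile U)]
  have h0 : HasDerivAt (fun t => fstDeriv^[j] U.1 (0, t)) 0 t := by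
    simpa only [hU j hj] using hasDerivAt_const t (0 : ℂ)
  simp only [sndEuler]
  rw [(hasDerivAt_snd (contDiff_fstDeriv_iterate (contDiff_profile U) j) 0 t).unique h0, mul_zero]

/-- The commutator of ∂/∂r with r ∂/∂r is ∂/∂r. At r = 0 this says that r ∂/∂r multiplies the j-th
Taylor coefficient by j. -/
theorem fstDeriv_iterate_fstEuler {U : ℝ × ℝ → ℂ} (hU : ContDiff ℝ ∞ U) (j : ℕ) :
    fstDeriv^[j] (fstEuler U) = (j : ℂ) • fstDeriv^[j] U + fstEuler (fstDeriv^[j] U) := by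
  induction j generalizing U with
  | zero => simp
  | succ j ih =>
    rw [Function.iterate_succ_apply, fstDeriv_mul_fst hU, fstDeriv_iterate_add (contDiff_fstDeriv hU)
      (contDiff_fstEuler (contDiff_fstDeriv hU)), ih (contDiff_fstDeriv hU),
      ← Function.iterate_succ_apply]
    push_cast
    rw [add_smul, one_smul]
    abel


theorem fstDeriv_iterate_neg (U : profile) (j : ℕ) (r t : ℝ) :
    fstDeriv^[j] U.1 (-r, t) = (-1) ^ j * fstDeriv^[j] U.1 (r, t) := by
  induction j generalizing r t with
  | zero => simpa using even_profile U r t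
  | succ j ih =>
    rw [Function.iterate_succ_apply',
      fstDeriv_neg_of_even (contDiff_fstDeriv_iterate (contDiff_profile U) j) ih, pow_succ]
    ring

theorem fstDeriv_iterate_odd_eq_zero (U : profile) {j : ℕ} (hj : Odd j) (t : ℝ) :
    fstDeriv^[j] U.1 (0, t) = 0 := by
  have h := fstDeriv_iterate_neg U j 0 t
  rw [hj.neg_one_pow, neg_zero, neg_one_mul] at h
  exact self_eq_neg.1 h

/-- The product of the operators `r ∂/∂r - 2 i` for `i < m`; it annihilates the Taylor
polynomial of degree `2 m - 1` of a profile. -/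
def taylorKiller : ℕ → Module.End ℂ profile
  | 0 => 1
  | m + 1 => (radialEuler - (2 * m : ℂ) • 1) * taylorKiller m

theorem commute_taylorKiller_slopeEuler (m : ℕ) : Commute (taylorKiller m) slopeEuler := by
  induction m with
  | zero => exact Commute.one_left _
  | succ m ih =>
    refine Commute.mul_left ?_ ih
    have hc : ∀ U, radialEuler (slopeEuler U) = slopeEuler (radialEuler U) :=
      LinearMap.congr_fun commute_radialEuler_slopeEuler.eq
    refine LinearMap.ext fun U => ?_
    simp [hc]

/-- The j-th Taylor coefficient at r = 0 is multiplied by j - 2 m, which kills order 2 m; order 2 m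
+ 1 is zero by evenness. Hence the order of vanishing rises by two. -/
theorem VanishesToOrder.radialEuler_sub {m : ℕ} {U : profile} (hU : VanishesToOrder (2 * m) U) :
    VanishesToOrder (2 * (m + 1)) (radialEuler U - (2 * m : ℂ) • U) := by
  intro j hj t
  have e : (radialEuler U - (2 * m : ℂ) • U).1 = fstEuler U.1 + (-(2 * m : ℂ)) • U.1 := by
    rw [neg_smul, ← sub_eq_add_neg]
    rfl
  have hV : ContDiff ℝ ∞ (-(2 * m : ℂ) • U.1) := contDiff_profile (-(2 * m : ℂ) • U)
  rw [e, fstDeriv_iterate_add (contDiff_fstEuler (contDiff_profile U)) hV, fstDeriv_iterate_smul (contDiff_profile U),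
    fstDeriv_iterate_fstEuler (contDiff_profile U)]
  simp only [Pi.add_apply, Pi.smul_apply, fstEuler, smul_eq_mul, Complex.ofReal_zero, zero_mul,
    add_zero]
  rw [← add_mul]
  have hcases : j < 2 * m ∨ j = 2 * m ∨ j = 2 * m + 1 := by omega
  rcases hcases with h | h | h
  · rw [hU j h, mul_zero]
  · rw [h]; push_cast; ring
  · rw [fstDeriv_iterate_odd_eq_zero U ⟨m, h⟩, mul_zero]

theorem vanishesToOrder_taylorKiller (m : ℕ) (U : profile) :
    VanishesToOrder (2 * m) (taylorKiller m U) := by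
  induction m with
  | zero => exact vanishesToOrder_zero _
  | succ m ih => exact ih.radialEuler_sub

/-- The bound for the r-derivative is integrated from r = 0, one order at a time, uniformly in t ∈
[0, 1]. -/
theorem exists_bound_of_vanishing {n : ℕ} {U : ℝ × ℝ → ℂ} (hU : ContDiff ℝ ∞ U)
    (h : ∀ j < n, ∀ t, fstDeriv^[j] U (0, t) = 0) (R : ℝ) :
    ∃ C : ℝ, 0 ≤ C ∧ ∀ r ∈ Set.Icc 0 R, ∀ t ∈ Set.Icc (0 : ℝ) 1, ‖U (r, t)‖ ≤ C * r ^ n := by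
  induction n generalizing U with
  | zero =>
    obtain ⟨C, hC⟩ := (isCompact_Icc.prod isCompact_Icc).exists_bound_of_continuousOn
      (hU.continuous.continuousOn (s := Set.Icc (0 : ℝ) R ×ˢ Set.Icc (0 : ℝ) 1))
    refine ⟨max C 0, le_max_right _ _, fun r hr t ht => ?_⟩
    rw [pow_zero, mul_one]
    exact (hC (r, t) ⟨hr, ht⟩).trans (le_max_left _ _)
  | succ n ih =>
    obtain ⟨C, hC0, hC⟩ := ih (contDiff_fstDeriv hU) fun j hj t => by
      rw [← Function.iterate_succ_apply]
      exact h (j + 1) (by omega) t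
    refine ⟨C, hC0, fun r hr t ht => ?_⟩
    have h1 : ‖U (r, t) - U (0, t)‖ ≤ C * r ^ n * (r - 0) := by
      refine norm_image_sub_le_of_norm_deriv_le_segment' (f := fun s => U (s, t))
        (f' := fun s => fstDeriv U (s, t))
        (fun s _ => (hasDerivAt_fst hU s t).hasDerivWithinAt) (fun s hs => ?_) r ⟨hr.1, le_refl r⟩
      refine (hC s ⟨hs.1, hs.2.le.trans hr.2⟩ t ht).trans ?_
      gcongr
      · exact hs.1
      · exact hs.2.le
    have h0 : U (0, t) = 0 := h 0 (by omega) t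
    rw [h0, sub_zero, sub_zero] at h1
    rwa [pow_succ, ← mul_assoc]

/-- A profile vanishing to order `n` is bounded by a multiple of `r ^ n`. -/
theorem VanishesToOrder.exists_bound {n : ℕ} {U : profile} (hU : VanishesToOrder n U) :
    ∃ C R : ℝ, 0 ≤ C ∧ 0 < R ∧ (∀ r t, R < |r| → U.1 (r, t) = 0) ∧
      ∀ r ∈ Set.Icc 0 R, ∀ t ∈ Set.Icc (0 : ℝ) 1, ‖U.1 (r, t)‖ ≤ C * r ^ n := by
  obtain ⟨R, hR, hR'⟩ := exists_profile_eq_zero U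
  obtain ⟨C, hC, hC'⟩ := exists_bound_of_vanishing (contDiff_profile U) hU R
  exact ⟨C, R, hC, hR, hR', hC'⟩

end Profiles

end ConePower
end

noncomputable section
namespace ConePower

/-! ### The cone integral: convergence and holomorphy -/

section ConeIntegral

/-- The kernel `r ^ (α - 1) * (1 - t²) ^ l * t ^ b`. -/
def coneKernel (b : ℝ) (α l : ℂ) (x : ℝ × ℝ) : ℂ :=
  (x.1 : ℂ) ^ (α - 1) * ((1 - x.2 ^ 2 : ℝ) : ℂ) ^ l * ((x.2 ^ b : ℝ) : ℂ)

/-- The half strip `0 < r`, `0 < t < 1`. -/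
def halfStrip : Set (ℝ × ℝ) := Set.Ioi 0 ×ˢ Set.Ioo 0 1

/-- The integral of a profile against the kernel `2 r ^ (α - 1) * (1 - t²) ^ l * t ^ b`. -/
def coneIntegral (b : ℝ) (α l : ℂ) (U : profile) : ℂ :=
  2 * ∫ x in halfStrip, coneKernel b α l x * U.1 x

theorem measurableSet_halfStrip : MeasurableSet halfStrip :=
  measurableSet_Ioi.prod measurableSet_Ioo

theorem volume_restrict_halfStrip : (volume : Measure (ℝ × ℝ)).restrict halfStrip =
    (volume.restrict (Set.Ioi 0)).prod (volume.restrict (Set.Ioo 0 1)) := by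
  rw [Measure.prod_restrict, ← Measure.volume_eq_prod]
  rfl

theorem measurable_coneKernel (b : ℝ) (α l : ℂ) : Measurable (coneKernel b α l) := by
  unfold coneKernel
  refine ((Measurable.pow_const (by fun_prop) _).mul (Measurable.pow_const (by fun_prop) _)).mul ?_
  exact Complex.measurable_ofReal.comp (Measurable.pow_const measurable_snd _)

theorem integrableOn_Ioi_indicator_rpow {ρ : ℝ} (hρ : 0 < ρ) (R : ℝ) :
    IntegrableOn ((Set.Iic R).indicator fun r : ℝ => r ^ (ρ - 1)) (Set.Ioi 0) := by
  rw [integrableOn_indicator_iff measurableSet_Iic, Set.inter_comm, Set.Ioi_inter_Iic]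
  by_cases hR : 0 ≤ R
  · rw [← intervalIntegrable_iff_integrableOn_Ioc_of_le hR]
    exact intervalIntegral.intervalIntegrable_rpow' (by linarith)
  · rw [Set.Ioc_eq_empty (by linarith)]
    exact integrableOn_empty

theorem integrableOn_Ioo_one_sub_sq_rpow {σ : ℝ} (hσ : -1 < σ) :
    IntegrableOn (fun t : ℝ => (1 - t ^ 2) ^ σ) (Set.Ioo 0 1) := by
  -- The constant bounds (1 + t)^σ for 1 ≤ 1 + t ≤ 2, for either sign of σ; the singularity is
  -- carried by (1 - t)^σ.
  have h1 : IntegrableOn (fun t : ℝ => max 1 ((2 : ℝ) ^ σ) * (1 - t) ^ σ) (Set.Ioo 0 1) := by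
    refine Integrable.const_mul ?_ _
    have h2 : IntervalIntegrable (fun t : ℝ => (1 - t) ^ σ) volume 0 1 := by
      have h3 := (intervalIntegral.intervalIntegrable_rpow' (a := 0) (b := 1) hσ).comp_sub_left 1
      rw [sub_zero, sub_self] at h3
      exact h3.symm
    exact ((intervalIntegrable_iff_integrableOn_Ioc_of_le zero_le_one).1 h2).mono_set
      Set.Ioo_subset_Ioc_self
  refine Integrable.mono' h1 (Measurable.aestronglyMeasurable (by fun_prop)) ?_
  filter_upwards [ae_restrict_mem measurableSet_Ioo] with t ht
  have h0 : 0 ≤ 1 - t := by linarith [ht.2]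
  have h2 : 0 ≤ 1 + t := by linarith [ht.1]
  rw [show 1 - t ^ 2 = (1 + t) * (1 - t) by ring, Real.mul_rpow h2 h0,
    Real.norm_of_nonneg (by positivity)]
  gcongr
  rcases le_total 0 σ with h | h
  · exact (Real.rpow_le_rpow h2 (by linarith [ht.2]) h).trans (le_max_right _ _)
  · exact (Real.rpow_le_one_of_one_le_of_nonpos (by linarith [ht.1]) h).trans (le_max_left _ _)

/-- An integrable majorant of kernels times profiles. -/
def stripBound (ρ σ R : ℝ) (x : ℝ × ℝ) : ℝ :=
  (Set.Iic R).indicator (fun r : ℝ => r ^ (ρ - 1)) x.1 * (1 - x.2 ^ 2) ^ σ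

theorem integrableOn_stripBound {ρ σ : ℝ} (hρ : 0 < ρ) (hσ : -1 < σ) (R : ℝ) :
    IntegrableOn (stripBound ρ σ R) halfStrip := by
  rw [IntegrableOn, volume_restrict_halfStrip]
  exact (integrableOn_Ioi_indicator_rpow hρ R).mul_prod (integrableOn_Ioo_one_sub_sq_rpow hσ)

theorem norm_ofReal_cpow {r : ℝ} (hr : 0 < r) (α : ℂ) : ‖(r : ℂ) ^ α‖ = r ^ α.re :=
  Complex.norm_cpow_eq_rpow_re_of_pos hr α

/-- Vanishing to order n raises the radial exponent from α to α + n. Letting Re α + n range over [ρ,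
ρ'] makes the majorant uniform in the exponents: the surplus power of r ≤ R is absorbed in `max 1 R
^ (ρ' - ρ)`. -/
theorem norm_coneKernel_mul_le {b : ℝ} (hb : 0 ≤ b) {n : ℕ} {U : ℝ × ℝ → ℂ} {C R : ℝ}
    (hC : 0 ≤ C) (hR : ∀ r t, R < |r| → U (r, t) = 0)
    (hU : ∀ r ∈ Set.Icc 0 R, ∀ t ∈ Set.Icc (0 : ℝ) 1, ‖U (r, t)‖ ≤ C * r ^ n) {α l : ℂ}
    {ρ ρ' σ : ℝ} (h1 : ρ ≤ α.re + n) (h2 : α.re + n ≤ ρ') (h3 : σ ≤ l.re) {x : ℝ × ℝ}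
    (hx : x ∈ halfStrip) :
    ‖coneKernel b α l x * U x‖ ≤ C * max 1 R ^ (ρ' - ρ) * stripBound ρ σ R x := by
  obtain ⟨r, t⟩ := x
  obtain ⟨hr, ht⟩ := hx
  simp only [Set.mem_Ioi, Set.mem_Ioo] at hr ht
  unfold stripBound
  by_cases hrR : r ≤ R
  swap
  · rw [hR r t (by rw [abs_of_pos hr]; linarith)]
    simp [hrR]
  have ht2 : 0 < 1 - t ^ 2 := by nlinarith
  simp only [Set.mem_Iic, hrR, Set.indicator_of_mem]
  rw [norm_mul, coneKernel, norm_mul, norm_mul, norm_ofReal_cpow hr, norm_ofReal_cpow ht2,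
    Complex.norm_real, Real.norm_of_nonneg (Real.rpow_nonneg ht.1.le b)]
  have e1 : (1 - t ^ 2) ^ l.re ≤ (1 - t ^ 2) ^ σ :=
    Real.rpow_le_rpow_of_exponent_ge ht2 (by nlinarith) h3
  have e2 : t ^ b ≤ 1 := Real.rpow_le_one ht.1.le ht.2.le hb
  have e0 : 0 ≤ t ^ b := Real.rpow_nonneg ht.1.le b
  have e3 := hU r ⟨hr.le, hrR⟩ t ⟨ht.1.le, ht.2.le⟩
  have e4 : r ^ (α - 1).re * r ^ n = r ^ (ρ - 1) * r ^ (α.re + n - ρ) := by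
    rw [← Real.rpow_natCast, ← Real.rpow_add hr, ← Real.rpow_add hr]
    congr 1
    simp
    ring
  have e5 : r ^ (α.re + n - ρ) ≤ max 1 R ^ (ρ' - ρ) :=
    (Real.rpow_le_rpow hr.le (hrR.trans (le_max_right 1 R)) (by linarith)).trans
      (Real.rpow_le_rpow_of_exponent_le (le_max_left 1 R) (by linarith))
  calc r ^ (α - 1).re * (1 - t ^ 2) ^ l.re * t ^ b * ‖U (r, t)‖
      ≤ r ^ (α - 1).re * (1 - t ^ 2) ^ σ * 1 * (C * r ^ n) := by
        gcongr
    _ = C * (r ^ (α - 1).re * r ^ n) * (1 - t ^ 2) ^ σ := by ring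
    _ = C * (r ^ (ρ - 1) * r ^ (α.re + n - ρ)) * (1 - t ^ 2) ^ σ := by rw [e4]
    _ ≤ C * (r ^ (ρ - 1) * max 1 R ^ (ρ' - ρ)) * (1 - t ^ 2) ^ σ := by
        gcongr
    _ = C * max 1 R ^ (ρ' - ρ) * (r ^ (ρ - 1) * (1 - t ^ 2) ^ σ) := by ring

theorem VanishesToOrder.integrableOn {b : ℝ} (hb : 0 ≤ b) {n : ℕ} {U : profile}
    (hU : VanishesToOrder n U) {α l : ℂ} (hα : 0 < α.re + n) (hl : -1 < l.re) :
    IntegrableOn (fun x => coneKernel b α l x * U.1 x) halfStrip := by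
  obtain ⟨C, R, hC, _, hR, hCR⟩ := hU.exists_bound
  refine Integrable.mono' ((integrableOn_stripBound hα hl R).const_mul
    (C * max 1 R ^ ((α.re + n) - (α.re + n)))) ?_ ?_
  · exact ((measurable_coneKernel b α l).mul
      (contDiff_profile U).continuous.measurable).aestronglyMeasurable
  · filter_upwards [ae_restrict_mem measurableSet_halfStrip] with x hx
    exact norm_coneKernel_mul_le hb hC hR hCR le_rfl le_rfl le_rfl hx

/-- Both exponents are entire functions of one parameter because in the application α = 2 λ + N
moves together with λ. -/
theorem VanishesToOrder.differentiableAt_coneIntegral {b : ℝ} (hb : 0 ≤ b) {n : ℕ} {U : profile}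
    (hU : VanishesToOrder n U) {A L : ℂ → ℂ} (hA : Differentiable ℂ A) (hL : Differentiable ℂ L)
    {z₀ : ℂ} (hα : 0 < (A z₀).re + n) (hl : -1 < (L z₀).re) :
    DifferentiableAt ℂ (fun z => coneIntegral b (A z) (L z) U) z₀ := by
  obtain ⟨C, R, hC, _, hR, hCR⟩ := hU.exists_bound
  set ρ := ((A z₀).re + n) / 2
  set ρ' := (A z₀).re + n + 1
  set σ := ((L z₀).re - 1) / 2
  have hρ : 0 < ρ := by simp only [ρ]; linarith
  have hσ : -1 < σ := by simp only [σ]; linarith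
  have hnear : ∀ᶠ z in 𝓝 z₀, (ρ < (A z).re + n ∧ (A z).re + n < ρ') ∧ σ < (L z).re := by
    have cA : Tendsto (fun z => (A z).re + n) (𝓝 z₀) (𝓝 ((A z₀).re + n)) :=
      ((Complex.continuous_re.comp hA.continuous).add continuous_const).tendsto z₀
    have cL : Tendsto (fun z => (L z).re) (𝓝 z₀) (𝓝 (L z₀).re) :=
      (Complex.continuous_re.comp hL.continuous).tendsto z₀
    exact ((cA.eventually_const_lt (by simp only [ρ]; linarith)).and
      (cA.eventually_lt_const (by simp only [ρ']; linarith))).and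
      (cL.eventually_const_lt (by simp only [σ]; linarith))
  obtain ⟨ε, hε, hball⟩ := Metric.eventually_nhds_iff_ball.1 hnear
  refine DifferentiableAt.const_mul (differentiableAt_integral_of_dominated hε
    (bound := fun x => C * max 1 R ^ (ρ' - ρ) * stripBound ρ σ R x) (fun z _ => ?_) ?_ ?_ ?_) 2
  · exact ((measurable_coneKernel b _ _).mul
      (contDiff_profile U).continuous.measurable).aestronglyMeasurable
  · filter_upwards [ae_restrict_mem measurableSet_halfStrip] with x hx
    have hx1 : (x.1 : ℂ) ≠ 0 := by exact_mod_cast (ne_of_gt hx.1)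
    have hx2 : ((1 - x.2 ^ 2 : ℝ) : ℂ) ≠ 0 := by
      have h1 := hx.2.1
      have h2 := hx.2.2
      have : 0 < 1 - x.2 ^ 2 := by nlinarith
      exact_mod_cast this.ne'
    unfold coneKernel
    refine Differentiable.differentiableOn (Differentiable.mul_const (Differentiable.mul_const
      (Differentiable.mul ?_ ?_) _) _)
    · exact fun z => ((hA z).sub_const 1).const_cpow (Or.inl hx1)
    · exact fun z => (hL z).const_cpow (Or.inl hx2)
  · filter_upwards [ae_restrict_mem measurableSet_halfStrip] with x hx z hz
    exact norm_coneKernel_mul_le hb hC hR hCR (hball z hz).1.1.le (hball z hz).1.2.le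
      (hball z hz).2.le hx
  · exact (integrableOn_stripBound hρ hσ R).const_mul _

theorem VanishesToOrder.coneIntegral_add {b : ℝ} (hb : 0 ≤ b) {n : ℕ} {U V : profile}
    (hU : VanishesToOrder n U) (hV : VanishesToOrder n V) {α l : ℂ} (hα : 0 < α.re + n)
    (hl : -1 < l.re) :
    coneIntegral b α l (U + V) = coneIntegral b α l U + coneIntegral b α l V := by
  unfold coneIntegral
  rw [← mul_add, ← integral_add (hU.integrableOn hb hα hl) (hV.integrableOn hb hα hl)]
  congr 2
  ext x
  simp [mul_add]

theorem coneIntegral_smul (b : ℝ) (α l a : ℂ) (U : profile) :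
    coneIntegral b α l (a • U) = a * coneIntegral b α l U := by
  unfold coneIntegral
  rw [mul_left_comm, ← integral_const_mul a]
  refine congrArg ((2 : ℂ) * ·) (integral_congr_ae (.of_forall fun x => ?_))
  simp only [Submodule.coe_smul, Pi.smul_apply, smul_eq_mul]
  ring

end ConeIntegral

end ConePower
end

noncomputable section
namespace ConePower

/-! ### Integration by parts in t and in r -/

section Recursions

theorem setIntegral_halfStrip {f : ℝ × ℝ → ℂ} (hf : IntegrableOn f halfStrip) :
    ∫ x in halfStrip, f x = ∫ r in Set.Ioi (0 : ℝ), ∫ t in Set.Ioo (0 : ℝ) 1, f (r, t) := by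
  rw [IntegrableOn, volume_restrict_halfStrip] at hf
  rw [volume_restrict_halfStrip, integral_prod _ hf]

theorem setIntegral_halfStrip_symm {f : ℝ × ℝ → ℂ} (hf : IntegrableOn f halfStrip) :
    ∫ x in halfStrip, f x = ∫ t in Set.Ioo (0 : ℝ) 1, ∫ r in Set.Ioi (0 : ℝ), f (r, t) := by
  rw [IntegrableOn, volume_restrict_halfStrip] at hf
  rw [volume_restrict_halfStrip, integral_prod_symm _ hf]

theorem ae_integrableOn_snd {f : ℝ × ℝ → ℂ} (hf : IntegrableOn f halfStrip) :
    ∀ᵐ r ∂(volume.restrict (Set.Ioi (0 : ℝ))), IntegrableOn (fun t => f (r, t)) (Set.Ioo 0 1) := by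
  rw [IntegrableOn, volume_restrict_halfStrip] at hf
  exact hf.prod_right_ae

theorem ae_integrableOn_fst {f : ℝ × ℝ → ℂ} (hf : IntegrableOn f halfStrip) :
    ∀ᵐ t ∂(volume.restrict (Set.Ioo (0 : ℝ) 1)), IntegrableOn (fun r => f (r, t)) (Set.Ioi 0) := by
  rw [IntegrableOn, volume_restrict_halfStrip] at hf
  exact hf.prod_left_ae

theorem hasDerivAt_one_sub_sq_cpow {l : ℂ} (hl : -1 < l.re) {t : ℝ} (ht : t ∈ Set.Ioo (0 : ℝ) 1) :
    HasDerivAt (fun t : ℝ => ((1 - t ^ 2 : ℝ) : ℂ) ^ (l + 1))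
      (-(2 * t) * (l + 1) * ((1 - t ^ 2 : ℝ) : ℂ) ^ l) t := by
  have h0 : (1 - t ^ 2 : ℝ) ≠ 0 := by have h1 := ht.1; have h2 := ht.2; nlinarith
  have hl1 : l ≠ -1 := by rintro rfl; simp at hl
  have hl2 : l + 1 ≠ 0 := fun h => hl1 (eq_neg_of_add_eq_zero_left h)
  have h1 : HasDerivAt (fun t : ℝ => 1 - t ^ 2) (-(2 * t)) t := by
    simpa using (hasDerivAt_pow 2 t).const_sub 1
  have h2 := (hasDerivAt_ofReal_cpow_const h0 hl2).scomp t h1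
  refine h2.congr_deriv ?_
  rw [Complex.real_smul, add_sub_cancel_right]
  push_cast
  ring

theorem hasDerivAt_ofReal_rpow {b : ℝ} (hb : 0 ≤ b) {t : ℝ} :
    HasDerivAt (fun t : ℝ => ((t ^ (b + 1) : ℝ) : ℂ)) (((b + 1) * t ^ b : ℝ) : ℂ) t := by
  have h := (Real.hasDerivAt_rpow_const (x := t) (p := b + 1) (Or.inr (by linarith))).ofReal_comp
  rwa [add_sub_cancel_right] at h

/-- By t² = 1 - (1 - t²), `f` is the derivative of (1/2) (1 - t²)^(l+1) t^(b+1) U(r, t), which is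
zero at both ends. -/
theorem integral_slope_deriv {b : ℝ} (hb : 0 ≤ b) {l : ℂ} (hl : -1 < l.re) {U : ℝ × ℝ → ℂ}
    (hU : ContDiff ℝ ∞ U) (r : ℝ) {f : ℝ → ℂ} (hf : IntegrableOn f (Set.Ioo 0 1))
    (hf' : ∀ t ∈ Set.Ioo (0 : ℝ) 1, f t = ((1 - t ^ 2 : ℝ) : ℂ) ^ (l + 1) * ((t ^ b : ℝ) : ℂ) *
      ((l + 1 + (b + 1) / 2) * U (r, t) + sndEuler U (r, t)) -
      (l + 1) * (((1 - t ^ 2 : ℝ) : ℂ) ^ l * ((t ^ b : ℝ) : ℂ) * U (r, t))) :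
    ∫ t in Set.Ioo (0 : ℝ) 1, f t = 0 := by
  have hl2 : 0 < (l + 1).re := by simp; linarith
  have hl3 : l + 1 ≠ 0 := fun h => by rw [h] at hl2; simp at hl2
  have hd : ∀ t ∈ Set.Ioo (0 : ℝ) 1, HasDerivAt (fun t : ℝ => (1 / 2 : ℂ) *
      (((1 - t ^ 2 : ℝ) : ℂ) ^ (l + 1) * ((t ^ (b + 1) : ℝ) : ℂ) * U (r, t))) (f t) t := by
    intro t ht
    refine ((((hasDerivAt_one_sub_sq_cpow hl ht).mul (hasDerivAt_ofReal_rpow hb)).mul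
      (hasDerivAt_snd hU r t)).const_mul (1 / 2 : ℂ)).congr_deriv ?_
    have h0 : ((1 - t ^ 2 : ℝ) : ℂ) ≠ 0 := by
      have h1 := ht.1
      have h2 := ht.2
      have : (1 - t ^ 2 : ℝ) ≠ 0 := by nlinarith
      exact_mod_cast this
    rw [hf' t ht]
    simp only [Pi.mul_apply]
    rw [Complex.cpow_add _ _ h0, Complex.cpow_one, Real.rpow_add_one ht.1.ne']
    simp only [sndEuler]
    push_cast
    ring
  rw [← integral_Ioc_eq_integral_Ioo, ← intervalIntegral.integral_of_le zero_le_one,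
    intervalIntegral.integral_eq_sub_of_hasDerivAt_of_le zero_le_one ?_ hd ?_]
  · have : (b + 1) ≠ 0 := by linarith
    simp [Complex.zero_cpow hl3, Real.zero_rpow this]
  · refine Continuous.continuousOn (continuous_const.mul ((Continuous.mul ?_ ?_).mul ?_))
    · exact (Complex.continuous_ofReal_cpow_const hl2).comp (by fun_prop : Continuous
        fun t : ℝ => 1 - t ^ 2)
    · exact Complex.continuous_ofReal.comp (Real.continuous_rpow_const (by linarith))
    · exact hU.continuous.comp (by fun_prop)
  · rw [intervalIntegrable_iff_integrableOn_Ioo_of_le zero_le_one]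
    exact hf

/-- Integration by parts in the slope variable. -/
theorem VanishesToOrder.coneIntegral_slope {b : ℝ} (hb : 0 ≤ b) {n : ℕ} {U : profile}
    (hU : VanishesToOrder n U) {α l : ℂ} (hα : 0 < α.re + n) (hl : -1 < l.re) :
    (l + 1) * coneIntegral b α l U =
      (l + 1 + (b + 1) / 2) * coneIntegral b α (l + 1) U +
        coneIntegral b α (l + 1) (ConePower.slopeEuler U) := by
  have hl1 : -1 < (l + 1).re := by simp; linarith
  have i1 := (hU.smul (l + 1 + (b + 1) / 2)).add hU.slopeEuler
  have j1 := i1.integrableOn hb hα hl1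
  have j2 := (hU.integrableOn hb hα hl).const_mul (l + 1)
  rw [← coneIntegral_smul b α (l + 1) (l + 1 + (b + 1) / 2),
    ← (hU.smul _).coneIntegral_add hb hU.slopeEuler hα hl1]
  unfold coneIntegral
  rw [mul_left_comm, ← integral_const_mul (l + 1)]
  refine congrArg ((2 : ℂ) * ·) (sub_eq_zero.1 ?_)
  rw [← neg_eq_zero, neg_sub, ← integral_sub j1 j2]
  refine (setIntegral_halfStrip (j1.sub j2)).trans (integral_eq_zero_of_ae ?_)
  filter_upwards [ae_integrableOn_snd (j1.sub j2)] with r hr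
  -- The radial factor is constant in t and is divided out; if it is zero the integrand is zero.
  by_cases h0 : (r : ℂ) ^ (α - 1) = 0
  · simp [coneKernel, h0]
  have h1 := integral_slope_deriv hb hl (contDiff_profile U) r (hr.const_mul ((r : ℂ) ^ (α - 1))⁻¹)
    fun t _ => by
      simp only [coneKernel, Pi.sub_apply, Submodule.coe_add, Submodule.coe_smul, Pi.add_apply,
        Pi.smul_apply, smul_eq_mul]
      rw [show (ConePower.slopeEuler U).1 = sndEuler U.1 from rfl]
      field_simp
  rw [integral_const_mul] at h1
  exact (mul_eq_zero.1 h1).resolve_left (inv_ne_zero h0)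

/-- Twice the integrand in t is ∂/∂t (t^(b+1) U), with zero value at t = 0, so only the trace on the
cone t = 1 is left. -/
theorem VanishesToOrder.coneIntegral_slope_boundary {b : ℝ} (hb : 0 ≤ b) {n : ℕ} {U : profile}
    (hU : VanishesToOrder n U) {α : ℂ} (hα : 0 < α.re + n) :
    coneIntegral b α 0 (((b + 1) / 2 : ℂ) • U + ConePower.slopeEuler U) =
      ∫ r in Set.Ioi (0 : ℝ), (r : ℂ) ^ (α - 1) * U.1 (r, 1) := by
  have i1 := ((hU.smul ((b + 1) / 2)).add hU.slopeEuler).integrableOn hb hα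
    (l := 0) (by simp)
  unfold coneIntegral
  rw [setIntegral_halfStrip i1, ← integral_const_mul]
  refine integral_congr_ae ?_
  filter_upwards [ae_integrableOn_snd i1] with r hr
  rw [← integral_const_mul, ← integral_Ioc_eq_integral_Ioo,
    ← intervalIntegral.integral_of_le zero_le_one,
    intervalIntegral.integral_eq_sub_of_hasDerivAt_of_le (f := fun t : ℝ => (r : ℂ) ^ (α - 1) *
      (((t ^ (b + 1) : ℝ) : ℂ) * U.1 (r, t))) zero_le_one]
  · have : (b + 1) ≠ 0 := by linarith
    simp [Real.zero_rpow this]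
  · refine Continuous.continuousOn (continuous_const.mul (Continuous.mul ?_ ?_))
    · exact Complex.continuous_ofReal.comp (Real.continuous_rpow_const (by linarith))
    · exact (contDiff_profile U).continuous.comp (by fun_prop)
  · intro t ht
    refine (((hasDerivAt_ofReal_rpow hb).mul
      (hasDerivAt_snd (contDiff_profile U) r t)).const_mul _).congr_deriv ?_
    simp only [coneKernel, Submodule.coe_add, Submodule.coe_smul, Pi.add_apply,
        Pi.smul_apply, smul_eq_mul, Complex.cpow_zero]
    rw [show (ConePower.slopeEuler U).1 = sndEuler U.1 from rfl, Real.rpow_add_one ht.1.ne']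
    simp only [sndEuler]
    push_cast
    ring
  · rw [intervalIntegrable_iff_integrableOn_Ioo_of_le zero_le_one]
    exact hr.const_mul 2

/-- Integration by parts in the radial variable. -/
theorem coneIntegral_radialEuler {b : ℝ} (hb : 0 ≤ b) (U : profile) {α l : ℂ} (hα : 0 < α.re)
    (hl : -1 < l.re) :
    coneIntegral b α l (radialEuler U) = -α * coneIntegral b α l U := by
  have hα' : 0 < α.re + (0 : ℕ) := by simpa using hα
  have hα0 : α ≠ 0 := fun h => by rw [h] at hα; simp at hα
  have i1 := (vanishesToOrder_zero (radialEuler U + α • U)).integrableOn hb hα' hl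
  rw [← sub_eq_zero, neg_mul, sub_neg_eq_add, ← coneIntegral_smul,
    ← (vanishesToOrder_zero (radialEuler U)).coneIntegral_add hb (vanishesToOrder_zero _) hα' hl]
  unfold coneIntegral
  rw [setIntegral_halfStrip_symm i1]
  refine mul_eq_zero_of_right _ (integral_eq_zero_of_ae ?_)
  filter_upwards [ae_integrableOn_fst i1] with t ht
  set w : ℂ := ((1 - t ^ 2 : ℝ) : ℂ) ^ l * ((t ^ b : ℝ) : ℂ) with hw
  obtain ⟨R, hR, hR'⟩ := exists_profile_eq_zero U
  -- The integrand of r ∂U/∂r + α U is the r-derivative of r^α U w; this is zero at r = 0 because Re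
  -- α > 0, and zero for large r.
  have h := integral_Ioi_of_hasDerivAt_of_tendsto
    (f := fun r : ℝ => (r : ℂ) ^ α * U.1 (r, t) * w) (a := 0) (m := 0) ?_ (fun r hr => ?_) ht ?_
  · rw [h]
    simp [Complex.zero_cpow hα0]
  · refine Continuous.continuousWithinAt ((Continuous.mul ?_ ?_).mul continuous_const)
    · exact Complex.continuous_ofReal_cpow_const hα
    · exact (contDiff_profile U).continuous.comp (by fun_prop)
  · have hr0 : r ≠ 0 := ne_of_gt hr
    have hr0' : (r : ℂ) ≠ 0 := by exact_mod_cast hr0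
    have h1 := hasDerivAt_ofReal_cpow_const hr0 hα0
    refine ((h1.mul (hasDerivAt_fst (contDiff_profile U) r t)).mul_const w).congr_deriv ?_
    simp only [coneKernel, Submodule.coe_add, Submodule.coe_smul, Pi.add_apply,
        Pi.smul_apply, smul_eq_mul]
    rw [show (radialEuler U).1 = fstEuler U.1 from rfl, hw]
    simp only [fstEuler]
    rw [Complex.cpow_sub _ _ hr0', Complex.cpow_one]
    field_simp
    ring
  · refine tendsto_const_nhds.congr' ?_
    filter_upwards [eventually_gt_atTop R] with r hr
    rw [hR' r t (hr.trans_le (le_abs_self r))]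
    simp

end Recursions

end ConePower
end

noncomputable section
namespace ConePower

/-! ### Meromorphic continuation, residues and regularization -/

section Continuation

/-- The continuation of `coneIntegral` to `Re l > -1 - K` by integration by parts in the slope
variable. -/
def slopeExt (b : ℝ) : ℕ → ℂ → ℂ → profile → ℂ
  | 0, α, l, U => coneIntegral b α l U
  | K + 1, α, l, U => ((l + 1 + (b + 1) / 2) * slopeExt b K α (l + 1) U +
      slopeExt b K α (l + 1) (slopeEuler U)) / (l + 1)

theorem VanishesToOrder.slopeExt_eq {b : ℝ} (hb : 0 ≤ b) {n : ℕ} {U : profile}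
    (hU : VanishesToOrder n U) {α l : ℂ} (hα : 0 < α.re + n) (hl : -1 < l.re) (K : ℕ) :
    slopeExt b K α l U = coneIntegral b α l U := by
  induction K generalizing U l with
  | zero => rfl
  | succ K ih =>
    have hl1 : -1 < (l + 1).re := by simp; linarith
    have hl3 : l + 1 ≠ 0 := fun h => by
      have h' := congrArg Complex.re h
      simp at h'
      linarith
    rw [slopeExt, ih hU hl1, ih hU.slopeEuler hl1, ← hU.coneIntegral_slope hb hα hl,
      mul_div_cancel_left₀ _ hl3]

theorem VanishesToOrder.analyticAt_coneIntegral {b : ℝ} (hb : 0 ≤ b) {n : ℕ} {U : profile}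
    (hU : VanishesToOrder n U) {A L : ℂ → ℂ} (hA : Differentiable ℂ A) (hL : Differentiable ℂ L)
    {z₀ : ℂ} (hα : 0 < (A z₀).re + n) (hl : -1 < (L z₀).re) :
    AnalyticAt ℂ (fun z => coneIntegral b (A z) (L z) U) z₀ := by
  rw [Complex.analyticAt_iff_eventually_differentiableAt]
  have cA : Tendsto (fun z => (A z).re + n) (𝓝 z₀) (𝓝 ((A z₀).re + n)) :=
    ((Complex.continuous_re.comp hA.continuous).add continuous_const).tendsto z₀
  have cL : Tendsto (fun z => (L z).re) (𝓝 z₀) (𝓝 (L z₀).re) :=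
    (Complex.continuous_re.comp hL.continuous).tendsto z₀
  filter_upwards [cA.eventually_const_lt hα, cL.eventually_const_lt hl] with z h1 h2
  exact hU.differentiableAt_coneIntegral hb hA hL h1 h2

theorem VanishesToOrder.meromorphicAt_slopeExt {b : ℝ} (hb : 0 ≤ b) {n : ℕ} {U : profile}
    (hU : VanishesToOrder n U) {A L : ℂ → ℂ} (hA : Differentiable ℂ A) (hL : Differentiable ℂ L)
    {z₀ : ℂ} (hα : 0 < (A z₀).re + n) {K : ℕ} (hl : -1 - (K : ℝ) < (L z₀).re) :
    MeromorphicAt (fun z => slopeExt b K (A z) (L z) U) z₀ := by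
  induction K generalizing U L with
  | zero => exact (hU.analyticAt_coneIntegral hb hA hL hα (by simpa using hl)).meromorphicAt
  | succ K ih =>
    have hL1 : Differentiable ℂ fun z => L z + 1 := hL.add_const 1
    have hl1 : -1 - (K : ℝ) < (L z₀ + 1).re := by
      push_cast at hl
      simp only [Complex.add_re, Complex.one_re]
      linarith
    have mL : MeromorphicAt L z₀ := (hL.analyticAt z₀).meromorphicAt
    have m1 := ih hU hL1 hl1
    have m2 := ih hU.slopeEuler hL1 hl1
    exact ((((mL.add (MeromorphicAt.const 1 z₀)).add (MeromorphicAt.const _ z₀)).mul m1).add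
      m2).div (mL.add (MeromorphicAt.const 1 z₀))

/-- The product of the operators `(b + 1) / 2 - i + (t / 2) ∂/∂t` for `1 ≤ i ≤ j`. -/
def slopeFactor (b : ℝ) : ℕ → Module.End ℂ profile
  | 0 => 1
  | j + 1 => slopeFactor b j * (((b + 1) / 2 - (j + 1) : ℂ) • 1 + slopeEuler)

theorem commute_slopeFactor_slopeEuler (b : ℝ) (j : ℕ) :
    Commute (slopeFactor b j) slopeEuler := by
  induction j with
  | zero => exact Commute.one_left _
  | succ j ih =>
    exact Commute.mul_left ih (((Commute.one_left _).smul_left _).add_left (Commute.refl _))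

theorem commute_taylorKiller_slopeFactor (b : ℝ) (m j : ℕ) :
    Commute (taylorKiller m) (slopeFactor b j) := by
  induction j with
  | zero => exact Commute.one_right _
  | succ j ih =>
    exact Commute.mul_right ih (((Commute.one_right _).smul_right _).add_right
      (commute_taylorKiller_slopeEuler m))

theorem VanishesToOrder.slopeFactor (b : ℝ) {n : ℕ} {U : profile} (hU : VanishesToOrder n U)
    (j : ℕ) : VanishesToOrder n (slopeFactor b j U) := by
  induction j generalizing U with
  | zero => exact hU
  | succ j ih => exact ih ((hU.smul _).add hU.slopeEuler)

theorem slopeFactor_succ_apply (b : ℝ) (j : ℕ) (U : profile) :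
    slopeFactor b (j + 1) U = ((b + 1) / 2 - (j + 1) : ℂ) • slopeFactor b j U +
      slopeFactor b j (slopeEuler U) := by
  simp only [slopeFactor, Module.End.mul_apply, LinearMap.add_apply, LinearMap.smul_apply,
    Module.End.one_apply, map_add, map_smul]

/-- The operator `(b + 1) / 2 + (t / 2) ∂/∂t`. -/
def slopeBoundary (b : ℝ) : Module.End ℂ profile := ((b + 1) / 2 : ℂ) • 1 + slopeEuler

theorem slopeBoundary_apply (b : ℝ) (U : profile) :
    slopeBoundary b U = ((b + 1) / 2 : ℂ) • U + slopeEuler U := rfl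

theorem VanishesToOrder.slopeBoundary (b : ℝ) {n : ℕ} {U : profile} (hU : VanishesToOrder n U) :
    VanishesToOrder n (slopeBoundary b U) :=
  (hU.smul _).add hU.slopeEuler

theorem commute_taylorKiller_slopeBoundary (b : ℝ) (m : ℕ) :
    Commute (taylorKiller m) (slopeBoundary b) :=
  ((Commute.one_right _).smul_right _).add_right (commute_taylorKiller_slopeEuler m)

/-- The residue of the continuation in the exponent `l`. -/
theorem VanishesToOrder.tendsto_slopeExt {b : ℝ} (hb : 0 ≤ b) {n : ℕ} {U : profile}
    (hU : VanishesToOrder n U) {A : ℂ → ℂ} (hA : Differentiable ℂ A) (j : ℕ) (s : ℂ)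
    (hα : 0 < (A (-(j + 1) - s)).re + n) :
    Tendsto (fun z => (z + s + (j + 1)) * slopeExt b (j + 1) (A z) (z + s) U)
      (𝓝[≠] (-(j + 1) - s)) (𝓝 ((-1) ^ j / (j.factorial : ℂ) *
        coneIntegral b (A (-(j + 1) - s)) 0
          (ConePower.slopeBoundary b (ConePower.slopeFactor b j U)))) := by
  -- The shift `s` absorbs the passage from l to l + 1: with `s + 1` in place of `s` the case j has
  -- the same limit point in `z` as the case j + 1, and `A` is unchanged.
  induction j generalizing U s with
  | zero =>
    simp only [Nat.cast_zero, zero_add] at hα ⊢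
    set z₀ : ℂ := -1 - s with hz₀
    have hL : Differentiable ℂ fun z : ℂ => z + s + 1 := by fun_prop
    have hl : -1 < (z₀ + s + 1).re := by simp [hz₀]
    have c1 := (hU.differentiableAt_coneIntegral hb hA hL hα hl).continuousAt
    have c2 := (hU.slopeEuler.differentiableAt_coneIntegral hb hA hL hα hl).continuousAt
    have c3 : ContinuousAt (fun z : ℂ => z + s + 1 + ((b : ℂ) + 1) / 2) z₀ := by fun_prop
    have h := ((c3.mul c1).add c2).tendsto
    have e : z₀ + s + 1 = 0 := by simp [hz₀]
    have hval : coneIntegral b (A z₀) 0 (ConePower.slopeBoundary b (ConePower.slopeFactor b 0 U)) =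
        (z₀ + s + 1 + ((b : ℂ) + 1) / 2) * coneIntegral b (A z₀) (z₀ + s + 1) U +
          coneIntegral b (A z₀) (z₀ + s + 1) (ConePower.slopeEuler U) := by
      rw [e, zero_add, slopeBoundary_apply, show ConePower.slopeFactor b 0 U = U from rfl,
        (hU.smul _).coneIntegral_add hb hU.slopeEuler hα (by simp), coneIntegral_smul]
    rw [pow_zero, Nat.factorial_zero, Nat.cast_one, div_one, one_mul, hval]
    refine (h.mono_left nhdsWithin_le_nhds).congr' ?_
    filter_upwards [self_mem_nhdsWithin] with z hz
    have hz' : z + s + 1 ≠ 0 := fun h => hz (by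
      simp only [Set.mem_singleton_iff, hz₀]
      linear_combination h)
    simp only [slopeExt, Pi.add_apply, Pi.mul_apply]
    field_simp
  | succ j ih =>
    set z₀ : ℂ := -((j + 1 : ℕ) + 1) - s with hz₀
    have ez : -((j : ℂ) + 1) - (s + 1) = z₀ := by rw [hz₀]; push_cast; ring
    have h1 := ih hU (s + 1) (by rw [ez]; exact hα)
    have h2 := ih hU.slopeEuler (s + 1) (by rw [ez]; exact hα)
    rw [ez] at h1 h2
    -- At the limit point the new denominator is -(j+1), not zero. It turns (-1)^j / j! into
    -- (-1)^(j+1) / (j+1)!, and the numerator z + s + 1 + (b+1)/2 tends to the constant of the next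
    -- factor in `slopeFactor`.
    have e1 : z₀ + s + 1 = -((j : ℂ) + 1) := by rw [hz₀]; push_cast; ring
    have hj : (j : ℂ) + 1 ≠ 0 := by exact_mod_cast Nat.succ_ne_zero j
    have c3 : ContinuousAt (fun z : ℂ => (z + s + 1 + ((b : ℂ) + 1) / 2) / (z + s + 1)) z₀ := by
      refine ContinuousAt.div (by fun_prop) (by fun_prop) ?_
      rw [e1]; exact neg_ne_zero.2 hj
    have c4 : ContinuousAt (fun z : ℂ => 1 / (z + s + 1)) z₀ := by
      refine ContinuousAt.div (by fun_prop) (by fun_prop) ?_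
      rw [e1]; exact neg_ne_zero.2 hj
    have h := ((c3.tendsto.mono_left nhdsWithin_le_nhds).mul h1).add
      ((c4.tendsto.mono_left nhdsWithin_le_nhds).mul h2)
    rw [e1] at h
    have hV := hU.slopeFactor b j
    have hV' := hU.slopeEuler.slopeFactor b j
    have hval : coneIntegral b (A z₀) 0
        (ConePower.slopeBoundary b (ConePower.slopeFactor b (j + 1) U)) =
        (((b : ℂ) + 1) / 2 - (j + 1)) * coneIntegral b (A z₀) 0
          (ConePower.slopeBoundary b (ConePower.slopeFactor b j U)) +
        coneIntegral b (A z₀) 0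
          (ConePower.slopeBoundary b (ConePower.slopeFactor b j (ConePower.slopeEuler U))) := by
      rw [slopeFactor_succ_apply, map_add, map_smul,
        ((hV.slopeBoundary b).smul _).coneIntegral_add hb (hV'.slopeBoundary b) hα (by simp),
        coneIntegral_smul]
    rw [hval]
    have hf : (j.factorial : ℂ) ≠ 0 := by exact_mod_cast j.factorial_ne_zero
    convert h.congr' ?_ using 2
    · rw [Nat.factorial_succ, pow_succ]
      push_cast
      field_simp
      ring
    · filter_upwards with z
      rw [show slopeExt b (j + 1 + 1) (A z) (z + s) U = ((z + s + 1 + (b + 1) / 2) *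
        slopeExt b (j + 1) (A z) (z + s + 1) U +
        slopeExt b (j + 1) (A z) (z + s + 1) (ConePower.slopeEuler U)) / (z + s + 1) from rfl,
        ← add_assoc]
      push_cast
      ring_nf

/-- The continuation of `coneIntegral` to `Re l > -1 - K`, `Re α > -2 m`. -/
def coneExt (b : ℝ) (m K : ℕ) (α l : ℂ) (U : profile) : ℂ :=
  slopeExt b K α l (taylorKiller m U) / ∏ i ∈ Finset.range m, (-(α + 2 * i))

/-- By radial integration by parts, each factor r ∂/∂r - 2 i acts under the integral as -α - 2 i;
the denominator of `coneExt` cancels these numbers. -/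
theorem coneIntegral_taylorKiller {b : ℝ} (hb : 0 ≤ b) (U : profile) {α l : ℂ} (hα : 0 < α.re)
    (hl : -1 < l.re) (m : ℕ) :
    coneIntegral b α l (taylorKiller m U) =
      (∏ i ∈ Finset.range m, (-(α + 2 * i))) * coneIntegral b α l U := by
  induction m with
  | zero => simp [taylorKiller]
  | succ m ih =>
    have e : taylorKiller (m + 1) U = radialEuler (taylorKiller m U) +
        (-(2 * m : ℂ)) • taylorKiller m U := by
      have e' : taylorKiller (m + 1) U = radialEuler (taylorKiller m U) -
        (2 * m : ℂ) • taylorKiller m U := rfl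
      rw [e']
      module
    rw [e, (vanishesToOrder_zero _).coneIntegral_add hb (vanishesToOrder_zero _)
      (by simpa using hα) hl, coneIntegral_smul, coneIntegral_radialEuler hb _ hα hl, ih,
      Finset.prod_range_succ]
    ring

theorem coneExt_eq {b : ℝ} (hb : 0 ≤ b) (U : profile) {α l : ℂ} (hα : 0 < α.re)
    (hl : -1 < l.re) (m K : ℕ) : coneExt b m K α l U = coneIntegral b α l U := by
  have hp : ∏ i ∈ Finset.range m, (-(α + 2 * i)) ≠ 0 := by
    refine Finset.prod_ne_zero_iff.2 fun i _ h => ?_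
    have h' := congrArg Complex.re h
    simp at h'
    have : (0 : ℝ) ≤ i := i.cast_nonneg
    linarith
  rw [coneExt, (vanishesToOrder_zero _).slopeExt_eq hb (by simpa using hα) hl,
    coneIntegral_taylorKiller hb U hα hl, mul_div_cancel_left₀ _ hp]

theorem meromorphicAt_coneExt {b : ℝ} (hb : 0 ≤ b) (U : profile) {A L : ℂ → ℂ}
    (hA : Differentiable ℂ A) (hL : Differentiable ℂ L) {z₀ : ℂ} {m K : ℕ}
    (hα : 0 < (A z₀).re + 2 * m) (hl : -1 - (K : ℝ) < (L z₀).re) :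
    MeromorphicAt (fun z => coneExt b m K (A z) (L z) U) z₀ := by
  refine ((vanishesToOrder_taylorKiller m U).meromorphicAt_slopeExt hb hA hL
    (by push_cast; exact hα) hl).div (AnalyticAt.meromorphicAt ?_)
  exact (Differentiable.fun_finsetProd fun i _ => (hA.add_const _).neg).analyticAt z₀

/-- The weighted power integral of a profile has a meromorphic continuation. -/
theorem exists_meromorphic_coneIntegral {b : ℝ} (hb : 0 ≤ b) (U : profile) {N : ℝ} (hN : 2 ≤ N) :
    ∃ F : ℂ → ℂ, MeromorphicOn F Set.univ ∧
      ∀ l : ℂ, -1 < l.re → F l = coneIntegral b (2 * l + N) l U := by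
  refine exists_meromorphic_extension fun B => ?_
  -- For Re l > B these choices give Re l > -1 - K and Re (2 l + N) > -2 m.
  obtain ⟨K, hK⟩ := exists_nat_gt (-1 - B)
  obtain ⟨m, hm⟩ := exists_nat_gt (-B - N / 2)
  refine ⟨fun l => coneExt b m K (2 * l + N) l U, fun z hz => ?_, fun z hz => ?_⟩
  · simp only [Set.mem_ofPred_eq] at hz
    refine meromorphicAt_coneExt hb U (A := fun l => 2 * l + N) (L := fun l => l) (by fun_prop)
      (by fun_prop) ?_ (by linarith)
    simp
    linarith
  · exact coneExt_eq hb U (by simp; linarith) hz m K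

/-- The residues of the meromorphic continuation of the weighted power integral of a profile. -/
theorem tendsto_meromorphic_coneIntegral {b : ℝ} (hb : 0 ≤ b) (U : profile) {N : ℝ} (hN : 2 ≤ N)
    {F : ℂ → ℂ} (hF : MeromorphicOn F Set.univ)
    (hFI : ∀ l : ℂ, -1 < l.re → F l = coneIntegral b (2 * l + N) l U) (j m : ℕ)
    (hm : 0 < N - 2 * (j + 1) + 2 * m) (hres : ∀ i : ℕ, N - 2 * (j + 1) ≠ -(2 * i)) :
    Tendsto (fun l => (l + (j + 1)) * F l) (𝓝[≠] (-(j + 1))) (𝓝 ((-1) ^ j / (j.factorial : ℂ) *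
      coneExt b m 0 ((N - 2 * (j + 1) : ℝ) : ℂ) 0 (slopeBoundary b (slopeFactor b j U)))) := by
  set α₀ : ℂ := ((N - 2 * (j + 1) : ℝ) : ℂ) with hα₀
  have hA : Differentiable ℂ fun l : ℂ => 2 * l + (N : ℂ) := by fun_prop
  -- Near -(j+1) one explicit continuation suffices: K = j + 1 works for Re l > -j - 2, and m for Re
  -- l > -m - N/2.
  have hev : F =ᶠ[𝓝[≠] (-(j + 1) : ℂ)] fun l => coneExt b m (j + 1) (2 * l + N) l U := by
    refine eventuallyEq_of_eq_of_re_gt (B := max (-(j : ℝ) - 2) (-m - N / 2)) (c := -1)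
      (fun z _ => hF z trivial) (fun z hz => ?_) (fun z hz => ?_) ?_
    · simp only [Set.mem_ofPred_eq, max_lt_iff] at hz
      refine meromorphicAt_coneExt hb U hA (L := fun l => l) (by fun_prop) ?_ ?_
      · simp; linarith
      · push_cast; linarith
    · rw [hFI z hz, coneExt_eq hb U (by simp; linarith) hz]
    · simp only [max_lt_iff, Complex.neg_re, Complex.add_re, Complex.natCast_re, Complex.one_re]
      constructor <;> linarith
  have eA : 2 * (-((j : ℂ) + 1) - 0) + (N : ℂ) = α₀ := by rw [hα₀]; push_cast; ring
  have h1 := (vanishesToOrder_taylorKiller m U).tendsto_slopeExt hb hA j 0 (by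
    rw [eA, hα₀, Complex.ofReal_re]; push_cast; linarith)
  rw [eA, sub_zero] at h1
  simp only [add_zero] at h1
  -- The vertex contributes no pole here: this is where the condition on N enters.
  have hp : ∏ i ∈ Finset.range m, (-(α₀ + 2 * (i : ℂ))) ≠ 0 := by
    refine Finset.prod_ne_zero_iff.2 fun i _ h => hres i ?_
    have h' : (((N - 2 * (j + 1) : ℝ) + 2 * i : ℝ) : ℂ) = 0 := by
      push_cast
      push_cast [hα₀] at h
      linear_combination -h
    have h'' := Complex.ofReal_eq_zero.1 h'
    linarith
  have c2 : ContinuousAt (fun l : ℂ => ∏ i ∈ Finset.range m, (-(2 * l + (N : ℂ) + 2 * (i : ℂ))))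
      (-((j : ℂ) + 1)) := by fun_prop
  have c3 := c2.tendsto.mono_left (nhdsWithin_le_nhds (s := {-((j : ℂ) + 1)}ᶜ))
  rw [sub_zero] at eA
  simp only [eA] at c3
  have h2 := h1.div c3 hp
  -- Operators in t commute with those in r, so the residue is again a `coneExt`.
  have hcomm : slopeBoundary b (slopeFactor b j (taylorKiller m U)) =
      taylorKiller m (slopeBoundary b (slopeFactor b j U)) := by
    have e1 := LinearMap.congr_fun (commute_taylorKiller_slopeFactor b m j).eq U
    have e2 := LinearMap.congr_fun (commute_taylorKiller_slopeBoundary b m).eq (slopeFactor b j U)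
    simp only [Module.End.mul_apply] at e1 e2
    rw [e2, e1]
  rw [hcomm, mul_div_assoc] at h2
  refine h2.congr' ?_
  filter_upwards [hev] with l hl
  rw [hl, coneExt, Pi.div_apply, mul_div_assoc]

/-- The regularization of the integral of a profile with respect to `r ^ (β - 1)`. -/
theorem exists_meromorphic_regularization {b : ℝ} (hb : 0 ≤ b) (U : profile) {β : ℝ} {m : ℕ}
    (hm : 0 < β + 2 * m) (hres : ∀ i : ℕ, β ≠ -(2 * i)) :
    ∃ F : ℂ → ℂ, MeromorphicOn F Set.univ ∧ AnalyticAt ℂ F 0 ∧ F 0 = coneExt b m 0 β 0 U ∧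
      ∀ z : ℂ, max 0 (-β) < z.re → F z = coneIntegral b (z + β) 0 U := by
  obtain ⟨F, hF, hFI⟩ := exists_meromorphic_extension (c := max 0 (-β))
    (I := fun z => coneIntegral b (z + β) 0 U) fun B => by
      obtain ⟨m, hm⟩ := exists_nat_gt (-B - β)
      refine ⟨fun z => coneExt b m 0 (z + β) 0 U, fun z hz => ?_, fun z hz => ?_⟩
      · simp only [Set.mem_ofPred_eq] at hz
        refine meromorphicAt_coneExt hb U (A := fun z => z + β) (L := fun _ => 0) (by fun_prop)
          (by fun_prop) ?_ (by simp)
        have : (0 : ℝ) ≤ m := m.cast_nonneg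
        simp
        linarith
      · rw [max_lt_iff] at hz
        exact coneExt_eq hb U (by simp; linarith) (by simp) m 0
  have hA : Differentiable ℂ fun z : ℂ => z + (β : ℂ) := by fun_prop
  set G : ℂ → ℂ := fun z => coneExt b m 0 (z + β) 0 U with hG
  have hGan : AnalyticAt ℂ G 0 := by
    refine AnalyticAt.fun_div ((vanishesToOrder_taylorKiller m U).analyticAt_coneIntegral hb hA
      (L := fun _ => 0) (by fun_prop) (by simpa using hm) (by simp))
      ((Differentiable.fun_finsetProd fun i _ => (hA.add_const _).neg).analyticAt 0) ?_
    refine Finset.prod_ne_zero_iff.2 fun i _ h => hres i ?_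
    have h' : ((β + 2 * i : ℝ) : ℂ) = 0 := by
      push_cast
      linear_combination -h
    have h'' := Complex.ofReal_eq_zero.1 h'
    linarith
  have hFG : F =ᶠ[𝓝[≠] (0 : ℂ)] G := by
    refine eventuallyEq_of_eq_of_re_gt (B := -β - 2 * m) (c := max 0 (-β))
      (fun z _ => hF z trivial) (fun z hz => ?_) (fun z hz => ?_) (by simp; linarith)
    · simp only [Set.mem_ofPred_eq] at hz
      exact meromorphicAt_coneExt hb U hA (L := fun _ => 0) (by fun_prop) (by simp; linarith)
        (by simp)
    · rw [hFI z hz]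
      rw [max_lt_iff] at hz
      exact (coneExt_eq hb U (by simp; linarith) (by simp) m 0).symm
  -- `F` is known to equal `G` only in a punctured neighbourhood of 0, so its value at 0 is reset to
  -- make it analytic there.
  have hupd : Function.update F 0 (G 0) =ᶠ[𝓝 0] G := by
    rw [Filter.EventuallyEq, eventually_nhdsWithin_iff] at hFG
    filter_upwards [hFG] with z hz
    by_cases h : z = 0
    · subst h; simp
    · rw [Function.update_of_ne h]; exact hz h
  refine ⟨Function.update F 0 (G 0), fun z _ => ?_, hGan.congr hupd.symm, ?_, fun z hz => ?_⟩
  · refine (hF z trivial).congr ?_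
    by_cases h : z = 0
    · subst h
      filter_upwards [self_mem_nhdsWithin] with w hw
      rw [Function.update_of_ne hw]
    · apply eventually_nhdsWithin_of_eventually_nhds
      filter_upwards [isOpen_ne.mem_nhds h] with w hw
      rw [Function.update_of_ne hw]
  · simp [hG]
  · have : z ≠ 0 := by rintro rfl; rw [max_lt_iff] at hz; simp at hz
    rw [Function.update_of_ne this, hFI z hz]

end Continuation

end ConePower
end

noncomputable section
namespace ConePower

/-! ### Smoothness of averages along linear maps -/

section ParametricIntegral

set_option linter.unusedSectionVars false

variable {ι : Type} [Fintype ι] [DecidableEq ι] {X : Type*} [MeasurableSpace X]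
  {E : Type*} [NormedAddCommGroup E] [NormedSpace ℝ E]

theorem exists_bound_of_continuous_of_eq_zero {f : (ι → ℝ) → ℂ} (hf : Continuous f) {R : ℝ}
    (hR : ∀ x, R < ‖x‖ → f x = 0) : ∃ C, 0 ≤ C ∧ ∀ x, ‖f x‖ ≤ C := by
  obtain ⟨C, hC⟩ := (isCompact_closedBall (0 : ι → ℝ) R).exists_bound_of_continuousOn
    hf.continuousOn
  refine ⟨max C 0, le_max_right _ _, fun x => ?_⟩
  by_cases h : R < ‖x‖
  · rw [hR x h, norm_zero]; exact le_max_right _ _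
  · exact (hC x (by simpa using not_lt.1 h)).trans (le_max_left _ _)

/-- The linear map `y ↦ (κ i * e i y)_i`. -/
def scaledCoords (e : ι → E →L[ℝ] ℝ) (κ : ι → ℝ) : E →L[ℝ] (ι → ℝ) :=
  ContinuousLinearMap.pi fun i => κ i • e i

theorem scaledCoords_apply (e : ι → E →L[ℝ] ℝ) (κ : ι → ℝ) (y : E) (i : ι) :
    scaledCoords e κ y i = κ i * e i y := by
  simp [scaledCoords]

theorem measurable_scaledCoords (e : ι → E →L[ℝ] ℝ) {κ : X → ι → ℝ} (hκ : Measurable κ) (y : E) :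
    Measurable fun a => scaledCoords e (κ a) y := by
  refine measurable_pi_lambda _ fun i => ?_
  simp only [scaledCoords_apply]
  exact ((measurable_pi_apply i).comp hκ).mul_const _

/-- Averages of smooth functions with bounded support along a bounded family of linear maps are
smooth. -/
theorem contDiff_integral_scaledCoords {μ : Measure X} [IsFiniteMeasure μ] (e : ι → E →L[ℝ] ℝ)
    {κ : X → ι → ℝ} (hκ : Measurable κ) (hκ1 : ∀ a i, |κ a i| ≤ 1) {f : (ι → ℝ) → ℂ}
    (hf : ContDiff ℝ ∞ f) {R : ℝ} (hR : ∀ x, R < ‖x‖ → f x = 0) {w : X → ℝ} (hw : Measurable w)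
    (hw1 : ∀ a, |w a| ≤ 1) :
    ContDiff ℝ ∞ fun y : E => ∫ a, (w a : ℂ) * f (scaledCoords e (κ a) y) ∂μ := by
  refine contDiff_infty.2 fun n => ?_
  have hmeas : ∀ {g : (ι → ℝ) → ℂ} {v : X → ℝ}, ContDiff ℝ ∞ g → Measurable v → ∀ y,
      AEStronglyMeasurable (fun a => (v a : ℂ) * g (scaledCoords e (κ a) y)) μ := by
    intro g v hg hv y
    exact ((Complex.measurable_ofReal.comp hv).mul
      (hg.continuous.measurable.comp (measurable_scaledCoords e hκ y))).aestronglyMeasurable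
  have hint : ∀ {g : (ι → ℝ) → ℂ} {v : X → ℝ}, ContDiff ℝ ∞ g → (∀ x, R < ‖x‖ → g x = 0) →
      Measurable v → (∀ a, |v a| ≤ 1) → ∀ y,
      Integrable (fun a => (v a : ℂ) * g (scaledCoords e (κ a) y)) μ := by
    intro g v hg hgR hv hv1 y
    obtain ⟨C, hC0, hC⟩ := exists_bound_of_continuous_of_eq_zero hg.continuous hgR
    refine Integrable.of_bound (hmeas hg hv y) C (.of_forall fun a => ?_)
    rw [norm_mul, Complex.norm_real, Real.norm_eq_abs]
    calc |v a| * ‖g (scaledCoords e (κ a) y)‖ ≤ 1 * C := by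
          gcongr
          exacts [hv1 a, hC _]
      _ = C := one_mul C
  have hpart : ∀ {g : (ι → ℝ) → ℂ}, ContDiff ℝ ∞ g → ∀ i,
      ContDiff ℝ ∞ fun x => fderiv ℝ g x (Pi.single i 1) := fun hg i =>
    (hg.fderiv_right (by simp)).clm_apply contDiff_const
  have hpartR : ∀ {g : (ι → ℝ) → ℂ}, (∀ x, R < ‖x‖ → g x = 0) → ∀ i x, R < ‖x‖ →
      fderiv ℝ g x (Pi.single i 1) = 0 := by
    intro g hgR i x hx
    have : g =ᶠ[𝓝 x] fun _ => 0 := by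
      filter_upwards [(continuous_norm.tendsto x).eventually_const_lt hx] with y hy using hgR y hy
    rw [this.fderiv_eq]
    simp
  have hwκ : ∀ {v : X → ℝ}, Measurable v → ∀ i, Measurable fun a => v a * κ a i := fun hv i =>
    hv.mul ((measurable_pi_apply i).comp hκ)
  have hwκ1 : ∀ {v : X → ℝ}, (∀ a, |v a| ≤ 1) → ∀ i a, |v a * κ a i| ≤ 1 := fun hv i a => by
    rw [abs_mul]
    exact mul_le_one₀ (hv a) (abs_nonneg _) (hκ1 a i)
  -- Differentiation yields integrals of the same type, with ∂f/∂x i for `f` and w · κ i for `w`;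
  -- the bound 1 on the weight persists since |κ i| ≤ 1.
  induction n generalizing f w with
  | zero =>
    refine contDiff_zero.2 (continuous_iff_continuousAt.2 fun y₀ => ?_)
    obtain ⟨C, hC0, hC⟩ := exists_bound_of_continuous_of_eq_zero hf.continuous hR
    refine continuousAt_of_dominated (bound := fun _ => C) (.of_forall fun y => hmeas hf hw y)
      (.of_forall fun y => .of_forall fun a => ?_) (integrable_const C) (.of_forall fun a => ?_)
    · rw [norm_mul, Complex.norm_real, Real.norm_eq_abs]
      calc |w a| * ‖f (scaledCoords e (κ a) y)‖ ≤ 1 * C := by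
            gcongr
            exacts [hw1 a, hC _]
        _ = C := one_mul C
    · exact (continuous_const.mul
        (hf.continuous.comp (scaledCoords e (κ a)).continuous)).continuousAt
  | succ n ih =>
    push_cast
    rw [contDiff_succ_iff_hasFDerivAt]
    choose C hC0 hC using fun i => exists_bound_of_continuous_of_eq_zero (hpart hf i).continuous
      (hpartR hR i)
    refine ⟨fun y => ∑ i, (e i).smulRight (∫ a, ((w a * κ a i : ℝ) : ℂ) *
      fderiv ℝ f (scaledCoords e (κ a) y) (Pi.single i 1) ∂μ), ContDiff.sum fun i _ => ?_,
      fun y₀ => ?_⟩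
    · exact contDiff_const.smulRight (ih (hpart hf i) (hpartR hR i) (hwκ hw i) (hwκ1 hw1 i))
    · have hsum : (∑ i, (e i).smulRight (∫ a, ((w a * κ a i : ℝ) : ℂ) *
          fderiv ℝ f (scaledCoords e (κ a) y₀) (Pi.single i 1) ∂μ)) =
          ∫ a, ∑ i, (e i).smulRight (((w a * κ a i : ℝ) : ℂ) *
            fderiv ℝ f (scaledCoords e (κ a) y₀) (Pi.single i 1)) ∂μ := by
        rw [integral_finsetSum]
        · refine Finset.sum_congr rfl fun i _ => ?_
          exact ((ContinuousLinearMap.smulRightL ℝ E ℂ (e i)).integral_comp_comm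
            (hint (hpart hf i) (hpartR hR i) (hwκ hw i) (hwκ1 hw1 i) y₀)).symm
        · intro i _
          exact (ContinuousLinearMap.smulRightL ℝ E ℂ (e i)).integrable_comp
            (hint (hpart hf i) (hpartR hR i) (hwκ hw i) (hwκ1 hw1 i) y₀)
      beta_reduce
      rw [hsum]
      refine hasFDerivAt_integral_of_dominated_of_fderiv_le (s := Set.univ)
        (F' := fun y a => ∑ i, (e i).smulRight (((w a * κ a i : ℝ) : ℂ) *
          fderiv ℝ f (scaledCoords e (κ a) y) (Pi.single i 1)))
        (bound := fun _ => ∑ i, ‖e i‖ * C i) univ_mem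
        (.of_forall fun y => hmeas hf hw y) (hint hf hR hw hw1 y₀) ?_
        (.of_forall fun a y _ => ?_) (integrable_const _) (.of_forall fun a y _ => ?_)
      · refine Finset.aestronglyMeasurable_fun_sum _ fun i _ => ?_
        exact (ContinuousLinearMap.smulRightL ℝ E ℂ (e i)).continuous.comp_aestronglyMeasurable
          (hmeas (hpart hf i) (hwκ hw i) y₀)
      · refine norm_sum_le_of_le _ fun i _ => ?_
        rw [ContinuousLinearMap.norm_smulRight_apply, norm_mul, Complex.norm_real,
          Real.norm_eq_abs]
        refine mul_le_mul_of_nonneg_left ?_ (norm_nonneg _)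
        calc _ ≤ 1 * C i := by
              gcongr
              exacts [hwκ1 hw1 i a, hC i _]
          _ = C i := one_mul _
      · have h := (((hf.differentiable (by simp) _).hasFDerivAt.comp y
          (scaledCoords e (κ a)).hasFDerivAt).const_mul (w a : ℂ))
        refine h.congr_fderiv ?_
        ext v
        have hv : scaledCoords e (κ a) v = ∑ i, (κ a i * e i v) • (Pi.single i 1 : ι → ℝ) := by
          ext i
          simp [scaledCoords_apply, Finset.sum_apply, Pi.single_apply]
        simp only [_root_.smul_apply, ContinuousLinearMap.comp_apply, _root_.sum_apply,
          ContinuousLinearMap.smulRight_apply]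
        rw [hv, map_sum, Finset.smul_sum]
        refine Finset.sum_congr rfl fun i _ => ?_
        rw [map_smul]
        simp only [Complex.real_smul, smul_eq_mul]
        push_cast
        ring

end ParametricIntegral

end ConePower
end

noncomputable section
namespace ConePower

/-! ### The spherical mean as a profile -/

section SphericalMean

variable {p q : ℕ}

instance (d : ℕ) : IsFiniteMeasure (surfaceMeasure d) :=
  inferInstanceAs (IsFiniteMeasure (volume : Measure (EuclideanSpace ℝ (Fin d))).toSphere)

theorem continuous_sphere_coord {d : ℕ} (i : Fin d) :
    Continuous fun θ : Metric.sphere (0 : EuclideanSpace ℝ (Fin d)) 1 => θ.1 i :=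
  (EuclideanSpace.proj (𝕜 := ℝ) i).continuous.comp continuous_subtype_val

theorem isOpen_posSphere (d : ℕ) : IsOpen (posSphere d) := by
  have : posSphere d = ⋂ i, {x | 0 < x.1 i} := by
    ext θ; simp only [posSphere, Set.mem_ofPred_eq, Set.mem_iInter]
  rw [this]
  exact isOpen_iInter_of_finite fun i => isOpen_lt continuous_const (continuous_sphere_coord i)

theorem measurableSet_posSphere (d : ℕ) : MeasurableSet (posSphere d) :=
  (isOpen_posSphere d).measurableSet

theorem abs_sphere_coord_le {d : ℕ} (θ : Metric.sphere (0 : EuclideanSpace ℝ (Fin d)) 1)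
    (i : Fin d) : |θ.1 i| ≤ 1 := by
  have h := PiLp.norm_apply_le θ.1 i
  have h1 : ‖θ.1‖ = 1 := by simp
  rwa [h1, Real.norm_eq_abs] at h

theorem sum_sq_sphere {d : ℕ} (θ : Metric.sphere (0 : EuclideanSpace ℝ (Fin d)) 1) :
    ∑ i, θ.1 i ^ 2 = 1 := by
  have h1 : ‖θ.1‖ = 1 := by simp
  rw [← EuclideanSpace.real_norm_sq_eq, h1, one_pow]

/-- Pairs of points of the unit spheres of `ℝ^p` and `ℝ^q`. -/
abbrev SpherePair (p q : ℕ) : Type :=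
  Metric.sphere (0 : EuclideanSpace ℝ (Fin p)) 1 × Metric.sphere (0 : EuclideanSpace ℝ (Fin q)) 1

/-- The product surface measure on the positive parts of the spheres. -/
def posSphereMeasure (p q : ℕ) : Measure (SpherePair p q) :=
  ((surfaceMeasure p).restrict (posSphere p)).prod ((surfaceMeasure q).restrict (posSphere q))

instance : IsFiniteMeasure (posSphereMeasure p q) := by
  unfold posSphereMeasure; infer_instance

/-- The coordinates of a pair of points of the spheres. -/
def pairCoords (θ : SpherePair p q) : Fin p ⊕ Fin q → ℝ :=
  Sum.elim (fun i => θ.1.1 i) (fun j => θ.2.1 j)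

/-- The radius relevant for each coordinate. -/
def radii : Fin p ⊕ Fin q → (ℝ × ℝ →L[ℝ] ℝ) :=
  Sum.elim (fun _ => ContinuousLinearMap.fst ℝ ℝ ℝ) (fun _ => ContinuousLinearMap.snd ℝ ℝ ℝ)

theorem measurable_pairCoords : Measurable (pairCoords : SpherePair p q → Fin p ⊕ Fin q → ℝ) := by
  refine measurable_pi_lambda _ fun i => ?_
  rcases i with i | j
  · exact (continuous_sphere_coord i).measurable.comp measurable_fst
  · exact (continuous_sphere_coord j).measurable.comp measurable_snd

theorem abs_pairCoords_le (θ : SpherePair p q) (i : Fin p ⊕ Fin q) : |pairCoords θ i| ≤ 1 := by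
  rcases i with i | j
  · exact abs_sphere_coord_le θ.1 i
  · exact abs_sphere_coord_le θ.2 j

theorem scaledCoords_radii (θ : SpherePair p q) (r s : ℝ) :
    scaledCoords radii (pairCoords θ) (r, s) =
      Sum.elim (fun i => r * θ.1.1 i) (fun j => s * θ.2.1 j) := by
  ext i
  rw [scaledCoords_apply]
  rcases i with i | j <;> simp [pairCoords, radii, mul_comm]

theorem measurable_weight {ι : Type} [Fintype ι] (γ : ι → ℝ) : Measurable (weight γ) :=
  Finset.measurable_fun_prod _ fun i _ => (measurable_pi_apply i).pow_const _

theorem abs_weight_le_one {ι : Type} [Fintype ι] {γ : ι → ℝ} (hγ : ∀ i, 0 < γ i) {x : ι → ℝ}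
    (hx : ∀ i, |x i| ≤ 1) : |weight γ x| ≤ 1 := by
  unfold weight
  rw [Finset.abs_prod]
  refine Finset.prod_le_one (fun i _ => abs_nonneg _) fun i _ => ?_
  exact (Real.abs_rpow_le_abs_rpow _ _).trans
    (Real.rpow_le_one (abs_nonneg _) (hx i) (hγ i).le)

/-- The spherical mean of the even extension of a test function. -/
def sphMean (γ : Fin p ⊕ Fin q → ℝ) (φ : TestFunction (Fin p ⊕ Fin q)) (y : ℝ × ℝ) : ℂ :=
  (1 / 2) * ∫ θ, (weight γ (pairCoords θ) : ℂ) *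
    φ.evenExt (scaledCoords radii (pairCoords θ) y) ∂(posSphereMeasure p q)

theorem contDiff_sphMean {γ : Fin p ⊕ Fin q → ℝ} (hγ : ∀ i, 0 < γ i)
    (φ : TestFunction (Fin p ⊕ Fin q)) : ContDiff ℝ ∞ (sphMean γ φ) := by
  obtain ⟨R, _, hR⟩ := φ.exists_evenExt_eq_zero
  exact contDiff_const.mul (contDiff_integral_scaledCoords radii measurable_pairCoords
    abs_pairCoords_le φ.contDiff_evenExt hR ((measurable_weight γ).comp measurable_pairCoords)
    fun θ => abs_weight_le_one hγ (abs_pairCoords_le θ))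

theorem sphMean_neg (γ : Fin p ⊕ Fin q → ℝ) (φ : TestFunction (Fin p ⊕ Fin q)) (y : ℝ × ℝ) :
    sphMean γ φ (-y) = sphMean γ φ y := by
  simp only [sphMean, map_neg, TestFunction.evenExt_neg]

/-- If all coordinates r ω'ᵢ are at most R in modulus, then r² = Σ (r ω'ᵢ)² ≤ p R² ≤ (p R)². -/
theorem evenExt_scaledCoords_eq_zero {φ : TestFunction (Fin p ⊕ Fin q)} {R : ℝ} (hR : 0 < R)
    (hφ : ∀ x, R < ‖x‖ → φ.evenExt x = 0) (hp : 0 < p) (θ : SpherePair p q) {r : ℝ} (s : ℝ)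
    (hr : p * R < |r|) : φ.evenExt (scaledCoords radii (pairCoords θ) (r, s)) = 0 := by
  refine hφ _ (not_le.1 fun hle => ?_)
  have h1 : ∀ i : Fin p, (r * θ.1.1 i) ^ 2 ≤ R ^ 2 := fun i => by
    have h2 := (norm_le_pi_norm (scaledCoords radii (pairCoords θ) (r, s)) (Sum.inl i)).trans hle
    rw [scaledCoords_radii] at h2
    exact sq_le_sq.2 (by simpa [abs_of_pos hR] using h2)
  have h3 : r ^ 2 ≤ p * R ^ 2 := by
    calc r ^ 2 = ∑ i : Fin p, (r * θ.1.1 i) ^ 2 := by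
          simp only [mul_pow]
          rw [← Finset.mul_sum, sum_sq_sphere, mul_one]
      _ ≤ ∑ _i : Fin p, R ^ 2 := Finset.sum_le_sum fun i _ => h1 i
      _ = p * R ^ 2 := by simp
  have hp1 : (1 : ℝ) ≤ p := by exact_mod_cast hp
  have h4 : (p * R) ^ 2 < r ^ 2 := by
    rw [← sq_abs r]
    exact pow_lt_pow_left₀ hr (by positivity) two_ne_zero
  nlinarith [sq_nonneg R, mul_nonneg (sub_nonneg.2 hp1) (mul_nonneg (by positivity : (0 : ℝ) ≤ p)
    (sq_nonneg R))]

/-- The spherical mean in the coordinates `r` and `t = s / r`, as a profile. -/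
def sphProfile {γ : Fin p ⊕ Fin q → ℝ} (hγ : ∀ i, 0 < γ i) (hp : 0 < p)
    (φ : TestFunction (Fin p ⊕ Fin q)) : profile :=
  ⟨fun x => sphMean γ φ (x.1, x.1 * x.2), by
    refine ⟨(contDiff_sphMean hγ φ).comp (by fun_prop), fun r t => ?_, ?_⟩
    -- The sign change of r sends (r, r t) to its negative, under which the mean of an even function
    -- is invariant.
    · simpa using sphMean_neg γ φ (r, r * t)
    · obtain ⟨R, hR, hφ⟩ := φ.exists_evenExt_eq_zero
      refine ⟨p * R, fun r t hr => ?_⟩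
      simp [sphMean, evenExt_scaledCoords_eq_zero hR hφ hp _ _ hr]⟩

theorem integrable_weight_mul_evenExt {γ : Fin p ⊕ Fin q → ℝ} (hγ : ∀ i, 0 < γ i)
    (φ : TestFunction (Fin p ⊕ Fin q)) (y : ℝ × ℝ) :
    Integrable (fun θ => (weight γ (pairCoords θ) : ℂ) *
      φ.evenExt (scaledCoords radii (pairCoords θ) y)) (posSphereMeasure p q) := by
  obtain ⟨R, _, hR⟩ := φ.exists_evenExt_eq_zero
  obtain ⟨C, hC0, hC⟩ := exists_bound_of_continuous_of_eq_zero φ.contDiff_evenExt.continuous hR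
  refine Integrable.of_bound (Measurable.aestronglyMeasurable ?_) C (.of_forall fun θ => ?_)
  · exact (Complex.measurable_ofReal.comp ((measurable_weight γ).comp measurable_pairCoords)).mul
      (φ.contDiff_evenExt.continuous.measurable.comp
        (measurable_scaledCoords radii measurable_pairCoords y))
  · rw [norm_mul, Complex.norm_real, Real.norm_eq_abs]
    calc |weight γ (pairCoords θ)| * _ ≤ 1 * C := by
          gcongr
          exacts [abs_weight_le_one hγ (abs_pairCoords_le θ), hC _]
      _ = C := one_mul C

/-- Positive radii keep the points inside the closed orthant, where the test function and its even
extension agree. -/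
theorem psi_eq_sphMean {γ : Fin p ⊕ Fin q → ℝ} (hγ : ∀ i, 0 < γ i)
    (φ : TestFunction (Fin p ⊕ Fin q)) {r s : ℝ} (hr : 0 < r) (hs : 0 < s) :
    psi γ φ r s = sphMean γ φ (r, s) := by
  have hint := integrable_weight_mul_evenExt hγ φ (r, s)
  unfold psi sphMean
  unfold posSphereMeasure at hint ⊢
  rw [integral_prod _ hint]
  congr 1
  refine setIntegral_congr_fun (measurableSet_posSphere p) fun θ' h' =>
    setIntegral_congr_fun (measurableSet_posSphere q) fun θ'' h'' => ?_
  have h : scaledCoords radii (pairCoords (θ', θ'')) (r, s) =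
      Sum.elim (fun i => r * θ'.1 i) (fun j => s * θ''.1 j) := scaledCoords_radii _ r s
  simp only [h]
  rw [TestFunction.evenExt_of_mem, mul_comm]
  · rfl
  · rintro (i | j)
    · exact (mul_pos hr (h' i)).le
    · exact (mul_pos hs (h'' j)).le

end SphericalMean

/-! ### The integrand of δ^(j) in terms of profiles -/

section ConeDelta

variable {p q : ℕ}

/-- The exponent `q + |γ''| - 1` of the slope variable. -/
def slopeExponent (γ : Fin p ⊕ Fin q → ℝ) : ℝ := (q : ℝ) + ∑ i, γ (Sum.inr i) - 1

theorem homDim_eq (γ : Fin p ⊕ Fin q → ℝ) :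
    homDim γ = ((p : ℝ) + ∑ i, γ (Sum.inl i) - 1) + slopeExponent γ + 2 := by
  unfold homDim slopeExponent
  rw [Fintype.sum_sum_type]
  ring

theorem slopeExponent_nonneg {γ : Fin p ⊕ Fin q → ℝ} (hγ : ∀ i, 0 < γ i) (hq : 1 < q) :
    0 ≤ slopeExponent γ := by
  unfold slopeExponent
  have h1 : (1 : ℝ) < q := by exact_mod_cast hq
  have h2 : 0 ≤ ∑ i, γ (Sum.inr i : Fin p ⊕ Fin q) := Finset.sum_nonneg fun i _ => (hγ _).le
  linarith

theorem two_le_homDim {γ : Fin p ⊕ Fin q → ℝ} (hγ : ∀ i, 0 < γ i) (hp : 1 < p) (hq : 1 < q) :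
    2 ≤ homDim γ := by
  unfold homDim
  have h1 : (1 : ℝ) < q := by exact_mod_cast hq
  have h0 : (1 : ℝ) < p := by exact_mod_cast hp
  have h2 : 0 ≤ ∑ i, γ i := Finset.sum_nonneg fun i _ => (hγ _).le
  linarith

/-- Chain rule with t = s / r: the operator s ∂/∂s acts on functions of t as t ∂/∂t, and as e on
s^e. -/
theorem halfRadialDeriv_rpow_mul (V : profile) (e : ℝ) {r s : ℝ} (hr : 0 < r) (hs : 0 < s)
    {f : ℝ → ℂ} (hf : ∀ s, 0 < s → f s = ((s ^ e : ℝ) : ℂ) * V.1 (r, s / r)) :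
    halfRadialDeriv f s =
      ((s ^ (e - 2) : ℝ) : ℂ) * ((e / 2 : ℂ) • V + slopeEuler V).1 (r, s / r) := by
  have h1 : HasDerivAt (fun s : ℝ => ((s ^ e : ℝ) : ℂ)) ((e * s ^ (e - 1) : ℝ) : ℂ) s :=
    (Real.hasDerivAt_rpow_const (Or.inl hs.ne')).ofReal_comp
  have h2 : HasDerivAt (fun s : ℝ => V.1 (r, s / r)) ((1 / r : ℝ) • sndDeriv V.1 (r, s / r)) s :=
    (hasDerivAt_snd (contDiff_profile V) r (s / r)).scomp s
      (h := fun s => s / r) ((hasDerivAt_id s).div_const r)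
  have h3 : HasDerivAt f _ s := (h1.mul h2).congr_of_eventuallyEq (by
    filter_upwards [lt_mem_nhds hs] with u hu using hf u hu)
  have hs' : (s : ℂ) ≠ 0 := by exact_mod_cast hs.ne'
  have hr' : (r : ℂ) ≠ 0 := by exact_mod_cast hr.ne'
  have e1 : s ^ (e - 1) = s ^ (e - 2) * s := by
    rw [← Real.rpow_add_one hs.ne']; ring_nf
  have e2 : s ^ e = s ^ (e - 2) * s * s := by
    rw [← e1, ← Real.rpow_add_one hs.ne']; ring_nf
  rw [halfRadialDeriv, h3.deriv, e1, e2]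
  simp only [Submodule.coe_add, Submodule.coe_smul, Pi.add_apply, Pi.smul_apply, smul_eq_mul,
    Complex.real_smul]
  rw [show (slopeEuler V).1 = sndEuler V.1 from rfl]
  simp only [sndEuler]
  push_cast
  field_simp

theorem slopeFactor_succ_apply' (b : ℝ) (j : ℕ) (U : profile) :
    slopeFactor b (j + 1) U = (((b + 1) / 2 - (j + 1) : ℂ)) • slopeFactor b j U +
      slopeEuler (slopeFactor b j U) := by
  rw [slopeFactor_succ_apply]
  congr 1
  exact LinearMap.congr_fun (commute_slopeFactor_slopeEuler b j).eq U

/-- Each application lowers the exponent of s by 2, starting from b - 1, so the i-th one contributes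
the constant (b+1)/2 - i, as in `slopeFactor`. -/
theorem halfRadialDeriv_iterate_rpow_mul (b : ℝ) (U : profile) (j : ℕ) {r : ℝ} (hr : 0 < r)
    {f : ℝ → ℂ} (hf : ∀ s, 0 < s → f s = ((s ^ (b - 1) : ℝ) : ℂ) * U.1 (r, s / r)) {s : ℝ}
    (hs : 0 < s) : halfRadialDeriv^[j] f s =
      ((s ^ (b - 1 - 2 * j) : ℝ) : ℂ) * (slopeFactor b j U).1 (r, s / r) := by
  induction j generalizing s with
  | zero =>
    rw [show slopeFactor b 0 U = U from rfl]
    simpa using hf s hs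
  | succ j ih =>
    rw [Function.iterate_succ_apply',
      halfRadialDeriv_rpow_mul (slopeFactor b j U) (b - 1 - 2 * j) hr hs fun s hs => ih hs,
      slopeFactor_succ_apply']
    congr 3
    · push_cast; ring
    · push_cast; ring_nf

/-- At s = r the powers combine: (b - 1 - 2 j) + (p + |γ'| - 1) = N - 2 (j + 1) - 1, which is α - 1
at λ = -(j+1). -/
theorem deltaIntegrand_eq {γ : Fin p ⊕ Fin q → ℝ} (hγ : ∀ i, 0 < γ i) (hp : 0 < p) (j : ℕ)
    (φ : TestFunction (Fin p ⊕ Fin q)) {r : ℝ} (hr : 0 < r) :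
    deltaIntegrand γ j φ r = (r : ℂ) ^ (((homDim γ - 2 * (j + 1) : ℝ) : ℂ) - 1) *
      (slopeFactor (slopeExponent γ) j (sphProfile hγ hp φ)).1 (r, 1) := by
  unfold deltaIntegrand
  rw [halfRadialDeriv_iterate_rpow_mul (slopeExponent γ) (sphProfile hγ hp φ) j hr
    (fun s hs => ?_) hr, div_self hr.ne', mul_right_comm]
  · congr 1
    rw [← Complex.ofReal_one, ← Complex.ofReal_sub, ← Complex.ofReal_cpow hr.le,
      ← Complex.ofReal_mul, ← Real.rpow_add hr]
    congr 2
    rw [homDim_eq]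
    ring
  · have e1 : (q : ℝ) + ∑ i, γ (Sum.inr i) - 2 = slopeExponent γ - 1 := by
      unfold slopeExponent; ring
    have e2 : (sphProfile hγ hp φ).1 (r, s / r) = sphMean γ φ (r, s) := by
      change sphMean γ φ (r, r * (s / r)) = _
      rw [mul_div_cancel₀ _ hr.ne']
    rw [psi_eq_sphMean hγ φ hr hs, mul_comm, e1, e2]

theorem integrableOn_cpow_mul_profile (U : profile) {α : ℂ} (hα : 0 < α.re) :
    IntegrableOn (fun r : ℝ => (r : ℂ) ^ (α - 1) * U.1 (r, 1)) (Set.Ioi 0) := by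
  obtain ⟨C, R, hC, hR0, hR, hCR⟩ := (vanishesToOrder_zero U).exists_bound
  refine Integrable.mono' ((integrableOn_Ioi_indicator_rpow hα R).const_mul C)
    (Measurable.aestronglyMeasurable ?_) ?_
  · exact (Measurable.pow_const (by fun_prop) _).mul
      ((contDiff_profile U).continuous.measurable.comp (by fun_prop))
  · filter_upwards [ae_restrict_mem measurableSet_Ioi] with r hr
    by_cases hrR : r ≤ R
    · simp only [Set.mem_Iic, hrR, Set.indicator_of_mem]
      rw [norm_mul, norm_ofReal_cpow hr, mul_comm, Complex.sub_re, Complex.one_re]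
      have h := hCR r ⟨le_of_lt hr, hrR⟩ 1 ⟨zero_le_one, le_rfl⟩
      rw [pow_zero, mul_one] at h
      exact mul_le_mul_of_nonneg_right h (Real.rpow_nonneg (le_of_lt hr) _)
    · rw [hR r 1 (by rw [abs_of_pos hr]; exact not_le.1 hrR)]
      simp [hrR]

end ConeDelta

end ConePower
end

noncomputable section
namespace ConePower

/-! ### Polar coordinates in both groups of variables -/

section PolarCoordinates

/-- The measure with density `r ^ (d - 1)` on the positive half line. -/
def radialMeasure (d : ℕ) : Measure ℝ :=
  (volume.restrict (Set.Ioi 0)).withDensity fun r => ENNReal.ofReal (r ^ (d - 1))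

instance (d : ℕ) : SFinite (radialMeasure d) := by unfold radialMeasure; infer_instance

theorem map_volumeIoiPow (n : ℕ) :
    (Measure.volumeIoiPow n).map Subtype.val =
      (volume.restrict (Set.Ioi 0)).withDensity fun r : ℝ => ENNReal.ofReal (r ^ n) := by
  ext s hs
  rw [Measure.map_apply measurable_subtype_coe hs, Measure.volumeIoiPow,
    withDensity_apply _ (measurable_subtype_coe hs),
    setLIntegral_subtype measurableSet_Ioi _ fun a : ℝ => ENNReal.ofReal (a ^ n),
    withDensity_apply _ hs, Measure.restrict_restrict hs, Subtype.image_preimage_coe,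
    Set.inter_comm]

/-- Polar coordinates identify the complement of the origin with sphere times half line, and for d >
0 the origin is a null set. -/
theorem measurePreserving_sphere_smul {d : ℕ} (hd : 0 < d) :
    MeasurePreserving
      (fun x : Metric.sphere (0 : EuclideanSpace ℝ (Fin d)) 1 × ℝ => x.2 • x.1.1)
      ((surfaceMeasure d).prod (radialMeasure d)) volume := by
  have : Nonempty (Fin d) := ⟨⟨0, hd⟩⟩
  have h1 := (Measure.measurePreserving_homeomorphUnitSphereProd
    (volume : Measure (EuclideanSpace ℝ (Fin d))))
  have h2 : MeasurePreserving (homeomorphUnitSphereProd (EuclideanSpace ℝ (Fin d))).symm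
      ((surfaceMeasure d).prod (Measure.volumeIoiPow (d - 1)))
      (volume.comap (Subtype.val : ({0}ᶜ : Set (EuclideanSpace ℝ (Fin d))) → EuclideanSpace ℝ (Fin d))) := by
    have := h1.symm (homeomorphUnitSphereProd (EuclideanSpace ℝ (Fin d))).toMeasurableEquiv
    rw [finrank_euclideanSpace_fin] at this
    exact this
  have h3 : MeasurePreserving (Subtype.val : ({0}ᶜ : Set (EuclideanSpace ℝ (Fin d))) → EuclideanSpace ℝ (Fin d))
      (volume.comap Subtype.val) volume := by
    have := measurePreserving_subtype_coe (μa := (volume : Measure (EuclideanSpace ℝ (Fin d))))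
      (measurableSet_singleton (0 : EuclideanSpace ℝ (Fin d))).compl
    rwa [restrict_compl_singleton] at this
  have h4 := h3.comp h2
  refine ⟨by fun_prop, ?_⟩
  rw [radialMeasure, ← map_volumeIoiPow, ← Measure.map_id (μ := surfaceMeasure d),
    Measure.map_prod_map _ _ measurable_id measurable_subtype_coe, Measure.map_map (by fun_prop)
      (by fun_prop), ← h4.map_eq]
  congr 1

theorem measurePreserving_sphere_smul_pi {d : ℕ} (hd : 0 < d) :
    MeasurePreserving
      (fun x : Metric.sphere (0 : EuclideanSpace ℝ (Fin d)) 1 × ℝ => fun i => x.2 * x.1.1 i)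
      ((surfaceMeasure d).prod (radialMeasure d)) volume :=
  (PiLp.volume_preserving_ofLp (Fin d)).comp (measurePreserving_sphere_smul hd)

theorem measurePreserving_prod_prod_comm {A B C D : Type*} [MeasurableSpace A] [MeasurableSpace B]
    [MeasurableSpace C] [MeasurableSpace D] (μA : Measure A) (μB : Measure B) (μC : Measure C)
    (μD : Measure D) [SFinite μA] [SFinite μB] [SFinite μC] [SFinite μD] :
    MeasurePreserving (fun x : (A × B) × (C × D) => ((x.1.1, x.2.1), (x.1.2, x.2.2)))
      ((μA.prod μB).prod (μC.prod μD)) ((μA.prod μC).prod (μB.prod μD)) := by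
  have h1 := measurePreserving_prodAssoc μA μB (μC.prod μD)
  have h2 := (measurePreserving_prodAssoc μB μC μD).symm MeasurableEquiv.prodAssoc
  have h3 := (Measure.measurePreserving_swap (μ := μB) (ν := μC)).prod (MeasurePreserving.id μD)
  have h4 := measurePreserving_prodAssoc μC μB μD
  have h5 := (measurePreserving_prodAssoc μA μC (μB.prod μD)).symm MeasurableEquiv.prodAssoc
  exact h5.comp (((MeasurePreserving.id μA).prod (h4.comp (h3.comp h2))).comp h1)

variable {p q : ℕ}

theorem measurePreserving_polar (hp : 0 < p) (hq : 0 < q) :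
    MeasurePreserving
      (fun x : SpherePair p q × (ℝ × ℝ) => scaledCoords radii (pairCoords x.1) x.2)
      (((surfaceMeasure p).prod (surfaceMeasure q)).prod
        ((radialMeasure p).prod (radialMeasure q))) volume := by
  have h1 := (volume_measurePreserving_sumPiEquivProdPi_symm
    fun _ : Fin p ⊕ Fin q => ℝ).comp
    (((measurePreserving_sphere_smul_pi hp).prod (measurePreserving_sphere_smul_pi hq)).comp
      (measurePreserving_prod_prod_comm (surfaceMeasure p) (surfaceMeasure q) (radialMeasure p)
        (radialMeasure q)))
  convert h1 using 1
  ext ⟨θ, r, s⟩ i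
  rw [scaledCoords_radii]
  rcases i with i | i <;> rfl

end PolarCoordinates
end ConePower
end

noncomputable section
namespace ConePower

/-! ### The substitution s = r t, with Jacobian r -/

section Wedge

/-- The wedge `0 < s < r`. -/
def wedge : Set (ℝ × ℝ) := {y | 0 < y.2 ∧ y.2 < y.1}

theorem measurableSet_wedge : MeasurableSet wedge :=
  (measurableSet_lt measurable_const measurable_snd).inter
    (measurableSet_lt measurable_snd measurable_fst)

/-- The map `(r, t) ↦ (r, r t)`. -/
def slopeMap (x : ℝ × ℝ) : ℝ × ℝ := (x.1, x.1 * x.2)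

theorem image_slopeMap : slopeMap '' halfStrip = wedge := by
  ext ⟨r, s⟩
  constructor
  · rintro ⟨⟨r', t⟩, ⟨hr, ht0, ht1⟩, h⟩
    simp only [Set.mem_Ioi] at hr ht0 ht1
    obtain ⟨rfl, rfl⟩ := Prod.mk.inj h
    exact ⟨mul_pos hr ht0, by simpa using mul_lt_mul_of_pos_left ht1 hr⟩
  · rintro ⟨hs, hr⟩
    simp only at hs hr
    have h0 : 0 < r := hs.trans hr
    exact ⟨(r, s / r), ⟨h0, div_pos hs h0, (div_lt_one h0).2 hr⟩, by
      simp [slopeMap, mul_div_cancel₀ _ h0.ne']⟩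

theorem injOn_slopeMap : Set.InjOn slopeMap halfStrip := by
  rintro ⟨r, t⟩ ⟨hr, _⟩ ⟨r', t'⟩ _ h
  simp only [Set.mem_Ioi] at hr
  obtain ⟨rfl, h2⟩ := Prod.mk.inj h
  simp only at h2
  rw [mul_left_cancel₀ hr.ne' h2]

/-- The derivative of `slopeMap`. -/
def fderivSlopeMap (x : ℝ × ℝ) : ℝ × ℝ →L[ℝ] ℝ × ℝ :=
  (Matrix.toLin (.finTwoProd ℝ) (.finTwoProd ℝ) !![1, 0; x.2, x.1]).toContinuousLinearMap

theorem hasFDerivAt_slopeMap (x : ℝ × ℝ) : HasFDerivAt slopeMap (fderivSlopeMap x) x := by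
  unfold fderivSlopeMap
  rw [Matrix.toLin_finTwoProd_toContinuousLinearMap]
  have h1 : HasFDerivAt (fun x : ℝ × ℝ => x.1) (.fst ℝ ℝ ℝ) x := hasFDerivAt_fst
  have h2 : HasFDerivAt (fun x : ℝ × ℝ => x.2) (.snd ℝ ℝ ℝ) x := hasFDerivAt_snd
  convert! h1.prodMk (h1.mul h2) using 2 <;>
  simp [add_comm]

theorem det_fderivSlopeMap (x : ℝ × ℝ) : (fderivSlopeMap x).det = x.1 := by
  unfold fderivSlopeMap
  simp [LinearMap.det_toContinuousLinearMap, LinearMap.det_toLin, Matrix.det_fin_two_of]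

variable {E : Type*} [NormedAddCommGroup E] [NormedSpace ℝ E]

theorem integrableOn_wedge_iff (f : ℝ × ℝ → E) :
    IntegrableOn f wedge ↔ IntegrableOn (fun x => x.1 • f (slopeMap x)) halfStrip := by
  rw [← image_slopeMap, integrableOn_image_iff_integrableOn_abs_det_fderiv_smul volume
    measurableSet_halfStrip (fun x _ => (hasFDerivAt_slopeMap x).hasFDerivWithinAt) injOn_slopeMap]
  refine integrableOn_congr_fun (fun x hx => ?_) measurableSet_halfStrip
  have : 0 < x.1 := hx.1
  simp only [det_fderivSlopeMap, abs_of_pos this]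

theorem integral_wedge_eq (f : ℝ × ℝ → E) :
    ∫ y in wedge, f y = ∫ x in halfStrip, x.1 • f (slopeMap x) := by
  rw [← image_slopeMap, integral_image_eq_integral_abs_det_fderiv_smul volume
    measurableSet_halfStrip (fun x _ => (hasFDerivAt_slopeMap x).hasFDerivWithinAt) injOn_slopeMap]
  refine setIntegral_congr_fun measurableSet_halfStrip fun x hx => ?_
  have : 0 < x.1 := hx.1
  simp only [det_fderivSlopeMap, abs_of_pos this]

theorem radialMeasure_prod (p q : ℕ) :
    (radialMeasure p).prod (radialMeasure q) =
      (volume.restrict (Set.Ioi 0 ×ˢ Set.Ioi 0)).withDensity fun y : ℝ × ℝ =>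
        ENNReal.ofReal (y.1 ^ (p - 1)) * ENNReal.ofReal (y.2 ^ (q - 1)) := by
  unfold radialMeasure
  rw [prod_withDensity (by fun_prop) (by fun_prop), Measure.prod_restrict,
    ← Measure.volume_eq_prod]

theorem wedge_subset : wedge ⊆ Set.Ioi 0 ×ˢ Set.Ioi 0 := fun _ hy => ⟨hy.1.trans hy.2, hy.1⟩

theorem radial_smul_indicator_eq (p q : ℕ) (f : ℝ × ℝ → E) :
    (fun y : ℝ × ℝ => (ENNReal.ofReal (y.1 ^ (p - 1)) * ENNReal.ofReal (y.2 ^ (q - 1))).toReal •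
      wedge.indicator f y) =
    wedge.indicator fun y => (y.1 ^ (p - 1) * y.2 ^ (q - 1)) • f y := by
  ext y
  by_cases hy : y ∈ wedge
  · have h2 : 0 < y.2 := hy.1
    have h1 : 0 < y.1 := h2.trans hy.2
    rw [Set.indicator_of_mem hy, Set.indicator_of_mem hy, ENNReal.toReal_mul,
      ENNReal.toReal_ofReal (by positivity), ENNReal.toReal_ofReal (by positivity)]
  · simp [hy]

theorem integrable_radial_indicator_iff (p q : ℕ) (f : ℝ × ℝ → E) :
    Integrable (wedge.indicator f) ((radialMeasure p).prod (radialMeasure q)) ↔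
      IntegrableOn (fun x => (x.1 * (x.1 ^ (p - 1) * (x.1 * x.2) ^ (q - 1))) • f (slopeMap x))
        halfStrip := by
  rw [radialMeasure_prod, integrable_withDensity_iff_integrable_smul' (by fun_prop)
    (.of_forall fun y => ENNReal.mul_lt_top ENNReal.ofReal_lt_top ENNReal.ofReal_lt_top),
    radial_smul_indicator_eq, ← IntegrableOn, integrableOn_indicator_iff measurableSet_wedge,
    Set.inter_eq_left.2 wedge_subset, integrableOn_wedge_iff]
  simp only [smul_smul, slopeMap]

theorem integral_radial_indicator (p q : ℕ) (f : ℝ × ℝ → E) :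
    ∫ y, wedge.indicator f y ∂((radialMeasure p).prod (radialMeasure q)) =
      ∫ x in halfStrip, (x.1 * (x.1 ^ (p - 1) * (x.1 * x.2) ^ (q - 1))) • f (slopeMap x) := by
  rw [radialMeasure_prod, integral_withDensity_eq_integral_toReal_smul (by fun_prop)
    (.of_forall fun y => ENNReal.mul_lt_top ENNReal.ofReal_lt_top ENNReal.ofReal_lt_top),
    radial_smul_indicator_eq, setIntegral_indicator measurableSet_wedge,
    Set.inter_eq_right.2 wedge_subset, integral_wedge_eq]
  simp only [smul_smul, slopeMap]

theorem ae_radialMeasure_prod_pos (p q : ℕ) :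
    ∀ᵐ y ∂((radialMeasure p).prod (radialMeasure q)), 0 < y.1 ∧ 0 < y.2 := by
  rw [radialMeasure_prod]
  refine (withDensity_absolutelyContinuous _ _).ae_le ?_
  filter_upwards [ae_restrict_mem (measurableSet_Ioi.prod measurableSet_Ioi)] with y hy using hy

end Wedge

/-! ### The integrand in polar coordinates -/

section PolarIntegrand

variable {p q : ℕ}

/-- The radial factor of the integrand `P ^ l * x ^ γ`. -/
def radialFactor (γ : Fin p ⊕ Fin q → ℝ) (l : ℂ) (y : ℝ × ℝ) : ℂ :=
  ((y.1 ^ 2 - y.2 ^ 2 : ℝ) : ℂ) ^ l *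
    ((y.1 ^ (∑ i, γ (Sum.inl i)) * y.2 ^ (∑ i, γ (Sum.inr i)) : ℝ) : ℂ)

/-- From r² - (r t)² = r² (1 - t²), and the count of powers of r: 1 from the Jacobian, p - 1 and q -
1 from the measures, |γ| from the weight and 2 l from the form, in all 2 l + N - 1. -/
theorem smul_radialFactor (γ : Fin p ⊕ Fin q → ℝ) (hp : 0 < p) (hq : 0 < q) (l : ℂ) {x : ℝ × ℝ}
    (hx : x ∈ halfStrip) :
    (x.1 * (x.1 ^ (p - 1) * (x.1 * x.2) ^ (q - 1))) • radialFactor γ l (slopeMap x) =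
      coneKernel (slopeExponent γ) (2 * l + homDim γ) l x := by
  obtain ⟨r, t⟩ := x
  obtain ⟨hr, ht0, ht1⟩ := hx
  simp only [Set.mem_Ioi] at hr ht0 ht1
  have ht2 : 0 ≤ 1 - t ^ 2 := by nlinarith
  have e1 : ((r ^ 2 - (r * t) ^ 2 : ℝ) : ℂ) ^ l = (r : ℂ) ^ (2 * l) * ((1 - t ^ 2 : ℝ) : ℂ) ^ l := by
    rw [show r ^ 2 - (r * t) ^ 2 = r ^ 2 * (1 - t ^ 2) by ring, Complex.ofReal_mul,
      Complex.mul_cpow_ofReal_nonneg (by positivity) ht2]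
    congr 1
    rw [two_mul, Complex.cpow_add _ _ (by exact_mod_cast hr.ne'), pow_two, Complex.ofReal_mul,
      Complex.mul_cpow_ofReal_nonneg hr.le hr.le]
  have e2 : r * (r ^ (p - 1) * (r * t) ^ (q - 1)) *
      (r ^ (∑ i, γ (Sum.inl i)) * (r * t) ^ (∑ i, γ (Sum.inr i))) =
      r ^ (homDim γ - 1) * t ^ slopeExponent γ := by
    have ep : r ^ (p - 1) = r ^ ((p : ℝ) - 1) := by
      rw [← Real.rpow_natCast, Nat.cast_pred hp]
    have eq : (r * t) ^ (q - 1) = r ^ ((q : ℝ) - 1) * t ^ ((q : ℝ) - 1) := by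
      rw [← Real.rpow_natCast, Nat.cast_pred hq, Real.mul_rpow hr.le ht0.le]
    rw [ep, eq, Real.mul_rpow hr.le ht0.le, homDim_eq]
    have e3 : r ^ ((p : ℝ) + ∑ i, γ (Sum.inl i) - 1 + slopeExponent γ + 2 - 1) =
        r * r ^ ((p : ℝ) - 1) * r ^ ((q : ℝ) - 1) * r ^ (∑ i, γ (Sum.inl i)) *
          r ^ (∑ i, γ (Sum.inr i)) := by
      rw [mul_comm r, ← Real.rpow_add_one hr.ne', ← Real.rpow_add hr, ← Real.rpow_add hr,
        ← Real.rpow_add hr]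
      unfold slopeExponent
      ring_nf
    have e4 : t ^ slopeExponent γ = t ^ ((q : ℝ) - 1) * t ^ (∑ i, γ (Sum.inr i)) := by
      rw [← Real.rpow_add ht0]
      unfold slopeExponent
      ring_nf
    rw [e3, e4]
    ring
  have e5 : (r : ℂ) ^ (2 * l + homDim γ - 1) = (r : ℂ) ^ (2 * l) * ((r ^ (homDim γ - 1) : ℝ) : ℂ) := by
    rw [Complex.ofReal_cpow hr.le, ← Complex.cpow_add _ _ (by exact_mod_cast hr.ne')]
    push_cast
    ring_nf
  unfold radialFactor coneKernel slopeMap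
  simp only
  rw [e1, e5, Complex.real_smul, mul_left_comm, ← Complex.ofReal_mul, e2]
  push_cast
  ring

theorem quadForm_polar (θ : SpherePair p q) (y : ℝ × ℝ) :
    quadForm (scaledCoords radii (pairCoords θ) y) = y.1 ^ 2 - y.2 ^ 2 := by
  obtain ⟨r, s⟩ := y
  rw [scaledCoords_radii]
  simp only [quadForm, Sum.elim_inl, Sum.elim_inr, mul_pow]
  rw [← Finset.mul_sum, ← Finset.mul_sum, sum_sq_sphere, sum_sq_sphere, mul_one, mul_one]

theorem weight_polar (γ : Fin p ⊕ Fin q → ℝ) {θ : SpherePair p q} (h' : θ.1 ∈ posSphere p)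
    (h'' : θ.2 ∈ posSphere q) {y : ℝ × ℝ} (hr : 0 < y.1) (hs : 0 < y.2) :
    weight γ (scaledCoords radii (pairCoords θ) y) =
      y.1 ^ (∑ i, γ (Sum.inl i)) * y.2 ^ (∑ i, γ (Sum.inr i)) * weight γ (pairCoords θ) := by
  obtain ⟨r, s⟩ := y
  rw [scaledCoords_radii]
  simp only [weight, Fintype.prod_sum_type, Sum.elim_inl, Sum.elim_inr, pairCoords] at *
  rw [Finset.prod_congr rfl fun i _ => Real.mul_rpow hr.le (h' i).le,
    Finset.prod_congr rfl fun i _ => Real.mul_rpow hs.le (h'' i).le, Finset.prod_mul_distrib,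
    Finset.prod_mul_distrib, Real.rpow_sum_of_pos hr, Real.rpow_sum_of_pos hs]
  ring

theorem polar_mem_posRegion_iff {θ : SpherePair p q} {y : ℝ × ℝ} (hr : 0 < y.1) (hs : 0 < y.2) :
    scaledCoords radii (pairCoords θ) y ∈ posRegion p q ↔
      θ ∈ posSphere p ×ˢ posSphere q ∧ y ∈ wedge := by
  have h1 : 0 < y.1 ^ 2 - y.2 ^ 2 ↔ y.2 < y.1 := by
    rw [sub_pos, sq_lt_sq₀ hs.le hr.le]
  have h2 : scaledCoords radii (pairCoords θ) y ∈ openOrthant (Fin p ⊕ Fin q) ↔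
      θ ∈ posSphere p ×ˢ posSphere q := by
    obtain ⟨r, s⟩ := y
    rw [scaledCoords_radii]
    simp only [openOrthant, posSphere, Set.mem_ofPred_eq, Sum.forall, Sum.elim_inl, Sum.elim_inr,
      Set.mem_prod]
    simp only at hr hs
    simp only [mul_pos_iff_of_pos_left hr, mul_pos_iff_of_pos_left hs]
  unfold posRegion wedge
  simp only [Set.mem_ofPred_eq, quadForm_polar, h1, h2]
  tauto

end PolarIntegrand
end ConePower
end

noncomputable section
namespace ConePower

/-! ### The power functional as a cone integral -/

section PowerIntegral

variable {p q : ℕ}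

theorem continuous_quadForm : Continuous (quadForm : (Fin p ⊕ Fin q → ℝ) → ℝ) := by
  unfold quadForm
  fun_prop

theorem measurableSet_posRegion (p q : ℕ) : MeasurableSet (posRegion p q) := by
  have h : posRegion p q = (⋂ i, {x | 0 < x i}) ∩ {x | 0 < quadForm x} := by
    ext x
    simp [posRegion, openOrthant]
  rw [h]
  exact (MeasurableSet.iInter fun i => measurableSet_lt measurable_const (measurable_pi_apply i)).inter
    (measurableSet_lt measurable_const continuous_quadForm.measurable)

/-- The function `P ^ l * φ * x ^ γ`, extended by zero. -/
def extPowerIntegrand (γ : Fin p ⊕ Fin q → ℝ) (l : ℂ) (φ : TestFunction (Fin p ⊕ Fin q)) :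
    (Fin p ⊕ Fin q → ℝ) → ℂ :=
  (posRegion p q).indicator fun x => (quadForm x : ℂ) ^ l * φ.evenExt x * (weight γ x : ℂ)

/-- The even extension replaces the test function, whose values off the closed orthant are
arbitrary, so that measurability holds on the whole space. -/
theorem measurable_extPowerIntegrand (γ : Fin p ⊕ Fin q → ℝ) (l : ℂ)
    (φ : TestFunction (Fin p ⊕ Fin q)) : Measurable (extPowerIntegrand γ l φ) := by
  refine Measurable.indicator ?_ (measurableSet_posRegion p q)
  exact (((Complex.measurable_ofReal.comp continuous_quadForm.measurable).pow_const l).mul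
    φ.contDiff_evenExt.continuous.measurable).mul
      (Complex.measurable_ofReal.comp (measurable_weight γ))

theorem extPowerIntegrand_eqOn (γ : Fin p ⊕ Fin q → ℝ) (l : ℂ)
    (φ : TestFunction (Fin p ⊕ Fin q)) :
    extPowerIntegrand γ l φ = (posRegion p q).indicator (powerIntegrand γ l φ) := by
  refine Set.indicator_congr fun x hx => ?_
  rw [powerIntegrand, φ.evenExt_of_mem fun i => (hx.1 i).le]

theorem extPowerIntegrand_polar (γ : Fin p ⊕ Fin q → ℝ) (l : ℂ)
    (φ : TestFunction (Fin p ⊕ Fin q)) (θ : SpherePair p q) {y : ℝ × ℝ} (hr : 0 < y.1)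
    (hs : 0 < y.2) :
    extPowerIntegrand γ l φ (scaledCoords radii (pairCoords θ) y) =
      (posSphere p ×ˢ posSphere q).indicator (fun θ => wedge.indicator (fun y =>
        radialFactor γ l y * ((weight γ (pairCoords θ) : ℂ) *
          φ.evenExt (scaledCoords radii (pairCoords θ) y))) y) θ := by
  unfold extPowerIntegrand
  by_cases hθ : θ ∈ posSphere p ×ˢ posSphere q
  · by_cases hy : y ∈ wedge
    · rw [Set.indicator_of_mem ((polar_mem_posRegion_iff hr hs).2 ⟨hθ, hy⟩),
        Set.indicator_of_mem hθ, Set.indicator_of_mem hy, quadForm_polar,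
        weight_polar γ hθ.1 hθ.2 hr hs, radialFactor]
      push_cast
      ring
    · rw [Set.indicator_of_notMem fun h => hy ((polar_mem_posRegion_iff hr hs).1 h).2,
        Set.indicator_of_mem hθ, Set.indicator_of_notMem hy]
  · rw [Set.indicator_of_notMem fun h => hθ ((polar_mem_posRegion_iff hr hs).1 h).1,
      Set.indicator_of_notMem hθ]

/-- The function equal to `C` for `|r| ≤ R` and to zero elsewhere. -/
def radialCutoff (C R : ℝ) (x : ℝ × ℝ) : ℂ := if |x.1| ≤ R then (C : ℂ) else 0

theorem measurable_radialCutoff (C R : ℝ) : Measurable (radialCutoff C R) :=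
  Measurable.ite (measurableSet_le (by fun_prop) measurable_const) measurable_const
    measurable_const

/-- Supplies a majorant independent of the spherical variables; since the spheres have finite
measure, it gives integrability on the product. -/
theorem integrable_radialFactor_mul_cutoff {γ : Fin p ⊕ Fin q → ℝ} (hγ : ∀ i, 0 < γ i)
    (hp : 1 < p) (hq : 1 < q) {l : ℂ} (hl : -1 < l.re) {C : ℝ} (hC : 0 ≤ C) (R : ℝ) :
    Integrable (wedge.indicator fun y => ‖radialFactor γ l y * radialCutoff C R y‖)
      ((radialMeasure p).prod (radialMeasure q)) := by
  have hN := two_le_homDim hγ hp hq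
  have hα : 0 < (2 * l + homDim γ).re := by simp; linarith
  rw [integrable_radial_indicator_iff]
  have h1 : ∀ x ∈ halfStrip, (x.1 * (x.1 ^ (p - 1) * (x.1 * x.2) ^ (q - 1))) •
      ‖radialFactor γ l (slopeMap x) * radialCutoff C R (slopeMap x)‖ =
      ‖coneKernel (slopeExponent γ) (2 * l + homDim γ) l x * radialCutoff C R x‖ := fun x hx => by
    have hx1 : 0 < x.1 := hx.1
    have hx2 : 0 < x.2 := hx.2.1
    rw [← smul_radialFactor γ (by lia) (by lia) l hx, norm_mul, norm_mul, norm_smul,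
      Real.norm_of_nonneg (by positivity), smul_eq_mul, ← mul_assoc]
    rfl
  rw [integrableOn_congr_fun h1 measurableSet_halfStrip]
  refine Integrable.mono' ((integrableOn_stripBound hα hl R).const_mul
    (C * max 1 R ^ ((2 * l + homDim γ).re - (2 * l + homDim γ).re))) ?_ ?_
  · exact ((measurable_coneKernel _ _ l).mul (measurable_radialCutoff C R)).norm.aestronglyMeasurable
  · filter_upwards [ae_restrict_mem measurableSet_halfStrip] with x hx
    rw [norm_norm]
    refine norm_coneKernel_mul_le (n := 0) (slopeExponent_nonneg hγ hq) hC
      (fun r t h => if_neg (not_le.2 h)) (fun r _ t _ => ?_) (by simp) (by simp) le_rfl hx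
    unfold radialCutoff
    split_ifs <;> simp [abs_of_nonneg hC, hC]

theorem integrable_extPowerIntegrand_polar {γ : Fin p ⊕ Fin q → ℝ} (hγ : ∀ i, 0 < γ i)
    (hp : 1 < p) (hq : 1 < q) {l : ℂ} (hl : -1 < l.re) (φ : TestFunction (Fin p ⊕ Fin q)) :
    Integrable (fun x : SpherePair p q × (ℝ × ℝ) =>
        extPowerIntegrand γ l φ (scaledCoords radii (pairCoords x.1) x.2))
      (((surfaceMeasure p).prod (surfaceMeasure q)).prod
        ((radialMeasure p).prod (radialMeasure q))) := by
  obtain ⟨R, hR, hφ⟩ := φ.exists_evenExt_eq_zero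
  obtain ⟨C, hC0, hC⟩ := exists_bound_of_continuous_of_eq_zero φ.contDiff_evenExt.continuous hφ
  have hM := measurePreserving_polar (p := p) (q := q) (by lia) (by lia)
  refine Integrable.mono' ((integrable_radialFactor_mul_cutoff hγ hp hq hl hC0 (p * R)).comp_snd _)
    ((measurable_extPowerIntegrand γ l φ).comp hM.measurable).aestronglyMeasurable ?_
  filter_upwards [Measure.quasiMeasurePreserving_snd.ae (ae_radialMeasure_prod_pos p q)] with x hx
  rw [extPowerIntegrand_polar γ l φ x.1 hx.1 hx.2]
  refine (norm_indicator_le_norm_self _ _).trans ?_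
  by_cases hy : x.2 ∈ wedge
  swap
  · simp [hy]
  rw [Set.indicator_of_mem hy, Set.indicator_of_mem hy, norm_mul, norm_mul (radialFactor γ l x.2)]
  gcongr
  unfold radialCutoff
  split_ifs with h
  · rw [norm_mul, Complex.norm_real, Complex.norm_real, Real.norm_eq_abs, Real.norm_of_nonneg hC0]
    calc |weight γ (pairCoords x.1)| * _ ≤ 1 * C := by
          gcongr
          exacts [abs_weight_le_one hγ (abs_pairCoords_le _), hC _]
      _ = C := one_mul C
  · rw [show x.2 = (x.2.1, x.2.2) from rfl,
      evenExt_scaledCoords_eq_zero hR hφ (by lia) _ _ (not_le.1 h)]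
    simp

theorem integral_extPowerIntegrand_polar (γ : Fin p ⊕ Fin q → ℝ) (l : ℂ)
    (φ : TestFunction (Fin p ⊕ Fin q)) {y : ℝ × ℝ} (hr : 0 < y.1) (hs : 0 < y.2) :
    ∫ θ, extPowerIntegrand γ l φ (scaledCoords radii (pairCoords θ) y)
        ∂((surfaceMeasure p).prod (surfaceMeasure q)) =
      wedge.indicator (fun y => 2 * (radialFactor γ l y * sphMean γ φ y)) y := by
  simp only [extPowerIntegrand_polar γ l φ _ hr hs]
  rw [integral_indicator ((measurableSet_posSphere p).prod (measurableSet_posSphere q)),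
    ← Measure.prod_restrict, ← posSphereMeasure]
  by_cases hy : y ∈ wedge
  · simp only [Set.indicator_of_mem hy]
    rw [integral_const_mul, sphMean]
    ring
  · simp [hy]

theorem integrableOn_powerIntegrand {γ : Fin p ⊕ Fin q → ℝ} (hγ : ∀ i, 0 < γ i)
    (hp : 1 < p) (hq : 1 < q) {l : ℂ} (hl : -1 < l.re) (φ : TestFunction (Fin p ⊕ Fin q)) :
    IntegrableOn (powerIntegrand γ l φ) (posRegion p q) := by
  rw [← integrable_indicator_iff (measurableSet_posRegion p q), ← extPowerIntegrand_eqOn,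
    ← (measurePreserving_polar (by lia) (by lia)).integrable_comp
      (measurable_extPowerIntegrand γ l φ).aestronglyMeasurable]
  exact integrable_extPowerIntegrand_polar hγ hp hq hl φ

/-- Fubini in polar coordinates: the spherical integral gives 2 ψ, the 2 undoing the 1/2 in the
mean, and the radial integral becomes one over the half strip. -/
theorem integral_powerIntegrand {γ : Fin p ⊕ Fin q → ℝ} (hγ : ∀ i, 0 < γ i)
    (hp : 1 < p) (hq : 1 < q) {l : ℂ} (hl : -1 < l.re) (φ : TestFunction (Fin p ⊕ Fin q)) :
    ∫ x in posRegion p q, powerIntegrand γ l φ x =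
      coneIntegral (slopeExponent γ) (2 * l + homDim γ) l
        (sphProfile hγ (zero_lt_one.trans hp) φ) := by
  have hM := measurePreserving_polar (p := p) (q := q) (by lia) (by lia)
  rw [← integral_indicator (measurableSet_posRegion p q), ← extPowerIntegrand_eqOn,
    ← hM.map_eq, integral_map hM.aemeasurable
      (measurable_extPowerIntegrand γ l φ).aestronglyMeasurable,
    integral_prod_symm _ (integrable_extPowerIntegrand_polar hγ hp hq hl φ)]
  have h1 : ∀ᵐ y ∂((radialMeasure p).prod (radialMeasure q)),
      ∫ θ, extPowerIntegrand γ l φ (scaledCoords radii (pairCoords θ) y)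
        ∂((surfaceMeasure p).prod (surfaceMeasure q)) =
      wedge.indicator (fun y => 2 * (radialFactor γ l y * sphMean γ φ y)) y := by
    filter_upwards [ae_radialMeasure_prod_pos p q] with y hy
    exact integral_extPowerIntegrand_polar γ l φ hy.1 hy.2
  rw [integral_congr_ae h1, integral_radial_indicator, coneIntegral, ← integral_const_mul]
  refine setIntegral_congr_fun measurableSet_halfStrip fun x hx => ?_
  rw [← smul_radialFactor γ (by lia) (by lia) l hx, Complex.real_smul, Complex.real_smul]
  simp only [sphProfile, slopeMap]
  ring

end PowerIntegral
end ConePower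
end

noncomputable section
namespace ConePower

/-! ### Uniqueness of regularized integrals -/

section Uniqueness

/-- Two continuations agree near 0 up to isolated points, and analyticity at 0 forces equal values
there. -/
theorem IsRegularizedIntegral.unique {f : ℝ → ℂ} {L L' : ℂ} (h : IsRegularizedIntegral f L)
    (h' : IsRegularizedIntegral f L') : L = L' := by
  obtain ⟨F, hF, hF0, rfl, c, hc⟩ := h
  obtain ⟨G, hG, hG0, rfl, c', hc'⟩ := h'
  have h1 : F =ᶠ[𝓝[≠] 0] G := eventuallyEq_of_eq_of_re_gt (B := -1) (c := max c c')
    (hF.mono_set (Set.subset_univ _)) (hG.mono_set (Set.subset_univ _))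
    (fun z hz => (hc z ((le_max_left _ _).trans_lt hz)).2.trans
      (hc' z ((le_max_right _ _).trans_lt hz)).2.symm) (by simp)
  exact tendsto_nhds_unique ((hF0.continuousAt.tendsto.mono_left nhdsWithin_le_nhds).congr' h1)
    (hG0.continuousAt.tendsto.mono_left nhdsWithin_le_nhds)

theorem IsConeDelta.unique {p q : ℕ} {γ : Fin p ⊕ Fin q → ℝ} {j : ℕ}
    {D D' : TestFunction (Fin p ⊕ Fin q) → ℂ} (h : IsConeDelta γ j D) (h' : IsConeDelta γ j D') :
    D = D' := by
  ext φ
  rcases lt_or_ge (j : ℝ) ((homDim γ - 2) / 2) with hj | hj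
  · rw [((h φ).1 hj).2, ((h' φ).1 hj).2]
  · exact ((h φ).2 hj).unique ((h' φ).2 hj)

/-- The Mellin transform of a continuous function vanishing near 0 and near infinity is entire, so
regularization changes nothing. The argument z + 1 accounts for the kernel r^(s-1). -/
theorem isRegularizedIntegral_of_eqOn {f g : ℝ → ℂ} (hg : Continuous g) {A B : ℝ} (hA : 0 < A)
    (h1 : ∀ r < A, g r = 0) (h2 : ∀ r, B < r → g r = 0) (hfg : Set.EqOn f g (Set.Ioi 0)) :
    IntegrableOn f (Set.Ioi 0) ∧ IsRegularizedIntegral f (∫ r in Set.Ioi 0, f r) := by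
  have hloc : LocallyIntegrableOn g (Set.Ioi 0) := hg.locallyIntegrable.locallyIntegrableOn _
  have htop : ∀ a : ℝ, g =O[atTop] fun x => x ^ (-a) := fun a =>
    (Asymptotics.isBigO_zero _ _).congr' ((eventually_gt_atTop B).mono fun r hr => (h2 r hr).symm)
      EventuallyEq.rfl
  have hbot : ∀ b : ℝ, g =O[𝓝[>] 0] fun x => x ^ (-b) := fun b =>
    (Asymptotics.isBigO_zero _ _).congr' (((gt_mem_nhds hA).filter_mono nhdsWithin_le_nhds).mono
      fun r hr => (h1 r hr).symm) EventuallyEq.rfl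
  have hconv : ∀ s, MellinConvergent g s := fun s =>
    mellinConvergent_of_isBigO_rpow hloc (htop (s.re + 1)) (lt_add_one _) (hbot (s.re - 1))
      (sub_one_lt _)
  have hdiff : Differentiable ℂ fun z => mellin g (z + 1) := fun z =>
    DifferentiableAt.comp (g := mellin g) (f := fun z : ℂ => z + 1) z
      (mellin_differentiableAt_of_isBigO_rpow hloc (htop ((z + 1).re + 1)) (lt_add_one _)
        (hbot ((z + 1).re - 1)) (sub_one_lt _)) (differentiableAt_id.add_const 1)
  have hmul : ∀ z : ℂ, Set.EqOn (fun r : ℝ => (r : ℂ) ^ z * f r)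
      (fun r : ℝ => (r : ℂ) ^ (z + 1 - 1) • g r) (Set.Ioi 0) := fun z r hr => by
    simp [hfg hr]
  have hint : ∀ z : ℂ, IntegrableOn (fun r : ℝ => (r : ℂ) ^ z * f r) (Set.Ioi 0) := fun z =>
    (integrableOn_congr_fun (hmul z) measurableSet_Ioi).2 (hconv (z + 1))
  refine ⟨by simpa using hint 0, fun z => mellin g (z + 1), fun z _ =>
    (hdiff.analyticAt z).meromorphicAt, hdiff.analyticAt 0, ?_, 0, fun z _ => ⟨hint z, ?_⟩⟩
  · have := setIntegral_congr_fun measurableSet_Ioi (μ := volume) (hmul 0)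
    simp only [mellin, ← this]
    simp
  · exact (setIntegral_congr_fun measurableSet_Ioi (hmul z)).symm

end Uniqueness

/-! ### Explicit test functions and positivity of the spherical weight -/

section EvenTestFunctions

variable {ι : Type} [Fintype ι] [DecidableEq ι]

theorem iteratedDeriv_odd_eq_zero {f : ℝ → ℂ} (hf : ∀ t, f (-t) = f t) {n : ℕ} (hn : Odd n) :
    iteratedDeriv n f 0 = 0 := by
  have h := iteratedDeriv_comp_neg n f 0
  rw [show (fun x => f (-x)) = f from funext hf, neg_zero, hn.neg_one_pow, neg_smul, one_smul] at h
  exact self_eq_neg.1 h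

/-- The test function given by a smooth compactly supported function which is even in each
variable. -/
def TestFunction.ofEven (f : (ι → ℝ) → ℂ) (hf : ContDiff ℝ ∞ f)
    (heven : ∀ i x t, f (Function.update x i (-t)) = f (Function.update x i t))
    (hcpt : ∃ R : ℝ, ∀ x, R < ‖x‖ → f x = 0) : TestFunction ι where
  toFun := f
  smooth := hf.contDiffOn
  even i x _ _ m := by
    have h1 : ContDiff ℝ ∞ fun t : ℝ => f (Function.update x i t) :=
      hf.comp (contDiff_update ∞ x i)
    rw [iteratedDerivWithin_eq_iteratedDeriv (uniqueDiffOn_Ici 0)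
      (h1.contDiffAt.of_le (WithTop.coe_le_coe.2 le_top)) (Set.self_mem_Ici)]
    exact iteratedDeriv_odd_eq_zero (fun t => heven i x t) (odd_two_mul_add_one m)
  compactSupport := hcpt.imp fun R h x _ => h x

end EvenTestFunctions

section SphereWeight

theorem nonempty_posSphere {d : ℕ} (hd : 0 < d) : (posSphere d).Nonempty := by
  have hd' : (0 : ℝ) < d := by exact_mod_cast hd
  refine ⟨⟨WithLp.toLp 2 fun _ => 1 / √d, ?_⟩, fun i => ?_⟩
  · rw [mem_sphere_zero_iff_norm, EuclideanSpace.norm_eq]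
    simp [hd'.ne', Real.sq_sqrt hd'.le]
  · change 0 < 1 / √(d : ℝ)
    positivity

theorem integral_posSphere_weight_pos {d : ℕ} (hd : 0 < d) {e : Fin d → ℝ} (he : ∀ i, 0 < e i) :
    0 < ∫ θ in posSphere d, weight e (fun i => θ.1 i) ∂(surfaceMeasure d) := by
  have hpos : ∀ θ ∈ posSphere d, 0 < weight e (fun i => θ.1 i) := fun θ hθ =>
    Finset.prod_pos fun i _ => Real.rpow_pos_of_pos (hθ i) _
  have hmeas : Measurable fun θ : Metric.sphere (0 : EuclideanSpace ℝ (Fin d)) 1 =>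
      weight e (fun i => θ.1 i) :=
    (measurable_weight e).comp (measurable_pi_lambda _ fun i => (continuous_sphere_coord i).measurable)
  rw [setIntegral_pos_iff_support_of_nonneg_ae]
  · have hsub : posSphere d ⊆ Function.support fun θ => weight e fun i => θ.1 i :=
      fun θ hθ => (hpos θ hθ).ne'
    rw [Set.inter_eq_right.2 hsub]
    have : (surfaceMeasure d).IsOpenPosMeasure :=
      inferInstanceAs (volume : Measure (EuclideanSpace ℝ (Fin d))).toSphere.IsOpenPosMeasure
    exact (isOpen_posSphere d).measure_pos _ (nonempty_posSphere hd)
  · filter_upwards [ae_restrict_mem (measurableSet_posSphere d)] with θ hθ using (hpos θ hθ).le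
  · refine Integrable.of_bound hmeas.aestronglyMeasurable 1 (.of_forall fun θ => ?_)
    exact abs_weight_le_one he fun i => abs_sphere_coord_le θ i

end SphereWeight

section RadialTestFunctions

variable {p q : ℕ}

/-- The test function `A(|x'|²) B(|x''|²)`. -/
def biradial (A B : ℝ → ℝ) (hA : ContDiff ℝ ∞ A) (hB : ContDiff ℝ ∞ B)
    (hA0 : ∀ u, 9 < u → A u = 0) (hB0 : ∀ u, 9 < u → B u = 0) : TestFunction (Fin p ⊕ Fin q) :=
  TestFunction.ofEven (fun x => ((A (∑ i, x (Sum.inl i) ^ 2) * B (∑ j, x (Sum.inr j) ^ 2) : ℝ) : ℂ))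
    (Complex.ofRealCLM.contDiff.comp ((hA.comp (by fun_prop)).mul (hB.comp (by fun_prop))))
    (fun i x t => by
      have h : ∀ k, Function.update x i (-t) k ^ 2 = Function.update x i t k ^ 2 := fun k => by
        rcases eq_or_ne k i with rfl | hk
        · simp
        · simp [hk]
      simp only [h])
    -- The norm is the maximum norm, so one coordinate has square above 9 and the factor containing
    -- it vanishes.
    ⟨3, fun x hx => by
      obtain ⟨k, hk⟩ : ∃ k, 3 < |x k| := by
        by_contra! hcon
        exact absurd ((pi_norm_le_iff_of_nonneg (by norm_num)).2 hcon) (not_le.2 hx)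
      have hk2 : 9 < x k ^ 2 := by
        rw [← sq_abs]
        nlinarith
      rcases k with k | k
      · rw [hA0 _ (hk2.trans_le (Finset.single_le_sum (f := fun i => x (Sum.inl i) ^ 2)
          (fun i _ => sq_nonneg _) (Finset.mem_univ k))), zero_mul, Complex.ofReal_zero]
      · rw [hB0 _ (hk2.trans_le (Finset.single_le_sum (f := fun i => x (Sum.inr i) ^ 2)
          (fun i _ => sq_nonneg _) (Finset.mem_univ k))), mul_zero, Complex.ofReal_zero]⟩

theorem psi_biradial (γ : Fin p ⊕ Fin q → ℝ) {A B : ℝ → ℝ} (hA : ContDiff ℝ ∞ A)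
    (hB : ContDiff ℝ ∞ B) (hA0 : ∀ u, 9 < u → A u = 0) (hB0 : ∀ u, 9 < u → B u = 0) (r s : ℝ) :
    psi γ (biradial A B hA hB hA0 hB0) r s = ((1 / 2 *
      ((∫ θ in posSphere p, weight (fun i => γ (Sum.inl i)) (fun i => θ.1 i) ∂(surfaceMeasure p)) *
      ∫ θ in posSphere q, weight (fun i => γ (Sum.inr i)) (fun i => θ.1 i) ∂(surfaceMeasure q)) *
      (A (r ^ 2) * B (s ^ 2)) : ℝ) : ℂ) := by
  have h1 : ∀ (θ' : Metric.sphere (0 : EuclideanSpace ℝ (Fin p)) 1)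
      (θ'' : Metric.sphere (0 : EuclideanSpace ℝ (Fin q)) 1),
      (biradial A B hA hB hA0 hB0).toFun
        (Sum.elim (fun i => r * θ'.1 i) (fun j => s * θ''.1 j)) *
      (weight γ (Sum.elim (fun i => θ'.1 i) (fun j => θ''.1 j)) : ℂ) =
      ((A (r ^ 2) * B (s ^ 2) * weight (fun i => γ (Sum.inl i)) (fun i => θ'.1 i) *
        weight (fun i => γ (Sum.inr i)) (fun i => θ''.1 i) : ℝ) : ℂ) := fun θ' θ'' => by
    simp only [biradial, TestFunction.ofEven, Sum.elim_inl, Sum.elim_inr, mul_pow,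
      ← Finset.mul_sum, sum_sq_sphere, mul_one, weight, Fintype.prod_sum_type]
    push_cast
    ring
  unfold psi
  simp only [h1, integral_complex_ofReal, integral_const_mul, integral_mul_const]
  push_cast
  ring

end RadialTestFunctions

end ConePower
end

noncomputable section
namespace ConePower

/-! ### The residue is not the zero functional -/

section NonVanishing

theorem halfRadialDeriv_congr {f g : ℝ → ℂ} {r : ℝ} (h : f =ᶠ[𝓝 r] g) :
    halfRadialDeriv f =ᶠ[𝓝 r] halfRadialDeriv g := by
  filter_upwards [h.deriv] with s hs
  rw [halfRadialDeriv, halfRadialDeriv, hs]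

theorem halfRadialDeriv_iterate_congr {f g : ℝ → ℂ} {r : ℝ} (h : f =ᶠ[𝓝 r] g) (j : ℕ) :
    halfRadialDeriv^[j] f =ᶠ[𝓝 r] halfRadialDeriv^[j] g := by
  induction j with
  | zero => exact h
  | succ j ih =>
    rw [Function.iterate_succ_apply', Function.iterate_succ_apply']
    exact halfRadialDeriv_congr ih

/-- With v = s² the operator is d/dv, which fixes exp v; hence one test function serves for every j.
-/
theorem halfRadialDeriv_iterate_exp_sq (C : ℝ) {r : ℝ} (hr : 0 < r) (j : ℕ) :
    halfRadialDeriv^[j] (fun s => ((C * Real.exp (s ^ 2) : ℝ) : ℂ)) =ᶠ[𝓝 r]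
      fun s => ((C * Real.exp (s ^ 2) : ℝ) : ℂ) := by
  induction j with
  | zero => exact EventuallyEq.rfl
  | succ j ih =>
    rw [Function.iterate_succ_apply']
    refine (halfRadialDeriv_congr ih).trans ?_
    filter_upwards [lt_mem_nhds hr] with s hs
    have h1 : HasDerivAt (fun s : ℝ => C * Real.exp (s ^ 2))
        (C * (Real.exp (s ^ 2) * ((2 : ℕ) * s ^ (2 - 1)))) s :=
      ((hasDerivAt_pow 2 s).exp).const_mul C
    have hs' : (s : ℂ) ≠ 0 := by exact_mod_cast hs.ne'
    rw [halfRadialDeriv, h1.ofReal_comp.deriv]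
    push_cast
    field_simp

/-- A bump function which is positive exactly on `(3, 5)`. -/
def innerBump : ContDiffBump (4 : ℝ) := ⟨1 / 2, 1, by norm_num, by norm_num⟩

/-- A bump function supported in `(2, 6)` which is one on `[3, 5]`. -/
def outerBump : ContDiffBump (4 : ℝ) := ⟨1, 2, by norm_num, by norm_num⟩

theorem innerBump_ne_zero_iff {u : ℝ} : innerBump u ≠ 0 ↔ |u - 4| < 1 := by
  rw [← Function.mem_support, innerBump.support_eq, Metric.mem_ball, Real.dist_eq]
  rfl

theorem outerBump_eq_zero {u : ℝ} (hu : 2 ≤ |u - 4|) : outerBump u = 0 :=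
  outerBump.zero_of_le_dist (by rwa [Real.dist_eq])

theorem outerBump_eq_one {u : ℝ} (hu : |u - 4| ≤ 1) : outerBump u = 1 :=
  outerBump.one_of_mem_closedBall (by rwa [Metric.mem_closedBall, Real.dist_eq])

/-- A bump function times `v ^ e * exp v`. -/
def outerProfile (e v : ℝ) : ℝ := outerBump v * (v ^ e * Real.exp v)

theorem contDiff_outerProfile (e : ℝ) : ContDiff ℝ ∞ (outerProfile e) := by
  rw [contDiff_iff_contDiffAt]
  intro v
  rcases lt_or_ge 0 v with hv | hv
  · exact outerBump.contDiff.contDiffAt.mul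
      ((Real.contDiffAt_rpow_const_of_ne hv.ne').mul Real.contDiff_exp.contDiffAt)
  -- The real power may fail to be smooth at v = 0, but the bump vanishes for v < 2.
  · refine (contDiffAt_const (c := (0 : ℝ))).congr_of_eventuallyEq ?_
    filter_upwards [gt_mem_nhds (hv.trans_lt two_pos)] with u hu
    rw [outerProfile, outerBump_eq_zero (by rw [abs_of_neg (by linarith)]; linarith), zero_mul]

theorem outerProfile_sq_mul {e s : ℝ} (hs : 0 < s) (h : |s ^ 2 - 4| ≤ 1) :
    outerProfile (-e / 2) (s ^ 2) * s ^ e = Real.exp (s ^ 2) := by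
  have h1 : (s ^ 2) ^ (-e / 2) * s ^ e = 1 := by
    rw [← Real.rpow_natCast, ← Real.rpow_mul hs.le, ← Real.rpow_add hs]
    norm_num
    rw [show 2 * (-e / 2) + e = 0 by ring, Real.rpow_zero]
  rw [outerProfile, outerBump_eq_one h, one_mul, mul_right_comm, h1, one_mul]

variable {p q : ℕ}

/-- A test function on which the cone functionals do not vanish. -/
def coneTest (e : ℝ) : TestFunction (Fin p ⊕ Fin q) :=
  biradial innerBump (outerProfile e) innerBump.contDiff (contDiff_outerProfile e)
    (fun u hu => by
      by_contra h
      have := (abs_lt.1 (innerBump_ne_zero_iff.1 h)).2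
      linarith)
    (fun u hu => by
      rw [outerProfile, outerBump_eq_zero (by rw [abs_of_pos (by linarith)]; linarith), zero_mul])

/-- The mean of the weight over the product of the spheres. -/
def sphereWeight (γ : Fin p ⊕ Fin q → ℝ) : ℝ := 1 / 2 *
  ((∫ θ in posSphere p, weight (fun i => γ (Sum.inl i)) (fun i => θ.1 i) ∂(surfaceMeasure p)) *
  ∫ θ in posSphere q, weight (fun i => γ (Sum.inr i)) (fun i => θ.1 i) ∂(surfaceMeasure q))

/-- Either the inner bump is zero at r², and the function of s is identically zero, or r² ∈ (3, 5),
and for s near r the outer bump is 1 and its power cancels that of s, leaving a multiple of exp(s²).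
-/
theorem deltaIntegrand_coneTest (γ : Fin p ⊕ Fin q → ℝ) (j : ℕ) {r : ℝ} (hr : 0 < r) :
    deltaIntegrand γ j (coneTest (-((q : ℝ) + ∑ i, γ (Sum.inr i) - 2) / 2)) r =
      ((sphereWeight γ * innerBump (r ^ 2) * Real.exp (r ^ 2) *
        max r 0 ^ ((p : ℝ) + ∑ i, γ (Sum.inl i) - 1) : ℝ) : ℂ) := by
  have h : (fun s : ℝ => psi γ (coneTest (-((q : ℝ) + ∑ i, γ (Sum.inr i) - 2) / 2)) r s *
      ((s ^ ((q : ℝ) + ∑ i, γ (Sum.inr i) - 2) : ℝ) : ℂ)) =ᶠ[𝓝 r]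
      fun s => ((sphereWeight γ * innerBump (r ^ 2) * Real.exp (s ^ 2) : ℝ) : ℂ) := by
    by_cases h0 : innerBump (r ^ 2) = 0
    · refine .of_forall fun s => ?_
      simp only
      rw [coneTest, psi_biradial, h0]
      simp
    · have h1 := innerBump_ne_zero_iff.1 h0
      have h2 : ∀ᶠ s in 𝓝 r, |s ^ 2 - 4| < 1 :=
        (show Continuous fun s : ℝ => |s ^ 2 - 4| by fun_prop).continuousAt.eventually_lt_const h1
      filter_upwards [h2, lt_mem_nhds hr] with s hs hs0
      rw [coneTest, psi_biradial, ← sphereWeight, ← Complex.ofReal_mul, mul_assoc, mul_assoc,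
        outerProfile_sq_mul hs0 hs.le, ← mul_assoc]
  rw [deltaIntegrand, ((halfRadialDeriv_iterate_congr h j).trans
    (halfRadialDeriv_iterate_exp_sq _ hr j)).eq_of_nhds, ← Complex.ofReal_mul, max_eq_left hr.le]

theorem IsConeDelta.exists_ne_zero {γ : Fin p ⊕ Fin q → ℝ} (hγ : ∀ i, 0 < γ i) (hp : 1 < p)
    (hq : 1 < q) {j : ℕ} {D : TestFunction (Fin p ⊕ Fin q) → ℂ} (hD : IsConeDelta γ j D) :
    ∃ φ, D φ ≠ 0 := by
  set a : ℝ := (p : ℝ) + ∑ i, γ (Sum.inl i) - 1 with ha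
  have ha0 : 0 < a := by
    have h1 : (1 : ℝ) < p := by exact_mod_cast hp
    have h2 : 0 ≤ ∑ i, γ (Sum.inl i : Fin p ⊕ Fin q) := Finset.sum_nonneg fun i _ => (hγ _).le
    linarith
  have hK : 0 < sphereWeight γ := by
    unfold sphereWeight
    have h1 := integral_posSphere_weight_pos (zero_lt_one.trans hp) fun i => hγ (Sum.inl i)
    have h2 := integral_posSphere_weight_pos (zero_lt_one.trans hq) fun i => hγ (Sum.inr i)
    positivity
  -- `max r 0` makes `g` continuous on the whole line and zero for r ≤ 0; its support lies between
  -- √3 and √5, hence inside [1, 3].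
  set g : ℝ → ℝ := fun r => sphereWeight γ * innerBump (r ^ 2) * Real.exp (r ^ 2) * max r 0 ^ a
  have hg0 : ∀ r, 0 ≤ g r := fun r => mul_nonneg (mul_nonneg (mul_nonneg hK.le innerBump.nonneg)
    (Real.exp_pos _).le) (Real.rpow_nonneg (le_max_right _ _) _)
  have hgc : Continuous g :=
    ((continuous_const.mul (innerBump.continuous.comp (by fun_prop))).mul (by fun_prop)).mul
      ((by fun_prop : Continuous fun r : ℝ => max r 0).rpow_const fun _ => Or.inr ha0.le)
  have hgz : ∀ r, 0 < r → ¬ |r ^ 2 - 4| < 1 → g r = 0 := fun r _ h => by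
    simp only [g]
    rw [not_not.1 fun h' => h (innerBump_ne_zero_iff.1 h')]
    simp
  have h1 : ∀ r < 1, g r = 0 := fun r hr => by
    rcases le_or_gt r 0 with h | h
    · simp only [g]
      rw [max_eq_right h, Real.zero_rpow ha0.ne', mul_zero]
    · exact hgz r h fun h' => by have := (abs_lt.1 h').1; nlinarith
  have h2 : ∀ r, 3 < r → g r = 0 := fun r hr =>
    hgz r (by linarith) fun h' => by have := (abs_lt.1 h').2; nlinarith
  set φ : TestFunction (Fin p ⊕ Fin q) := coneTest (-((q : ℝ) + ∑ i, γ (Sum.inr i) - 2) / 2)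
  have hEq : Set.EqOn (deltaIntegrand γ j φ) (fun r => (g r : ℂ)) (Set.Ioi 0) :=
    fun r hr => deltaIntegrand_coneTest γ j hr
  obtain ⟨hint, hreg⟩ := isRegularizedIntegral_of_eqOn (g := fun r => (g r : ℂ))
    (Complex.continuous_ofReal.comp hgc) one_pos (fun r hr => by rw [h1 r hr, Complex.ofReal_zero])
    (fun r hr => by rw [h2 r hr, Complex.ofReal_zero]) hEq
  have hDφ : D φ = ∫ r in Set.Ioi 0, deltaIntegrand γ j φ r := by
    rcases lt_or_ge (j : ℝ) ((homDim γ - 2) / 2) with hj | hj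
    · exact ((hD φ).1 hj).2
    · exact ((hD φ).2 hj).unique hreg
  have hgint : IntegrableOn g (Set.Ioi 0) := by
    have := ((integrableOn_congr_fun hEq measurableSet_Ioi).1 hint).re
    exact this
  refine ⟨φ, ?_⟩
  rw [hDφ, setIntegral_congr_fun measurableSet_Ioi hEq, integral_complex_ofReal]
  refine Complex.ofReal_ne_zero.2 (ne_of_gt ?_)
  rw [setIntegral_pos_iff_support_of_nonneg_ae (.of_forall hg0) hgint]
  -- The squares of points of this interval lie between 3.61 and 4.41, inside the region (3, 5)
  -- where the inner bump is nonzero.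
  have hsub : Set.Ioo (19 / 10 : ℝ) (21 / 10) ⊆ Function.support g ∩ Set.Ioi 0 := by
    rintro r ⟨hr1, hr2⟩
    have hr0 : 0 < r := by linarith
    refine ⟨?_, hr0⟩
    have hb : innerBump (r ^ 2) ≠ 0 :=
      innerBump_ne_zero_iff.2 (abs_lt.2 ⟨by nlinarith, by nlinarith⟩)
    have hr' : max r 0 ^ a ≠ 0 := by
      rw [max_eq_left hr0.le]
      exact (Real.rpow_pos_of_pos hr0 _).ne'
    exact mul_ne_zero (mul_ne_zero (mul_ne_zero hK.ne' hb) (Real.exp_pos _).ne') hr'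
  refine lt_of_lt_of_le ?_ (measure_mono hsub)
  rw [Real.volume_Ioo]
  norm_num

end NonVanishing

end ConePower
end

noncomputable section
namespace ConePower

/-! ### Existence of both functionals, and the condition on N -/

section Existence

variable {p q : ℕ}

theorem exists_isPowerFunctional {γ : Fin p ⊕ Fin q → ℝ} (hγ : ∀ i, 0 < γ i) (hp : 1 < p)
    (hq : 1 < q) : ∃ T, IsPowerFunctional γ T := by
  choose F hF hFI using fun φ : TestFunction (Fin p ⊕ Fin q) =>
    exists_meromorphic_coneIntegral (slopeExponent_nonneg hγ hq)
      (sphProfile hγ (zero_lt_one.trans hp) φ) (two_le_homDim hγ hp hq)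
  refine ⟨fun l φ => F φ l, fun φ => ⟨hF φ, fun l hl =>
    ⟨integrableOn_powerIntegrand hγ hp hq hl φ,
      (hFI φ l hl).trans (integral_powerIntegrand hγ hp hq hl φ).symm⟩⟩⟩

/-- The regularized integral over the cone, as a continuation in the radial exponent. -/
def coneDelta {γ : Fin p ⊕ Fin q → ℝ} (hγ : ∀ i, 0 < γ i) (hp : 0 < p) (j m : ℕ)
    (φ : TestFunction (Fin p ⊕ Fin q)) : ℂ :=
  coneExt (slopeExponent γ) m 0 ((homDim γ - 2 * (j + 1) : ℝ) : ℂ) 0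
    (slopeBoundary (slopeExponent γ) (slopeFactor (slopeExponent γ) j (sphProfile hγ hp φ)))

/-- Multiplying the integrand by r^z shifts the radial exponent to z + β, and by the boundary
identity the integral is a cone integral with λ = 0; regularizing in z is therefore continuation in
the radial exponent. -/
theorem isConeDelta_coneDelta {γ : Fin p ⊕ Fin q → ℝ} (hγ : ∀ i, 0 < γ i) (hp : 0 < p)
    (hq : 1 < q) {j m : ℕ} (hm : 0 < homDim γ - 2 * (j + 1) + 2 * m)
    (hres : ∀ i : ℕ, homDim γ - 2 * (j + 1) ≠ -(2 * i)) :
    IsConeDelta γ j (coneDelta hγ hp j m) := by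
  intro φ
  have hb := slopeExponent_nonneg hγ hq
  set V := slopeFactor (slopeExponent γ) j (sphProfile hγ hp φ) with hV
  set β : ℝ := homDim γ - 2 * (j + 1) with hβ
  have hmul : ∀ z : ℂ, Set.EqOn (fun r : ℝ => (r : ℂ) ^ z * deltaIntegrand γ j φ r)
      (fun r : ℝ => (r : ℂ) ^ ((z + β) - 1) * V.1 (r, 1)) (Set.Ioi 0) := fun z r hr => by
    have hr0 : (r : ℂ) ≠ 0 := by exact_mod_cast (ne_of_gt hr)
    simp only
    rw [deltaIntegrand_eq hγ hp j φ hr, ← mul_assoc, ← Complex.cpow_add _ _ hr0, add_sub_assoc]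
  have hint : ∀ z : ℂ, 0 < z.re + β →
      IntegrableOn (fun r : ℝ => (r : ℂ) ^ z * deltaIntegrand γ j φ r) (Set.Ioi 0) ∧
      coneIntegral (slopeExponent γ) (z + β) 0 (slopeBoundary (slopeExponent γ) V) =
        ∫ r in Set.Ioi (0 : ℝ), (r : ℂ) ^ z * deltaIntegrand γ j φ r := fun z hz => by
    refine ⟨(integrableOn_congr_fun (hmul z) measurableSet_Ioi).2
      (integrableOn_cpow_mul_profile V (by simpa using hz)), ?_⟩
    rw [setIntegral_congr_fun measurableSet_Ioi (hmul z), slopeBoundary_apply]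
    exact (vanishesToOrder_zero V).coneIntegral_slope_boundary hb (by simpa using hz)
  refine ⟨fun hj => ?_, fun _ => ?_⟩
  -- The condition j < (N - 2)/2 is exactly β > 0, where no continuation is needed.
  · have hβ0 : 0 < β := by simp only [hβ]; linarith
    obtain ⟨h1, h2⟩ := hint 0 (by simpa using hβ0)
    simp only [Complex.cpow_zero, one_mul, zero_add] at h1 h2
    refine ⟨h1, ?_⟩
    rw [← h2, coneDelta, coneExt_eq hb _ (by rwa [Complex.ofReal_re]) (by simp)]
  · obtain ⟨F, hF, hF0, hFv, hFI⟩ := exists_meromorphic_regularization hb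
      (slopeBoundary (slopeExponent γ) V) hm hres
    refine ⟨F, hF, hF0, hFv, max 0 (-β), fun z hz => ?_⟩
    have h := hint z (by linarith [(max_lt_iff.1 hz).2])
    exact ⟨h.1, (hFI z hz).trans h.2⟩

/-- Equality would make N = 2 (k - i) an even natural number with k ≥ N/2, which each alternative
excludes. -/
theorem homDim_sub_ne_of_cases {γ : Fin p ⊕ Fin q → ℝ} {k : ℕ}
    (hcase : (∀ m : ℕ, homDim γ ≠ (m : ℝ)) ∨ (∃ m : ℕ, homDim γ = 2 * (m : ℝ) + 1) ∨
      ((∃ m : ℕ, homDim γ = 2 * (m : ℝ)) ∧ (k : ℝ) < homDim γ / 2)) (hN : 0 ≤ homDim γ) (i : ℕ) :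
    homDim γ - 2 * k ≠ -(2 * i) := by
  intro h
  have h1 : homDim γ = 2 * ((k : ℝ) - i) := by linarith
  have hik : (i : ℝ) ≤ k := by linarith
  have hik' : i ≤ k := by exact_mod_cast hik
  have h2 : homDim γ = ((2 * (k - i) : ℕ) : ℝ) := by
    rw [h1]; push_cast [hik']; ring
  rcases hcase with hc | ⟨m, hm⟩ | ⟨_, hc⟩
  · exact hc _ h2
  · rw [h2] at hm
    have hm' : 2 * (k - i) = 2 * m + 1 := by exact_mod_cast hm
    lia
  · have : (0 : ℝ) ≤ i := i.cast_nonneg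
    linarith

end Existence

end ConePower
end

theorem theorem1 (p q : ℕ) (hp : 1 < p) (hq : 1 < q)
    (γ : Fin p ⊕ Fin q → ℝ) (hγ : ∀ i, 0 < γ i) (k : ℕ) (hk : 1 ≤ k)
    (hcase : (∀ m : ℕ, ConePower.homDim γ ≠ (m : ℝ)) ∨
      (∃ m : ℕ, ConePower.homDim γ = 2 * (m : ℝ) + 1) ∨
      ((∃ m : ℕ, ConePower.homDim γ = 2 * (m : ℝ)) ∧ (k : ℝ) < ConePower.homDim γ / 2)) :
    (∃ T, ConePower.IsPowerFunctional γ T) ∧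
    (∃ D, ConePower.IsConeDelta γ (k - 1) D) ∧
    ∀ T D, ConePower.IsPowerFunctional γ T → ConePower.IsConeDelta γ (k - 1) D →
      ConePower.HasSimplePoleWithResidue T (-(k : ℂ))
        (fun φ => (-1 : ℂ) ^ (k - 1) / ((k - 1).factorial : ℂ) * D φ) := by
  obtain ⟨j, rfl⟩ : ∃ j, k = j + 1 := ⟨k - 1, by lia⟩
  have hN := ConePower.two_le_homDim hγ hp hq
  have hp0 : 0 < p := zero_lt_one.trans hp
  have hres : ∀ i : ℕ, ConePower.homDim γ - 2 * ((j : ℝ) + 1) ≠ -(2 * i) := fun i => by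
    have := ConePower.homDim_sub_ne_of_cases hcase (by linarith) i
    push_cast at this
    exact this
  -- With m = j + 1 the sum is N itself, which is at least 2.
  obtain ⟨m, hm⟩ : ∃ m : ℕ, 0 < ConePower.homDim γ - 2 * ((j : ℝ) + 1) + 2 * m :=
    ⟨j + 1, by push_cast; linarith⟩
  rw [Nat.add_sub_cancel]
  have hΔ := ConePower.isConeDelta_coneDelta hγ hp0 hq hm hres
  refine ⟨ConePower.exists_isPowerFunctional hγ hp hq, ⟨_, hΔ⟩, fun T D hT hD => ⟨fun φ => ?_, ?_⟩⟩
  · refine ⟨(hT φ).1 _ trivial, ?_⟩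
    have h := ConePower.tendsto_meromorphic_coneIntegral (ConePower.slopeExponent_nonneg hγ hq)
      (ConePower.sphProfile hγ hp0 φ) hN (hT φ).1 (fun l hl => by
        rw [((hT φ).2 l hl).2, ConePower.integral_powerIntegrand hγ hp hq hl]) j m hm hres
    -- An arbitrary `D` satisfying the definition equals the explicit continuation, for which the
    -- residue was computed.
    rw [hD.unique hΔ]
    push_cast
    simpa only [sub_neg_eq_add, ConePower.coneDelta] using h
  · obtain ⟨φ, hφ⟩ := hD.exists_ne_zero hγ hp hq
    refine ⟨φ, mul_ne_zero (div_ne_zero (pow_ne_zero _ (by norm_num)) ?_) hφ⟩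
    exact_mod_cast j.factorial_ne_zero
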